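/- **Proposition 4.9 (density of the Schwartz class).** Let $d\ge 1$ and $\alpha>0$. For $\phi\in\mathcal S(\mathbb R^d)$, $x\in\mathbb R^d$, $\xi\in\mathbb R^d\setminus\{0\}$ put $$\phi_{x,\xi}(t)=|\xi|^{\frac d2(1-\alpha)}\,\phi\bigl(|\xi|^{1-\alpha}(t-x)\bigr)\,e^{it\cdot\xi},$$ and, for a constant $C>0$, $Q_\alpha(x,\xi;1)=\{(y,\eta):|y-x|\le C|\xi|^{\alpha-1},\ |\eta-\xi|\le C|\xi|^{1-\alpha}\}$. For $w=(x,\xi)$, $z=(y,\eta)$ let $\mathbf d_\alpha(w,z)=r^{1-\alpha}|x-y|+r^{\alpha-1}|\xi-\eta|$ with $r=1+\min\{|\xi|,|\eta|\}$. Let $(\phi,\Omega_\alpha)$ be an $\alpha$-admissible pair, that is: * $\phi\in\mathcal S(\mathbb R^d)$ and $\widehat\phi$ is supported in an annulus $\{c_1\le|\zeta|\le c_2\}$, $0<c_1<c_2<\infty$; * $\Omega_\alpha=\{(x_j^k,\xi_k)\}_{j\in\mathbb Z^d,\,k\in\mathbb N}\subset\mathbb R^d\times(\mathbb R^d\setminus\{0\})$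 and, for some block constant $C>0$, the blocks $Q_\alpha(x_j^k,\xi_k;1)$ cover $\{(x,\xi):|\xi|^\alpha\ge1\}$, each point of phase space lies in at most $N$ of these blocks, and each $\eta\in\mathbb R^d$ lies in at most $N$ of the frequency balls $\{|\eta-\xi_k|\le C|\xi_k|^{1-\alpha}\}$, for some finite $N$; * $\{\phi_{x_j^k,\xi_k}\}_{j,k}$ is a frame of $L^2(\mathbb R^d)$. For $f\in\mathcal S'(\mathbb R^d)$ let $c_{j,k}(f)=\langle f,\phi_{x_j^k,\xi_k}\rangle$ (the pairing being antilinear in the second argument) and, for $\beta\in\mathbb R$ and $1\le p,q<\infty$, $$\|f\|_{M^{p,q}_{\alpha,\beta}}=\Bigl(\sum_{k}\Bigl(\sum_{j\in\mathbb Z^d}|c_{j,k}(f)|^p\Bigr)^{q/p}(1+|\xi_k|)^{\beta q}\Bigr)^{1/q},\qquad M^{p,q}_{\alpha,\beta}=\{f\in\mathcal S'(\mathbb R^d):\|f\|_{M^{p,q}_{\alpha,\beta}}<\infty\}.$$ Then, for all $\beta\in\mathbb R$ and $1\le p,q<\infty$, $\mathcal S(\mathbb R^d)$ is contained in $M^{p,q}_{\alpha,\beta}$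 and is dense in it: for every $f\in M^{p,q}_{\alpha,\beta}$ and $\varepsilon>0$ there is $g\in\mathcal S(\mathbb R^d)$ with $\|f-g\|_{M^{p,q}_{\alpha,\beta}}<\varepsilon$. Moreover the approximations are given by truncated expansions in the localized dual frame: the canonical dual frame $\{\widetilde\phi_{j,k}\}$ of $\{\phi_{x_j^k,\xi_k}\}$ in $L^2(\mathbb R^d)$ consists of Schwartz functions; for every $N$ there is $C_N$ such that $|\langle\widetilde\phi_{j,k},\widetilde\phi_{j',k'}\rangle|$ and $|\langle\widetilde\phi_{j,k},\phi_{x_{j'}^{k'},\xi_{k'}}\rangle|$ are at most $C_N\bigl(1+\mathbf d_\alpha((x_j^k,\xi_k),(x_{j'}^{k'},\xi_{k'}))\bigr)^{-N}$ for all indices; and for all $\beta\in\mathbb R$, $1\le p,q<\infty$ and $f\in M^{p,q}_{\alpha,\beta}$, $$\Bigl\|f-\sum_{(j,k)\in F}c_{j,k}(f)\,\widetilde\phi_{j,k}\Bigr\|_{M^{p,q}_{\alpha,\beta}}\longrightarrow 0$$ as the finite set $F\subset\mathbb Z^d\times\mathbb N$ increases to $\mathbb Z^d\times\mathbb N$.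 -/

import Mathlib

open scoped SchwartzMap ENNReal FourierTransform Topology
open MeasureTheory Filter

noncomputable section

namespace Dispersive

/-- The space `ℝ^d` with its Euclidean norm. -/
abbrev Space (d : ℕ) : Type := EuclideanSpace ℝ (Fin d)

/-! ### Modulations and dispersive wave packets -/

/-- The character `t ↦ e^{i t·ξ}` has temperate growth, so that multiplication by it acts on the
Schwartz space. -/
theorem character_hasTemperateGrowth {d : ℕ} (ξ : Space d) :
    (fun t : Space d => Complex.exp (Complex.I * (inner ℝ t ξ : ℝ))).HasTemperateGrowth := by
  have key : ∀ n : ℕ, ∀ s : ℝ,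
      iteratedDeriv n (fun s : ℝ => Complex.exp (Complex.I * s)) s
        = Complex.I ^ n * Complex.exp (Complex.I * s) := by
    intro n
    induction n with
    | zero => intro s; simp
    | succ n ih =>
      intro s
      rw [iteratedDeriv_succ, funext ih]
      have h1 : HasDerivAt (fun s : ℝ => Complex.I * (s : ℂ)) (Complex.I * 1) s :=
        (Complex.ofRealCLM.hasDerivAt (x := s)).const_mul Complex.I
      have h2 := (h1.cexp).const_mul (Complex.I ^ n)
      rw [h2.deriv]
      ring
  have h : (fun s : ℝ => Complex.exp (Complex.I * s)).HasTemperateGrowth := by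
    refine ⟨?_, fun n => ⟨0, 1, fun s => ?_⟩⟩
    · exact Complex.contDiff_exp.comp (contDiff_const.mul Complex.ofRealCLM.contDiff)
    · rw [norm_iteratedFDeriv_eq_norm_iteratedDeriv, key, mul_comm Complex.I (s : ℂ)]
      simp [Complex.norm_exp_ofReal_mul_I]
  exact h.comp (Function.hasTemperateGrowth_inner_left ξ)

/-- The dispersive wave packet
`φ_{x,ξ}(t) = |ξ|^{(d/2)(1-α)} φ(|ξ|^{1-α} (t - x)) e^{i t·ξ}`, for `ξ ≠ 0`, as a Schwartz
function; see `packet_apply`. -/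
def packet {d : ℕ} (α : ℝ) (φ : 𝓢(Space d, ℂ)) (x ξ : Space d) (hξ : ξ ≠ 0) :
    𝓢(Space d, ℂ) :=
  ((‖ξ‖ ^ ((d : ℝ) / 2 * (1 - α)) : ℝ) : ℂ) •
    SchwartzMap.smulLeftCLM ℂ
      (fun t : Space d => Complex.exp (Complex.I * (inner ℝ t ξ : ℝ)))
      (SchwartzMap.compSubConstCLM ℂ x
        (SchwartzMap.compCLMOfContinuousLinearEquiv ℂ
          (ContinuousLinearEquiv.smulLeft
            (Units.mk0 (‖ξ‖ ^ (1 - α)) (Real.rpow_pos_of_pos (norm_pos_iff.2 hξ) _).ne') :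
              Space d ≃L[ℝ] Space d) φ))

theorem packet_apply {d : ℕ} (α : ℝ) (φ : 𝓢(Space d, ℂ)) (x ξ : Space d) (hξ : ξ ≠ 0)
    (t : Space d) :
    packet α φ x ξ hξ t =
      ((‖ξ‖ ^ ((d : ℝ) / 2 * (1 - α)) : ℝ) : ℂ) * φ (‖ξ‖ ^ (1 - α) • (t - x)) *
        Complex.exp (Complex.I * (inner ℝ t ξ : ℝ)) := by
  simp only [packet, smul_apply,
    SchwartzMap.smulLeftCLM_apply_apply (character_hasTemperateGrowth ξ), smul_eq_mul,
    SchwartzMap.compSubConstCLM_apply, SchwartzMap.compCLMOfContinuousLinearEquiv_apply,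
    Function.comp_apply, ContinuousLinearEquiv.smulLeft_apply_apply]
  rw [Units.smul_def, Units.val_mk0]
  ring

/-- The complex conjugate of a Schwartz function. -/
def conj {d : ℕ} (φ : 𝓢(Space d, ℂ)) : 𝓢(Space d, ℂ) :=
  SchwartzMap.postcompCLM (𝕜 := ℝ) (Complex.conjCLE : ℂ →L[ℝ] ℂ) φ

theorem conj_apply {d : ℕ} (φ : 𝓢(Space d, ℂ)) (t : Space d) :
    conj φ t = starRingEnd ℂ (φ t) := rfl

/-- The sesquilinear pairing `⟨f, φ⟩` of a tempered distribution with a Schwartz function: it is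
antilinear in `φ`, and equals `∫ f(t) conj(φ(t)) dt` when `f` is a function. -/
def pair {d : ℕ} (f : 𝓢'(Space d, ℂ)) (φ : 𝓢(Space d, ℂ)) : ℂ := f (conj φ)

/-- The tempered distribution `φ ↦ ∫ g(t) φ(t) dt` defined by a Schwartz function `g`. -/
def ofSchwartz {d : ℕ} (g : 𝓢(Space d, ℂ)) : 𝓢'(Space d, ℂ) :=
  SchwartzMap.toTemperedDistributionCLM (Space d) ℂ volume g

/-! ### Subdyadic geometry of phase space -/

/-- The block `Q_α(x, ξ; ρ) = {(y, η) : |y - x| ≤ C ρ |ξ|^{α-1}, |η - ξ| ≤ C ρ |ξ|^{1-α}}`. -/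
def block {d : ℕ} (α C ρ : ℝ) (x ξ : Space d) : Set (Space d × Space d) :=
  {z | ‖z.1 - x‖ ≤ C * ρ * ‖ξ‖ ^ (α - 1) ∧ ‖z.2 - ξ‖ ≤ C * ρ * ‖ξ‖ ^ (1 - α)}

/-- The anisotropic quasi-distance
`d_α((x, ξ), (y, η)) = r^{1-α} |x - y| + r^{α-1} |ξ - η|`, with `r = 1 + min (|ξ|, |η|)`. -/
def quasiDist {d : ℕ} (α : ℝ) (w z : Space d × Space d) : ℝ :=
  (1 + min ‖w.2‖ ‖z.2‖) ^ (1 - α) * ‖w.1 - z.1‖ + (1 + min ‖w.2‖ ‖z.2‖) ^ (α - 1) * ‖w.2 - z.2‖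

/-- A family of phase-space points `(x_j^k, ξ_k)`, `j ∈ ℤ^d`, `k ∈ ℕ`, with `ξ_k ≠ 0`. -/
structure Lattice (d : ℕ) where
  pos : (Fin d → ℤ) → ℕ → Space d
  freq : ℕ → Space d
  freq_ne_zero : ∀ k, freq k ≠ 0

/-- The index set `ℤ^d × ℕ` of a lattice. -/
abbrev Index (d : ℕ) : Type := (Fin d → ℤ) × ℕ

/-- The point `(x_j^k, ξ_k)`. -/
def Lattice.point {d : ℕ} (Ω : Lattice d) (i : Index d) : Space d × Space d :=
  (Ω.pos i.1 i.2, Ω.freq i.2)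

/-- The wave packet `φ_{x_j^k, ξ_k}`. -/
def Lattice.packet {d : ℕ} (Ω : Lattice d) (α : ℝ) (φ : 𝓢(Space d, ℂ)) (i : Index d) :
    𝓢(Space d, ℂ) :=
  Dispersive.packet α φ (Ω.pos i.1 i.2) (Ω.freq i.2) (Ω.freq_ne_zero i.2)

/-- `α`-admissible lattices: for a suitable block constant `C`, the blocks `Q_α(x_j^k, ξ_k; 1)`
cover `{(x, ξ) : |ξ|^α ≥ 1}` and have finite overlap, and the subdyadic frequency balls of centre
`ξ_k` and radius `C |ξ_k|^{1-α}` have finite overlap. -/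
structure Lattice.IsAdmissible {d : ℕ} (Ω : Lattice d) (α C : ℝ) : Prop where
  pos_const : 0 < C
  cover : ∀ x ξ : Space d, 1 ≤ ‖ξ‖ ^ α →
    ∃ i : Index d, (x, ξ) ∈ block α C 1 (Ω.pos i.1 i.2) (Ω.freq i.2)
  overlap : ∃ N : ℕ, ∀ z : Space d × Space d,
    {i : Index d | z ∈ block α C 1 (Ω.pos i.1 i.2) (Ω.freq i.2)}.encard ≤ N
  freq_overlap : ∃ N : ℕ, ∀ η : Space d,
    {k : ℕ | ‖η - Ω.freq k‖ ≤ C * ‖Ω.freq k‖ ^ (1 - α)}.encard ≤ N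

/-! ### Frames -/

/-- A frame of a Hilbert space: `A ‖f‖² ≤ ∑ |⟨f, v_i⟩|² ≤ B ‖f‖²` for some `0 < A ≤ B < ∞`. -/
def IsFrame {ι H : Type*} [NormedAddCommGroup H] [InnerProductSpace ℂ H] (v : ι → H) : Prop :=
  ∃ A B : ℝ, 0 < A ∧ A ≤ B ∧ ∀ f : H, Summable (fun i => ‖inner ℂ (v i) f‖ ^ 2) ∧
    A * ‖f‖ ^ 2 ≤ ∑' i, ‖inner ℂ (v i) f‖ ^ 2 ∧ ∑' i, ‖inner ℂ (v i) f‖ ^ 2 ≤ B * ‖f‖ ^ 2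

/-- `u` is the canonical dual of the frame `v`: `S u_i = v_i` for all `i`, where
`S f = ∑_j ⟨f, v_j⟩ v_j` is the frame operator. -/
def IsCanonicalDual {ι H : Type*} [NormedAddCommGroup H] [InnerProductSpace ℂ H]
    (v u : ι → H) : Prop :=
  ∀ i, HasSum (fun j => inner ℂ (v j) (u i) • v j) (v i)

/-- The class in `L²(ℝ^d)` of a Schwartz function. -/
def toL2 {d : ℕ} (φ : 𝓢(Space d, ℂ)) : Lp ℂ 2 (volume : Measure (Space d)) :=
  φ.toLp 2 volume

/-- `φ` and `Ω` form an `α`-admissible pair: `Ω` is an `α`-admissible lattice, the Fourier transform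
of `φ` is supported in an annulus away from the origin, and the packets `φ_{x_j^k, ξ_k}` form a
frame of `L²(ℝ^d)`. (The normalization of the Fourier transform only rescales the annulus.) -/
structure IsAdmissiblePair {d : ℕ} (α : ℝ) (φ : 𝓢(Space d, ℂ)) (Ω : Lattice d) : Prop where
  lattice : ∃ C : ℝ, Ω.IsAdmissible α C
  annulus : ∃ c₁ c₂ : ℝ, 0 < c₁ ∧ c₁ < c₂ ∧
    ∀ ζ : Space d, (𝓕 φ) ζ ≠ 0 → c₁ ≤ ‖ζ‖ ∧ ‖ζ‖ ≤ c₂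
  frame : IsFrame (fun i : Index d => toL2 (Ω.packet α φ i))

/-- Polynomial off-diagonal decay of every order, with respect to `d_α`, of the matrix
`(⟨u_i, v_j⟩)` indexed by the points of the lattice. -/
def HasOffDiagonalDecay {d : ℕ} (α : ℝ) (Ω : Lattice d) (u v : Index d → 𝓢(Space d, ℂ)) : Prop :=
  ∀ N : ℝ, ∃ C : ℝ, ∀ i j : Index d,
    ‖inner ℂ (toL2 (v j)) (toL2 (u i))‖
      ≤ C * (1 + quasiDist α (Ω.point i) (Ω.point j)) ^ (-N)

/-! ### Dispersive modulation spaces -/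

/-- The dispersive Gabor coefficient `c_{j,k}(f) = ⟨f, φ_{x_j^k, ξ_k}⟩`. -/
def coeff {d : ℕ} (α : ℝ) (φ : 𝓢(Space d, ℂ)) (Ω : Lattice d) (f : 𝓢'(Space d, ℂ))
    (i : Index d) : ℂ :=
  pair f (Ω.packet α φ i)

/-- The radial weight `w_β(ξ) = (1 + |ξ|)^β`. -/
def weight {d : ℕ} (β : ℝ) (ξ : Space d) : ℝ := (1 + ‖ξ‖) ^ β

/-- The norm `(∑_k (∑_j |c_{j,k}(f)|^p)^{q/p} w_β(ξ_k)^q)^{1/q}` of a tempered distribution, for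
finite exponents `p` and `q`, with values in `[0, ∞]`. -/
def modNorm {d : ℕ} (α β p q : ℝ) (φ : 𝓢(Space d, ℂ)) (Ω : Lattice d) (f : 𝓢'(Space d, ℂ)) :
    ℝ≥0∞ :=
  (∑' k : ℕ, (∑' j : Fin d → ℤ, ‖coeff α φ Ω f (j, k)‖ₑ ^ p) ^ (q / p) *
    ENNReal.ofReal (weight β (Ω.freq k)) ^ q) ^ (1 / q)

/-- The dispersive modulation space `M^{p,q}_{α,β}` of tempered distributions. -/
def modSpace {d : ℕ} (α β p q : ℝ) (φ : 𝓢(Space d, ℂ)) (Ω : Lattice d) : Set 𝓢'(Space d, ℂ) :=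
  {f | modNorm α β p q φ Ω f < ∞}

end Dispersive

end

noncomputable section
namespace Dispersive

/-! ### Schur's test -/

/-! Let `V` be the analysis operator of the packets, `S = V* V` the frame operator and `T` its
inverse, so that the dual frame is the image of the packets under `T`. Everything rests on the
localization of the Gram matrix `V V*`. Since the Fourier transform of `φ` is compactly supported,
an entry vanishes unless the two frequencies are at bounded distance after the warping `ξ ↦ (1 +
|ξ|)^(α - 1) ξ`. For such pairs the spatial scales are comparable, and the entry decays faster than
every power of the rescaled distance of the positions (`exists_warpDist_le_of_inner_ne_zero`,
`exists_inner_packet_le`).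

The inverse inherits this decay by a commutator argument (`exists_norm_mul_inverse_le`,
`exists_localization`). If a weight `W` varies slowly along the nonzero Gram entries, the commutator
of `W ^ (n + 1)` with the Gram matrix is controlled by `W ^ n`. Induction on `n` then bounds `T` in
the weighted norms, with constants independent of `W`. Weights centred at each lattice point
(`slowWeight`) turn this into decay of the matrices of `T` and `T²` in `gap`, a product form of the
phase-space distance.

Schwartz seminorms of packets grow only polynomially in phase space. Hence `T v = ∑ ⟨T T v, v_j⟩
v_j`, for a packet `v`, converges in the Schwartz space, and so does the expansion of each packet,
with coefficients given by the dual frame. A tempered distribution may be applied term by term to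
the latter. Thus the coefficient sequence of `f` is reproduced by the matrix `⟨φd_i, v_j⟩`, and
subtracting a finite dual expansion leaves this matrix acting on the tail of the sequence
(`coeff_sub_sum`).

An almost diagonal matrix is bounded on the weighted mixed-norm space
(`Lattice.IsAdmissible.exists_mixNorm_le`), because finite overlap makes negative powers of `gap`
summable over the lattice. The tail tends to zero by dominated convergence, as `p` and `q` are
finite. This gives convergence of the truncated expansions, hence density. Membership of Schwartz
functions follows from the rapid decay of their coefficients. -/

theorem ennreal_weighted_mean_rpow {κ : Type*} (w b : κ → ℝ≥0∞) {K : ℝ≥0∞} (hw : ∑' y, w y ≤ K)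
    {p : ℝ} (hp : 1 ≤ p) :
    (∑' y, w y * b y) ^ p ≤ K ^ (p - 1) * ∑' y, w y * b y ^ p := by
  have hp0 : 0 < p := by linarith
  have h1 : ∑' y, w y * b y ≤ K ^ (1 - p⁻¹) * (∑' y, w y * b y ^ p) ^ p⁻¹ := by
    rw [ENNReal.tsum_eq_iSup_sum]
    refine iSup_le fun s => (ENNReal.inner_le_weight_mul_Lp_of_nonneg s hp w b).trans ?_
    have hp' : p⁻¹ ≤ 1 := inv_le_one_of_one_le₀ hp
    exact mul_le_mul'
      (ENNReal.rpow_le_rpow ((ENNReal.sum_le_tsum s).trans hw) (by linarith))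
      (ENNReal.rpow_le_rpow (ENNReal.sum_le_tsum s) (by positivity))
  calc (∑' y, w y * b y) ^ p ≤ (K ^ (1 - p⁻¹) * (∑' y, w y * b y ^ p) ^ p⁻¹) ^ p := by gcongr
    _ = K ^ (p - 1) * ∑' y, w y * b y ^ p := by
      rw [ENNReal.mul_rpow_of_nonneg _ _ hp0.le, ← ENNReal.rpow_mul, ← ENNReal.rpow_mul,
        inv_mul_cancel₀ hp0.ne', ENNReal.rpow_one]
      congr 2
      field_simp

/-- Hölder against the row weights costs `K ^ (p - 1)`. After interchanging the sums, the column
bound costs the last factor `K`. -/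
theorem schur_test {ι κ : Type*} (k : ι → κ → ℝ≥0∞) {K : ℝ≥0∞} (h1 : ∀ x, ∑' y, k x y ≤ K)
    (h2 : ∀ y, ∑' x, k x y ≤ K) {p : ℝ} (hp : 1 ≤ p) (b : κ → ℝ≥0∞) :
    ∑' x, (∑' y, k x y * b y) ^ p ≤ K ^ p * ∑' y, b y ^ p := by
  calc ∑' x, (∑' y, k x y * b y) ^ p ≤ ∑' x, K ^ (p - 1) * ∑' y, k x y * b y ^ p :=
        ENNReal.tsum_le_tsum fun x => ennreal_weighted_mean_rpow _ _ (h1 x) hp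
    _ = K ^ (p - 1) * ∑' y, (∑' x, k x y) * b y ^ p := by
        rw [ENNReal.tsum_mul_left, ENNReal.tsum_comm]
        simp_rw [ENNReal.tsum_mul_right]
    _ ≤ K ^ (p - 1) * ∑' y, K * b y ^ p := by
        gcongr with y
        exact h2 y
    _ = K ^ p * ∑' y, b y ^ p := by
        rw [ENNReal.tsum_mul_left, ← mul_assoc]
        congr 1
        conv_lhs => rw [← ENNReal.rpow_one K, ← ENNReal.rpow_mul, one_mul]
        rw [← ENNReal.rpow_add_of_nonneg _ _ (by linarith) zero_le_one]
        simp

/-! ### The frame operator -/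

section Frame

variable {ι H : Type*} [NormedAddCommGroup H] [InnerProductSpace ℂ H]

/-- The space `ℓ²` over an index set. -/
abbrev Ell2 (ι : Type*) : Type _ := lp (fun _ : ι => ℂ) 2

theorem Ell2.norm_sq (a : Ell2 ι) : ‖a‖ ^ 2 = ∑' x, ‖a x‖ ^ 2 := by
  simpa using lp.norm_rpow_eq_tsum (p := 2) (by simp) a

theorem Ell2.summable_norm_sq (a : Ell2 ι) : Summable fun x => ‖a x‖ ^ 2 := by
  simpa using (memℓp_gen_iff (p := 2) (by simp)).1 a.2

theorem enorm_rpow_two {F : Type*} [NormedAddCommGroup F] (z : F) :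
    ‖z‖ₑ ^ (2 : ℝ) = ENNReal.ofReal (‖z‖ ^ 2) := by
  rw [← ofReal_norm, ENNReal.ofReal_rpow_of_nonneg (norm_nonneg _) zero_le_two]
  norm_num

theorem Ell2.enorm_sq (a : Ell2 ι) : ‖a‖ₑ ^ (2 : ℝ) = ∑' x, ‖a x‖ₑ ^ (2 : ℝ) := by
  rw [enorm_rpow_two, Ell2.norm_sq, ENNReal.ofReal_tsum_of_nonneg (fun _ => by positivity)
    (Ell2.summable_norm_sq a)]
  exact tsum_congr fun x => (enorm_rpow_two _).symm

theorem Ell2.norm_apply_le (a : Ell2 ι) (x : ι) : ‖a x‖ ≤ ‖a‖ :=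
  lp.norm_apply_le_norm (by simp) a x

/-- A square summable family as an element of `ℓ²`. -/
def Ell2.mk (a : ι → ℂ) (h : Summable fun x => ‖a x‖ ^ 2) : Ell2 ι :=
  ⟨a, (memℓp_gen_iff (p := 2) (by simp)).2 (by simpa using h)⟩

/-- The analysis operator of a frame. -/
theorem IsFrame.exists_analysis {v : ι → H} (hv : IsFrame v) :
    ∃ (V : H →L[ℂ] Ell2 ι) (A : ℝ), 0 < A ∧ (∀ f x, V f x = inner ℂ (v x) f) ∧
      ∀ f, A * ‖f‖ ≤ ‖V f‖ := by
  obtain ⟨A, B, hA, hAB, h⟩ := hv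
  let V0 : H →ₗ[ℂ] Ell2 ι :=
    { toFun := fun f => Ell2.mk (fun x => inner ℂ (v x) f) (h f).1
      map_add' := fun f g => lp.ext (funext fun x => inner_add_right _ _ _)
      map_smul' := fun c f => lp.ext (funext fun x => inner_smul_right _ _ _) }
  have hsq : ∀ f, ‖V0 f‖ ^ 2 = ∑' i, ‖inner ℂ (v i) f‖ ^ 2 := fun f => Ell2.norm_sq _
  refine ⟨V0.mkContinuous (Real.sqrt B) fun f => ?_, Real.sqrt A, Real.sqrt_pos.2 hA,
    fun f x => rfl, fun f => ?_⟩
  · refine le_of_sq_le_sq ?_ (by positivity)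
    rw [hsq, mul_pow, Real.sq_sqrt (by linarith)]
    exact (h f).2.2
  · refine le_of_sq_le_sq ?_ (by positivity)
    rw [LinearMap.mkContinuous_apply, hsq, mul_pow, Real.sq_sqrt hA.le]
    exact (h f).2.1

variable [CompleteSpace H]

/-- The adjoint sends the unit vector at `y` to `v y`. It remains to apply it to the expansion of
`b` in unit vectors. -/
theorem hasSum_adjoint_analysis {v : ι → H} {V : H →L[ℂ] Ell2 ι}
    (hV : ∀ f x, V f x = inner ℂ (v x) f) (b : Ell2 ι) :
    HasSum (fun y => b y • v y) (ContinuousLinearMap.adjoint V b) := by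
  classical
  have h := (lp.hasSum_single (p := 2) (by simp) b).mapL (ContinuousLinearMap.adjoint V)
  convert h using 1
  funext y
  refine ext_inner_right ℂ fun f => ?_
  rw [ContinuousLinearMap.adjoint_inner_left, lp.inner_single_left, hV, inner_smul_left]
  simp [mul_comm]

open ContinuousLinearMap in
/-- The frame operator `S = V* V` of a frame is invertible. -/
theorem IsFrame.exists_inverse {v : ι → H} (hv : IsFrame v) :
    ∃ (V : H →L[ℂ] Ell2 ι) (T : H →L[ℂ] H) (A : ℝ), 0 < A ∧ (∀ f x, V f x = inner ℂ (v x) f) ∧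
      (∀ f, A * ‖f‖ ≤ ‖V f‖) ∧ (∀ f, adjoint V (V (T f)) = f) ∧ (∀ f, T (adjoint V (V f)) = f) ∧
      ∀ f g, inner ℂ (T f) g = inner ℂ f (T g) := by
  obtain ⟨V, A, hA, hV, hlow⟩ := hv.exists_analysis
  set S : H →L[ℂ] H := (adjoint V).comp V with hS
  have hSS : ∀ f g, inner ℂ (S f) g = inner ℂ f (S g) := fun f g => by
    simp only [hS, ContinuousLinearMap.comp_apply, adjoint_inner_left, adjoint_inner_right]
  -- Coercivity: `⟨S x, x⟩ = ‖V x‖² ≥ A² ‖x‖²`.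
  have hu : IsUnit S := by
    refine isUnit_of_forall_le_norm_inner_map S (c := (A ^ 2).toNNReal)
      (Real.toNNReal_pos.2 (by positivity)) fun x => ?_
    have h1 : inner ℂ (S x) x = ((‖V x‖ ^ 2 : ℝ) : ℂ) := by
      simp only [hS, ContinuousLinearMap.comp_apply, adjoint_inner_left]
      rw [inner_self_eq_norm_sq_to_K]
      norm_cast
    rw [h1, Complex.norm_real, Real.norm_of_nonneg (by positivity)]
    have h2 := hlow x
    have h3 : (A * ‖x‖) ^ 2 ≤ ‖V x‖ ^ 2 := by gcongr
    rw [Real.coe_toNNReal _ (by positivity)]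
    nlinarith
  obtain ⟨u, hu⟩ := hu
  have h1 : ∀ f, S ((↑u⁻¹ : H →L[ℂ] H) f) = f := fun f => by
    rw [← hu, ← mul_apply_eq_comp, u.mul_inv]; rfl
  have h2 : ∀ f, (↑u⁻¹ : H →L[ℂ] H) (S f) = f := fun f => by
    rw [← hu, ← mul_apply_eq_comp, u.inv_mul]; rfl
  refine ⟨V, ↑u⁻¹, A, hA, hV, hlow, h1, h2, fun f g => ?_⟩
  conv_lhs => rw [← h1 g]
  rw [← hSS, h1]

/-! ### Localization of the inverse frame operator -/

open ContinuousLinearMap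

/-- A redundant frame has a Gram matrix `V V*` with a kernel, so `V V* b` controls `b` only up to
the distance of `b` from the range of `V`. With `h = V* b'`, the identity `V* V h = V* b - V* (b - V
h)` and the lower bound for `V* V` control `h`, and hence `b`. -/
theorem exists_norm_le_of_approx {V : H →L[ℂ] Ell2 ι} {A : ℝ} (hA : 0 < A)
    (hlow : ∀ f, A * ‖f‖ ≤ ‖V f‖) :
    ∃ C : ℝ, 0 ≤ C ∧ ∀ b b' : Ell2 ι,
      ‖b‖ ≤ C * (‖b - V (adjoint V b')‖ + ‖V (adjoint V b)‖) := by
  have hS : ∀ f, A ^ 2 * ‖f‖ ≤ ‖adjoint V (V f)‖ := fun f => by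
    rcases eq_or_ne f 0 with rfl | hf
    · simp
    have h1 : ‖V f‖ ^ 2 ≤ ‖adjoint V (V f)‖ * ‖f‖ := by
      have h2 : inner ℂ (adjoint V (V f)) f = ((‖V f‖ ^ 2 : ℝ) : ℂ) := by
        rw [adjoint_inner_left, inner_self_eq_norm_sq_to_K]
        norm_cast
      have h3 := norm_inner_le_norm (𝕜 := ℂ) (adjoint V (V f)) f
      rwa [h2, Complex.norm_real, Real.norm_of_nonneg (by positivity)] at h3
    have h4 : (A * ‖f‖) ^ 2 ≤ ‖V f‖ ^ 2 := by
      have := hlow f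
      gcongr
    have hf' : 0 < ‖f‖ := norm_pos_iff.2 hf
    refine le_of_mul_le_mul_right ?_ hf'
    nlinarith
  refine ⟨1 + ‖V‖ * (A ^ 2)⁻¹ * (A⁻¹ + ‖V‖), by positivity, fun b b' => ?_⟩
  set h := adjoint V b'
  have hadj : ‖adjoint V‖ = ‖V‖ := LinearIsometryEquiv.norm_map _ _
  have e1 : ‖b‖ ≤ ‖b - V h‖ + ‖V‖ * ‖h‖ :=
    calc ‖b‖ = ‖(b - V h) + V h‖ := by rw [sub_add_cancel]
      _ ≤ _ := (norm_add_le _ _).trans (by gcongr; exact V.le_opNorm h)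
  have e2 : ‖h‖ ≤ (A ^ 2)⁻¹ * ‖adjoint V (V h)‖ := by
    rw [inv_mul_eq_div, le_div_iff₀ (by positivity), mul_comm]
    exact hS h
  have e3 : ‖adjoint V (V h)‖ ≤ ‖adjoint V b‖ + ‖V‖ * ‖b - V h‖ :=
    calc ‖adjoint V (V h)‖ = ‖adjoint V b - adjoint V (b - V h)‖ := by
          rw [← map_sub, sub_sub_cancel]
      _ ≤ _ := (norm_sub_le _ _).trans (by
        gcongr
        rw [← hadj]
        exact (adjoint V).le_opNorm _)
  have e4 : ‖adjoint V b‖ ≤ A⁻¹ * ‖V (adjoint V b)‖ := by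
    rw [inv_mul_eq_div, le_div_iff₀ hA, mul_comm]
    exact hlow _
  have hA' : 0 < (A ^ 2)⁻¹ := by positivity
  calc ‖b‖ ≤ ‖b - V h‖ + ‖V‖ * ((A ^ 2)⁻¹ * (A⁻¹ * ‖V (adjoint V b)‖ + ‖V‖ * ‖b - V h‖)) := by
        refine e1.trans ?_
        gcongr
        exact e2.trans (by gcongr; exact e3.trans (by gcongr))
    _ ≤ (1 + ‖V‖ * (A ^ 2)⁻¹ * (A⁻¹ + ‖V‖)) * (‖b - V h‖ + ‖V (adjoint V b)‖) := by
        have p1 : 0 ≤ ‖V‖ * (A ^ 2)⁻¹ * A⁻¹ * ‖b - V h‖ := by positivity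
        have p2 : 0 ≤ ‖V‖ * (A ^ 2)⁻¹ * ‖V‖ * ‖V (adjoint V b)‖ := by positivity
        have p3 := norm_nonneg (V (adjoint V b))
        nlinarith

/-- Multiplication of a square summable family by a bounded family of real numbers. -/
def Ell2.mul (D : ι → ℝ) {M : ℝ} (hD : ∀ x, |D x| ≤ M) (a : Ell2 ι) : Ell2 ι :=
  Ell2.mk (fun x => D x * a x) (by
    refine Summable.of_nonneg_of_le (fun _ => by positivity) (fun x => ?_)
      ((Ell2.summable_norm_sq a).mul_left (M ^ 2))
    rw [norm_mul, mul_pow, Complex.norm_real, Real.norm_eq_abs]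
    have := hD x
    gcongr)

theorem Ell2.mul_apply (D : ι → ℝ) {M : ℝ} (hD : ∀ x, |D x| ≤ M) (a : Ell2 ι) (x : ι) :
    Ell2.mul D hD a x = D x * a x := rfl

theorem Ell2.norm_le_of_schur (k : ι → ι → ℝ≥0∞) {K : ℝ≥0∞} (hK : K ≠ ∞)
    (h1 : ∀ x, ∑' y, k x y ≤ K) (h2 : ∀ y, ∑' x, k x y ≤ K) (c e : Ell2 ι)
    (h : ∀ x, ‖c x‖ₑ ≤ ∑' y, k x y * ‖e y‖ₑ) : ‖c‖ ≤ K.toReal * ‖e‖ := by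
  have h3 : ‖c‖ₑ ^ (2 : ℝ) ≤ (K * ‖e‖ₑ) ^ (2 : ℝ) := by
    rw [Ell2.enorm_sq, ENNReal.mul_rpow_of_nonneg _ _ zero_le_two, Ell2.enorm_sq]
    refine le_trans (ENNReal.tsum_le_tsum fun x => ?_) (schur_test k h1 h2 one_le_two _)
    exact ENNReal.rpow_le_rpow (h x) zero_le_two
  have h4 : ‖c‖ₑ ≤ K * ‖e‖ₑ := (ENNReal.rpow_le_rpow_iff zero_lt_two).1 h3
  have h5 := ENNReal.toReal_mono (ENNReal.mul_ne_top hK enorm_ne_top) h4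
  simpa using h5

/-- Factor out `a - b`. Each of the `n + 1` remaining terms is at most `(2 L b) ^ n`, because `a ≤ b
+ L ≤ 2 L b`. What matters is that `b` appears with one power less than on the left; the excess
falls on `L`. -/
theorem abs_pow_succ_sub_pow_succ_le {a b L : ℝ} (ha : 1 ≤ a) (hb : 1 ≤ b) (hL : 1 ≤ L)
    (h : |a - b| ≤ L) (n : ℕ) :
    |a ^ (n + 1) - b ^ (n + 1)| ≤ (n + 1) * 2 ^ n * L ^ (n + 1) * b ^ n := by
  have hab : a ≤ 2 * L * b := by
    have := (abs_le.1 h).2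
    nlinarith
  have hbb : b ≤ 2 * L * b := by nlinarith
  have h1 : a ^ (n + 1) - b ^ (n + 1)
      = (∑ i ∈ Finset.range (n + 1), a ^ i * b ^ (n + 1 - 1 - i)) * (a - b) :=
    (geom_sum₂_mul a b (n + 1)).symm
  rw [h1, abs_mul, abs_of_nonneg (by positivity)]
  have h2 : ∑ i ∈ Finset.range (n + 1), a ^ i * b ^ (n + 1 - 1 - i)
      ≤ ∑ _i ∈ Finset.range (n + 1), (2 * L * b) ^ n := by
    refine Finset.sum_le_sum fun i hi => ?_
    have hi' : i ≤ n := Nat.lt_succ_iff.1 (Finset.mem_range.1 hi)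
    calc a ^ i * b ^ (n + 1 - 1 - i) ≤ (2 * L * b) ^ i * (2 * L * b) ^ (n - i) := by
          gcongr
          rw [Nat.add_sub_cancel]
          gcongr
      _ = (2 * L * b) ^ n := by rw [← pow_add]; congr 1; omega
  calc _ ≤ (∑ _i ∈ Finset.range (n + 1), (2 * L * b) ^ n) * L := by gcongr
    _ = _ := by
      simp only [Finset.sum_const, Finset.card_range, nsmul_eq_mul, Nat.cast_add, Nat.cast_one]
      ring

/-- The commutator has entries `⟨v x, v y⟩ (W x ^ (n + 1) - W y ^ (n + 1))`, and Schur's test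
applies after one power of the weight has been traded for powers of `L`. The bounds `M`, `M'` only
make the multiplications act on `ℓ²`; they do not enter the constant. -/
theorem norm_commutator_le {v : ι → H} {V : H →L[ℂ] Ell2 ι}
    (hV : ∀ f x, V f x = inner ℂ (v x) f) {L : ι → ι → ℝ} (hL1 : ∀ x y, 1 ≤ L x y)
    (hLs : ∀ x y, L x y = L y x) {K : ℝ≥0∞} (hK : K ≠ ∞) (n : ℕ)
    (hschur : ∀ x, ∑' y, ‖inner ℂ (v x) (v y)‖ₑ * ENNReal.ofReal (L x y ^ (n + 1)) ≤ K)
    {W : ι → ℝ} (hW1 : ∀ x, 1 ≤ W x)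
    (hWL : ∀ x y, inner ℂ (v x) (v y) ≠ 0 → |W x - W y| ≤ L x y)
    {M M' : ℝ} (hM : ∀ x, |W x ^ (n + 1)| ≤ M) (hM' : ∀ x, |W x ^ n| ≤ M') (a : Ell2 ι) :
    ‖Ell2.mul _ hM (V (adjoint V a)) - V (adjoint V (Ell2.mul _ hM a))‖
      ≤ (n + 1) * 2 ^ n * K.toReal * ‖Ell2.mul _ hM' a‖ := by
  have hG : ∀ (b : Ell2 ι) x,
      HasSum (fun y => inner ℂ (v x) (v y) * b y) (V (adjoint V b) x) := fun b x => by
    rw [hV]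
    have := (hasSum_adjoint_analysis hV b).mapL (innerSL ℂ (v x))
    simpa [inner_smul_right, mul_comm] using this
  set c : ℝ≥0∞ := ENNReal.ofReal ((n + 1) * 2 ^ n) with hc
  have hkey := Ell2.norm_le_of_schur
    (fun x y => c * (‖inner ℂ (v x) (v y)‖ₑ * ENNReal.ofReal (L x y ^ (n + 1))))
    (K := c * K) (ENNReal.mul_ne_top ENNReal.ofReal_ne_top hK)
    (fun x => by rw [ENNReal.tsum_mul_left]; gcongr; exact hschur x)
    -- The column sums reduce to row sums: the Gram matrix is Hermitian and `L` is symmetric.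
    (fun y => by
      rw [ENNReal.tsum_mul_left]
      gcongr
      refine le_of_eq_of_le (tsum_congr fun x => ?_) (hschur y)
      rw [hLs x y, ← inner_conj_symm, ← ofReal_norm, ← ofReal_norm, RCLike.norm_conj])
    (Ell2.mul _ hM (V (adjoint V a)) - V (adjoint V (Ell2.mul _ hM a)))
    (Ell2.mul _ hM' a) (fun x => by
      have h1 : HasSum (fun y => inner ℂ (v x) (v y) * (((W x ^ (n + 1) - W y ^ (n + 1) : ℝ)) * a y))
          ((Ell2.mul _ hM (V (adjoint V a)) - V (adjoint V (Ell2.mul _ hM a)) : Ell2 ι) x) := by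
        have := ((hG a x).mul_left ((W x ^ (n + 1) : ℝ) : ℂ)).sub (hG (Ell2.mul _ hM a) x)
        have e : (fun y => inner ℂ (v x) (v y) * (((W x ^ (n + 1) - W y ^ (n + 1) : ℝ)) * a y))
            = fun y => ((W x ^ (n + 1) : ℝ) : ℂ) * (inner ℂ (v x) (v y) * a y) -
              inner ℂ (v x) (v y) * (Ell2.mul _ hM a) y := funext fun y => by
          rw [Ell2.mul_apply]
          push_cast
          ring
        rw [e]
        exact this
      rw [← h1.tsum_eq]
      refine enorm_tsum_le_tsum_enorm.trans (ENNReal.tsum_le_tsum fun y => ?_)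
      rw [enorm_mul, enorm_mul, Ell2.mul_apply, enorm_mul]
      rcases eq_or_ne (inner ℂ (v x) (v y)) 0 with h0 | h0
      · simp [h0]
      have h2 := abs_pow_succ_sub_pow_succ_le (hW1 x) (hW1 y) (hL1 x y) (hWL x y h0) n
      have h3 : ‖((W x ^ (n + 1) - W y ^ (n + 1) : ℝ) : ℂ)‖ₑ
          ≤ c * ENNReal.ofReal (L x y ^ (n + 1)) * ‖((W y ^ n : ℝ) : ℂ)‖ₑ := by
        have hL0 : 0 ≤ L x y := zero_le_one.trans (hL1 x y)
        have hW0 : 0 ≤ W y := zero_le_one.trans (hW1 y)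
        rw [← ofReal_norm, ← ofReal_norm, hc, ← ENNReal.ofReal_mul (by positivity),
          ← ENNReal.ofReal_mul (by positivity), Complex.norm_real, Complex.norm_real,
          Real.norm_eq_abs, Real.norm_of_nonneg (by positivity)]
        exact ENNReal.ofReal_le_ofReal h2
      calc _ ≤ ‖inner ℂ (v x) (v y)‖ₑ *
            (c * ENNReal.ofReal (L x y ^ (n + 1)) * ‖((W y ^ n : ℝ) : ℂ)‖ₑ * ‖a y‖ₑ) := by gcongr
        _ = _ := by ring)
  rw [ENNReal.toReal_mul, hc, ENNReal.toReal_ofReal (by positivity)] at hkey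
  exact hkey

theorem abs_pow_le_of_le {a M : ℝ} (h1 : 1 ≤ a) (h2 : a ≤ M) (n : ℕ) : |a ^ n| ≤ M ^ n := by
  rw [abs_of_nonneg (by positivity)]
  gcongr

/-- The inverse frame operator is bounded for polynomial weights that vary slowly along the Gram
matrix. -/
theorem exists_norm_mul_inverse_le {v : ι → H} {V : H →L[ℂ] Ell2 ι} {T : H →L[ℂ] H} {A : ℝ}
    (hA : 0 < A) (hV : ∀ f x, V f x = inner ℂ (v x) f) (hlow : ∀ f, A * ‖f‖ ≤ ‖V f‖)
    (hST : ∀ f, adjoint V (V (T f)) = f)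
    {L : ι → ι → ℝ} (hL1 : ∀ x y, 1 ≤ L x y) (hLs : ∀ x y, L x y = L y x)
    (hschur : ∀ n : ℕ, ∃ K : ℝ≥0∞, K ≠ ∞ ∧
      ∀ x, ∑' y, ‖inner ℂ (v x) (v y)‖ₑ * ENNReal.ofReal (L x y ^ n) ≤ K) (n : ℕ) :
    ∃ C : ℝ, 0 ≤ C ∧ ∀ (W : ι → ℝ) (M : ℝ) (hW1 : ∀ x, 1 ≤ W x) (hWM : ∀ x, W x ≤ M),
      (∀ x y, inner ℂ (v x) (v y) ≠ 0 → |W x - W y| ≤ L x y) → ∀ g,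
      ‖Ell2.mul (fun x => W x ^ n) (fun x => abs_pow_le_of_le (hW1 x) (hWM x) n) (V (T g))‖
        ≤ C * ‖Ell2.mul (fun x => W x ^ n)
            (fun x => abs_pow_le_of_le (hW1 x) (hWM x) n) (V g)‖ := by
  induction n with
  | zero =>
    have hone : ∀ (W : ι → ℝ) (M : ℝ) (h : ∀ x, |W x ^ 0| ≤ M) (a : Ell2 ι),
        Ell2.mul (fun x => W x ^ 0) h a = a := fun W M h a => by
      refine lp.ext (funext fun x => ?_)
      rw [Ell2.mul_apply]
      simp
    refine ⟨‖V‖ * ‖T‖ * A⁻¹, by positivity, fun W M hW1 hWM _ g => ?_⟩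
    rw [hone, hone]
    have h1 : ‖g‖ ≤ A⁻¹ * ‖V g‖ := by
      rw [inv_mul_eq_div, le_div_iff₀ hA, mul_comm]
      exact hlow _
    calc ‖V (T g)‖ ≤ ‖V‖ * (‖T‖ * ‖g‖) := (V.le_opNorm _).trans (by gcongr; exact T.le_opNorm _)
      _ ≤ ‖V‖ * (‖T‖ * (A⁻¹ * ‖V g‖)) := by gcongr
      _ = _ := by ring
  | succ n ih =>
    -- Let `b = W ^ (n + 1) V T g` and `b' = W ^ (n + 1) V T T g`. Since `V T g = V V* V T T g`, the
    -- difference `b - V V* b'` is a commutator applied to `V T T g`. Likewise `V V* b` differs from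
    -- `W ^ (n + 1) V g` by a commutator applied to `V T g`. Both errors involve only `W ^ n`, so
    -- the induction hypothesis bounds them, used twice for `T T g` and once for `T g`.
    obtain ⟨C, hC0, hC⟩ := ih
    obtain ⟨C', hC'0, hC'⟩ := exists_norm_le_of_approx hA hlow
    obtain ⟨K, hK, hKs⟩ := hschur (n + 1)
    set K' : ℝ := (n + 1) * 2 ^ n * K.toReal with hK'
    have hK'0 : 0 ≤ K' := by positivity
    refine ⟨C' * (K' * C * C + 1 + K' * C), by positivity, fun W M hW1 hWM hWL g => ?_⟩
    have hb := fun m x => abs_pow_le_of_le (hW1 x) (hWM x) m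
    have hcomm := norm_commutator_le hV hL1 hLs hK n hKs hW1 hWL (hb (n + 1)) (hb n)
    have hmono : ‖Ell2.mul _ (hb n) (V g)‖ ≤ ‖Ell2.mul _ (hb (n + 1)) (V g)‖ := by
      refine le_of_sq_le_sq ?_ (norm_nonneg _)
      rw [Ell2.norm_sq, Ell2.norm_sq]
      refine Summable.tsum_le_tsum (fun x => ?_) (Ell2.summable_norm_sq _)
        (Ell2.summable_norm_sq _)
      have h0 : 0 ≤ W x := zero_le_one.trans (hW1 x)
      rw [Ell2.mul_apply, Ell2.mul_apply, norm_mul, norm_mul, Complex.norm_real, Complex.norm_real,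
        Real.norm_of_nonneg (by positivity), Real.norm_of_nonneg (by positivity)]
      have := hW1 x
      gcongr
      · omega
    have h1 : ‖Ell2.mul _ (hb n) (V (T g))‖ ≤ C * ‖Ell2.mul _ (hb (n + 1)) (V g)‖ :=
      (hC W M hW1 hWM hWL g).trans (by gcongr)
    have h2 : ‖Ell2.mul _ (hb n) (V (T (T g)))‖ ≤ C * (C * ‖Ell2.mul _ (hb (n + 1)) (V g)‖) :=
      (hC W M hW1 hWM hWL (T g)).trans (by gcongr)
    have h3 := hcomm (V (T (T g)))
    have h4 := hcomm (V (T g))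
    rw [hST] at h3 h4
    have h5 := hC' (Ell2.mul _ (hb (n + 1)) (V (T g))) (Ell2.mul _ (hb (n + 1)) (V (T (T g))))
    have h6 : ‖V (adjoint V (Ell2.mul _ (hb (n + 1)) (V (T g))))‖
        ≤ ‖Ell2.mul _ (hb (n + 1)) (V g)‖ + K' * ‖Ell2.mul _ (hb n) (V (T g))‖ := by
      refine (norm_le_norm_add_norm_sub' _ (Ell2.mul _ (hb (n + 1)) (V g))).trans ?_
      rw [norm_sub_rev]
      exact add_le_add_right (h4.trans_eq rfl) _
    set X := ‖Ell2.mul _ (hb (n + 1)) (V g)‖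
    calc _ ≤ C' * (K' * (C * (C * X)) + (X + K' * (C * X))) := by
          refine h5.trans ?_
          gcongr
          · exact h3.trans (by gcongr)
          · exact h6.trans (by gcongr)
      _ = _ := by ring

/-- Localization of the coefficients of the canonical dual frame: if the Gram matrix of a frame
decays faster than every power of `L`, then the matrices of the inverse of the frame operator and of
its square decay faster than every power of each weight `W` with `|W x - W y| ≤ L x y`. -/
theorem exists_localization {v : ι → H} {V : H →L[ℂ] Ell2 ι} {T : H →L[ℂ] H} {A : ℝ}
    (hA : 0 < A) (hV : ∀ f x, V f x = inner ℂ (v x) f) (hlow : ∀ f, A * ‖f‖ ≤ ‖V f‖)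
    (hST : ∀ f, adjoint V (V (T f)) = f)
    {L : ι → ι → ℝ} (hL1 : ∀ x y, 1 ≤ L x y) (hLs : ∀ x y, L x y = L y x)
    (hschur : ∀ n : ℕ, ∃ K : ℝ≥0∞, K ≠ ∞ ∧
      ∀ x, ∑' y, ‖inner ℂ (v x) (v y)‖ₑ * ENNReal.ofReal (L x y ^ n) ≤ K) (n : ℕ) :
    ∃ C : ℝ, ∀ (W : ι → ℝ), (∀ x, 1 ≤ W x) →
      (∀ x y, inner ℂ (v x) (v y) ≠ 0 → |W x - W y| ≤ L x y) → ∀ i, W i = 1 → ∀ j,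
      W j ^ n * ‖inner ℂ (v j) (T (v i))‖ ≤ C ∧ W j ^ n * ‖inner ℂ (v j) (T (T (v i)))‖ ≤ C := by
  obtain ⟨C, hC0, hC⟩ := exists_norm_mul_inverse_le hA hV hlow hST hL1 hLs hschur n
  obtain ⟨K, hK, hKs⟩ := hschur n
  set Q : ℝ := 2 ^ n * K.toReal with hQ
  have hQ0 : 0 ≤ Q := by positivity
  refine ⟨C * Q + C * (C * Q), fun W hW1 hWL i hWi j => ?_⟩
  set M := W j
  -- Truncation at the value `W j` makes the weight bounded. It keeps the value at `j` and the slow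
  -- variation, and the constants do not see the bound.
  set W' : ι → ℝ := fun x => min (W x) M
  have hW'1 : ∀ x, 1 ≤ W' x := fun x => le_min (hW1 x) (hW1 j)
  have hW'M : ∀ x, W' x ≤ M := fun x => min_le_right _ _
  have hW'L : ∀ x y, inner ℂ (v x) (v y) ≠ 0 → |W' x - W' y| ≤ L x y := fun x y h =>
    (abs_min_sub_min_le_max _ _ _ _).trans (max_le (hWL x y h) (by
      rw [sub_self, abs_zero]; exact zero_le_one.trans (hL1 x y)))
  have hb := fun x => abs_pow_le_of_le (hW'1 x) (hW'M x) n
  -- Since `W i = 1`, the truncated weight is at most `1 + L i x ≤ 2 * L i x` wherever the Gram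
  -- entry is nonzero. The `ℓ²` norm is then bounded by the `ℓ¹` norm, that is, by the row sum.
  have hbase : ‖Ell2.mul _ hb (V (v i))‖ ≤ Q := by
    refine le_of_sq_le_sq ?_ hQ0
    have hterm : ∀ x, ‖(Ell2.mul _ hb (V (v i))) x‖ₑ
        ≤ ENNReal.ofReal (2 ^ n) * (‖inner ℂ (v i) (v x)‖ₑ * ENNReal.ofReal (L i x ^ n)) := by
      intro x
      rw [Ell2.mul_apply, hV]
      rcases eq_or_ne (inner ℂ (v i) (v x)) 0 with h0 | h0
      · rw [← inner_conj_symm, h0]; simp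
      have h1 : W' x ≤ 2 * L i x := by
        have h2 := (abs_le.1 (hWL i x h0)).1
        have h3 := hL1 i x
        have h4 : W' x ≤ W x := min_le_left _ _
        linarith
      have h0' : 0 ≤ W' x := zero_le_one.trans (hW'1 x)
      have hL0 : 0 ≤ L i x := zero_le_one.trans (hL1 i x)
      rw [enorm_mul, ← ofReal_norm ((W' x ^ n : ℝ) : ℂ), Complex.norm_real,
        Real.norm_of_nonneg (by positivity), ← inner_conj_symm,
        ← ofReal_norm ((starRingEnd ℂ) _), RCLike.norm_conj, ofReal_norm,
        mul_comm ‖_‖ₑ, ← mul_assoc, ← ENNReal.ofReal_mul (by positivity), ← mul_pow]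
      gcongr
    have h2 : ‖Ell2.mul _ hb (V (v i))‖ₑ ≤ ENNReal.ofReal Q := by
      rw [← ENNReal.rpow_le_rpow_iff zero_lt_two, Ell2.enorm_sq]
      calc _ ≤ (∑' x, ‖(Ell2.mul _ hb (V (v i))) x‖ₑ) ^ (2 : ℝ) := by
            rw [ENNReal.rpow_two, sq, ← ENNReal.tsum_mul_right]
            refine ENNReal.tsum_le_tsum fun x => ?_
            rw [ENNReal.rpow_two, sq]
            gcongr
            exact ENNReal.le_tsum x
        _ ≤ _ := by
            refine ENNReal.rpow_le_rpow ?_ zero_le_two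
            refine (ENNReal.tsum_le_tsum hterm).trans ?_
            rw [ENNReal.tsum_mul_left, hQ, ENNReal.ofReal_mul (by positivity),
              ENNReal.ofReal_toReal hK]
            gcongr
            exact hKs i
    have h3 : ‖Ell2.mul _ hb (V (v i))‖ ≤ Q := by
      rwa [← ofReal_norm, ENNReal.ofReal_le_ofReal_iff hQ0] at h2
    gcongr
  have hT : ‖Ell2.mul _ hb (V (T (v i)))‖ ≤ C * Q :=
    (hC W' M hW'1 hW'M hW'L (v i)).trans (by gcongr)
  have hTT : ‖Ell2.mul _ hb (V (T (T (v i))))‖ ≤ C * (C * Q) :=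
    (hC W' M hW'1 hW'M hW'L (T (v i))).trans (by gcongr)
  have hj : ∀ f, W j ^ n * ‖inner ℂ (v j) f‖ ≤ ‖Ell2.mul _ hb (V f)‖ := fun f => by
    refine le_of_eq_of_le ?_ (Ell2.norm_apply_le _ j)
    rw [Ell2.mul_apply, hV, norm_mul, Complex.norm_real, Real.norm_eq_abs,
      abs_of_nonneg (pow_nonneg (zero_le_one.trans (hW'1 j)) n)]
    simp [W', M]
  have p1 : 0 ≤ C * Q := by positivity
  have p2 : 0 ≤ C * (C * Q) := by positivity
  exact ⟨(hj _).trans (by linarith), (hj _).trans (by linarith)⟩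

end Frame
end Dispersive
end

noncomputable section
namespace Dispersive

/-! ### The warping map -/

theorem rpow_le_of_comparable {x y c : ℝ} (hx : 0 < x) (hy : 0 < y) (hc : 1 ≤ c) (h1 : x ≤ c * y)
    (h2 : y ≤ c * x) (γ : ℝ) : x ^ γ ≤ c ^ |γ| * y ^ γ := by
  have hc0 : 0 < c := by linarith
  rcases le_total 0 γ with h | h
  · rw [abs_of_nonneg h, ← Real.mul_rpow hc0.le hy.le]
    gcongr
  · rw [abs_of_nonpos h]
    have h3 : (c * x) ^ γ ≤ y ^ γ := Real.rpow_le_rpow_of_nonpos hy h2 h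
    rw [Real.mul_rpow hc0.le hx.le] at h3
    calc x ^ γ = c ^ (-γ) * (c ^ γ * x ^ γ) := by
          rw [← mul_assoc, ← Real.rpow_add hc0]; simp
      _ ≤ _ := by gcongr

theorem hasDerivAt_radial (α : ℝ) {t : ℝ} (ht : 0 ≤ t) :
    HasDerivAt (fun t : ℝ => (1 + t) ^ (α - 1) * t)
      ((1 + t) ^ (α - 1) * ((1 + α * t) / (1 + t))) t := by
  have h0 : (0 : ℝ) < 1 + t := by linarith
  have h1 : HasDerivAt (fun t : ℝ => 1 + t) 1 t := by simpa using (hasDerivAt_id t).const_add 1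
  have h2 := (h1.rpow_const (p := α - 1) (Or.inl h0.ne')).mul (hasDerivAt_id t)
  refine h2.congr_deriv ?_
  rw [Real.rpow_sub_one h0.ne']
  simp only [id]
  field_simp
  ring

theorem radial_bounds {α : ℝ} (hα : 0 < α) {s t : ℝ} (hs : 0 ≤ s) (hst : s ≤ t) :
    min 1 α * min ((1 + s) ^ (α - 1)) ((1 + t) ^ (α - 1)) * (t - s)
        ≤ (1 + t) ^ (α - 1) * t - (1 + s) ^ (α - 1) * s ∧
      (1 + t) ^ (α - 1) * t - (1 + s) ^ (α - 1) * s
        ≤ max 1 α * max ((1 + s) ^ (α - 1)) ((1 + t) ^ (α - 1)) * (t - s) := by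
  rcases hst.eq_or_lt with rfl | hlt
  · simp
  obtain ⟨c, hc, hcd⟩ := exists_hasDerivAt_eq_slope (fun t : ℝ => (1 + t) ^ (α - 1) * t) _ hlt
    (fun x hx => (hasDerivAt_radial α (hs.trans hx.1)).continuousAt.continuousWithinAt)
    (fun x hx => hasDerivAt_radial α (hs.trans hx.1.le))
  have hts : 0 < t - s := by linarith
  rw [eq_div_iff hts.ne'] at hcd
  rw [← hcd]
  have hc1 : (0 : ℝ) < 1 + c := by linarith [hc.1]
  have hq1 : min 1 α ≤ (1 + α * c) / (1 + c) := by
    rw [le_div_iff₀ hc1]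
    nlinarith [min_le_left 1 α, min_le_right 1 α, hc.1]
  have hq2 : (1 + α * c) / (1 + c) ≤ max 1 α := by
    rw [div_le_iff₀ hc1]
    nlinarith [le_max_left 1 α, le_max_right 1 α, hc.1]
  have hm0 : 0 < min 1 α := lt_min one_pos hα
  have hp1 : min ((1 + s) ^ (α - 1)) ((1 + t) ^ (α - 1)) ≤ (1 + c) ^ (α - 1) := by
    rcases le_total 0 (α - 1) with h | h
    · exact (min_le_left _ _).trans (Real.rpow_le_rpow (by linarith) (by linarith [hc.1]) h)
    · exact (min_le_right _ _).trans
        (Real.rpow_le_rpow_of_nonpos (by linarith) (by linarith [hc.2]) h)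
  have hp2 : (1 + c) ^ (α - 1) ≤ max ((1 + s) ^ (α - 1)) ((1 + t) ^ (α - 1)) := by
    rcases le_total 0 (α - 1) with h | h
    · exact (Real.rpow_le_rpow (by linarith) (by linarith [hc.2]) h).trans (le_max_right _ _)
    · exact (Real.rpow_le_rpow_of_nonpos (by linarith) (by linarith [hc.1]) h).trans
        (le_max_left _ _)
  have hcp : 0 < (1 + c) ^ (α - 1) := Real.rpow_pos_of_pos hc1 _
  constructor
  · rw [mul_comm (min 1 α)]
    gcongr
  · rw [mul_comm (max 1 α)]
    exact mul_le_mul_of_nonneg_right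
      (mul_le_mul hp2 hq2 (hm0.le.trans hq1) (hcp.le.trans hp2)) hts.le

theorem radial_abs_bounds {α : ℝ} (hα : 0 < α) {s t : ℝ} (hs : 0 ≤ s) (ht : 0 ≤ t) :
    min 1 α * min ((1 + s) ^ (α - 1)) ((1 + t) ^ (α - 1)) * |s - t|
        ≤ |(1 + s) ^ (α - 1) * s - (1 + t) ^ (α - 1) * t| ∧
      |(1 + s) ^ (α - 1) * s - (1 + t) ^ (α - 1) * t|
        ≤ max 1 α * max ((1 + s) ^ (α - 1)) ((1 + t) ^ (α - 1)) * |s - t| := by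
  have key : ∀ {s t : ℝ}, 0 ≤ s → s ≤ t →
      min 1 α * min ((1 + s) ^ (α - 1)) ((1 + t) ^ (α - 1)) * |s - t|
        ≤ |(1 + s) ^ (α - 1) * s - (1 + t) ^ (α - 1) * t| ∧
      |(1 + s) ^ (α - 1) * s - (1 + t) ^ (α - 1) * t|
        ≤ max 1 α * max ((1 + s) ^ (α - 1)) ((1 + t) ^ (α - 1)) * |s - t| := by
    intro s t hs hst
    have h := radial_bounds hα hs hst
    have hpos : 0 ≤ min 1 α * min ((1 + s) ^ (α - 1)) ((1 + t) ^ (α - 1)) * (t - s) := by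
      have : 0 ≤ t - s := by linarith
      have : 0 ≤ t := by linarith
      positivity
    rw [abs_sub_comm, abs_of_nonneg (sub_nonneg.2 hst), abs_sub_comm,
      abs_of_nonneg (hpos.trans h.1)]
    exact h
  rcases le_total s t with h | h
  · exact key hs h
  · have := key ht h
    rwa [abs_sub_comm, min_comm ((1 + t) ^ (α - 1)), abs_sub_comm (_ * t),
      max_comm ((1 + t) ^ (α - 1))] at this

variable {d : ℕ}

/-- The map `ξ ↦ (1 + |ξ|)^(α - 1) ξ`, which takes subdyadic balls to sets of bounded size. -/
def warp (α : ℝ) (ξ : Space d) : Space d := (1 + ‖ξ‖) ^ (α - 1) • ξ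

/-- The distance between the images of two frequencies under `warp`. -/
def warpDist (α : ℝ) (ξ η : Space d) : ℝ := ‖warp α ξ - warp α η‖

theorem warpDist_nonneg (α : ℝ) (ξ η : Space d) : 0 ≤ warpDist α ξ η := norm_nonneg _

theorem warpDist_comm (α : ℝ) (ξ η : Space d) : warpDist α ξ η = warpDist α η ξ :=
  norm_sub_rev _ _

theorem warpDist_triangle (α : ℝ) (ξ η ζ : Space d) :
    warpDist α ξ ζ ≤ warpDist α ξ η + warpDist α η ζ := norm_sub_le_norm_sub_add_norm_sub _ _ _

theorem one_add_norm_pos (ξ : Space d) : 0 < 1 + ‖ξ‖ := by positivity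

/-- Separates the radial from the angular displacement: the last bracket is `2 (|ξ| |η| - ⟨ξ, η⟩)`,
on which the factors act by their product. -/
theorem norm_smul_sub_smul_sq (a b : ℝ) (ξ η : Space d) :
    ‖a • ξ - b • η‖ ^ 2 = (a * ‖ξ‖ - b * ‖η‖) ^ 2
      + a * b * (‖ξ - η‖ ^ 2 - (‖ξ‖ - ‖η‖) ^ 2) := by
  rw [@norm_sub_sq ℝ, @norm_sub_sq ℝ, norm_smul, norm_smul, inner_smul_left, inner_smul_right,
    mul_pow, mul_pow, Real.norm_eq_abs, Real.norm_eq_abs, sq_abs, sq_abs]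
  simp only [RCLike.re_to_real, conj_trivial]
  ring

/-- The radial part is `radial_abs_bounds`. The angular part is multiplied by the product of the two
factors, which lies between the squares of their minimum and maximum, and `min 1 α ≤ 1 ≤ max 1 α`.
-/
theorem warpDist_bounds {α : ℝ} (hα : 0 < α) (ξ η : Space d) :
    min 1 α * min ((1 + ‖ξ‖) ^ (α - 1)) ((1 + ‖η‖) ^ (α - 1)) * ‖ξ - η‖ ≤ warpDist α ξ η ∧
      warpDist α ξ η
        ≤ max 1 α * max ((1 + ‖ξ‖) ^ (α - 1)) ((1 + ‖η‖) ^ (α - 1)) * ‖ξ - η‖ := by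
  obtain ⟨h1, h2⟩ := radial_abs_bounds hα (norm_nonneg ξ) (norm_nonneg η)
  have hsq := norm_smul_sub_smul_sq ((1 + ‖ξ‖) ^ (α - 1)) ((1 + ‖η‖) ^ (α - 1)) ξ η
  have ha : 0 < (1 + ‖ξ‖) ^ (α - 1) := Real.rpow_pos_of_pos (one_add_norm_pos ξ) _
  have hb : 0 < (1 + ‖η‖) ^ (α - 1) := Real.rpow_pos_of_pos (one_add_norm_pos η) _
  set a := (1 + ‖ξ‖) ^ (α - 1)
  set b := (1 + ‖η‖) ^ (α - 1)
  set e := ‖ξ - η‖ ^ 2 - (‖ξ‖ - ‖η‖) ^ 2 with he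
  have he0 : 0 ≤ e := by
    rw [he, sub_nonneg, sq_le_sq, abs_of_nonneg (norm_nonneg (ξ - η))]
    exact abs_norm_sub_norm_le ξ η
  have hm0 : 0 < min 1 α := lt_min one_pos hα
  have hM1 : 1 ≤ max 1 α := le_max_left _ _
  have h1' := pow_le_pow_left₀ (by positivity) h1 2
  have h2' := pow_le_pow_left₀ (abs_nonneg _) h2 2
  rw [mul_pow, sq_abs, sq_abs] at h1' h2'
  have hab1 : min a b ^ 2 ≤ a * b := by
    rw [sq]; gcongr
    · exact min_le_left _ _
    · exact min_le_right _ _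
  have hab2 : a * b ≤ max a b ^ 2 := by
    rw [sq]; gcongr
    · exact le_max_left _ _
    · exact le_max_right _ _
  have hmm : min 1 α ^ 2 ≤ 1 := pow_le_one₀ hm0.le (min_le_left _ _)
  have hMM : 1 ≤ max 1 α ^ 2 := one_le_pow₀ hM1
  have hn : ‖ξ - η‖ ^ 2 = e + (‖ξ‖ - ‖η‖) ^ 2 := by rw [he]; ring
  constructor
  · refine le_of_sq_le_sq ?_ (norm_nonneg _)
    change _ ≤ ‖a • ξ - b • η‖ ^ 2
    rw [hsq, mul_pow, hn]
    have h3 : (min 1 α * min a b) ^ 2 * e ≤ a * b * e := by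
      gcongr
      rw [mul_pow]
      nlinarith [sq_nonneg (min a b)]
    nlinarith
  · refine le_of_sq_le_sq ?_ (by positivity)
    change ‖a • ξ - b • η‖ ^ 2 ≤ _
    rw [hsq, mul_pow _ ‖ξ - η‖, hn]
    have h3 : a * b * e ≤ (max 1 α * max a b) ^ 2 * e := by
      gcongr
      rw [mul_pow]
      nlinarith [sq_nonneg (max a b)]
    nlinarith

theorem norm_warp (α : ℝ) (ξ : Space d) : ‖warp α ξ‖ = (1 + ‖ξ‖) ^ (α - 1) * ‖ξ‖ := by
  rw [warp, norm_smul, Real.norm_of_nonneg (Real.rpow_pos_of_pos (one_add_norm_pos ξ) _).le]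

theorem norm_warp_le (α : ℝ) (ξ : Space d) : ‖warp α ξ‖ ≤ (1 + ‖ξ‖) ^ α := by
  have h0 := one_add_norm_pos ξ
  rw [norm_warp, Real.rpow_sub_one h0.ne', div_mul_eq_mul_div, div_le_iff₀ h0]
  have := Real.rpow_pos_of_pos h0 α
  gcongr
  linarith

theorem rpow_le_norm_warp {α : ℝ} (hα : 0 < α) (ξ : Space d) :
    (1 + ‖ξ‖) ^ α ≤ 2 ^ α + 2 * ‖warp α ξ‖ := by
  have h0 := one_add_norm_pos ξ
  rcases le_total ‖ξ‖ 1 with h | h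
  · have : (1 + ‖ξ‖) ^ α ≤ 2 ^ α := by gcongr; linarith
    have := norm_nonneg (warp α ξ)
    linarith
  · have h2 : (1 + ‖ξ‖) ^ α ≤ 2 * ‖warp α ξ‖ := by
      rw [norm_warp, Real.rpow_sub_one h0.ne', div_mul_eq_mul_div, ← mul_div_assoc, le_div_iff₀ h0]
      have := Real.rpow_pos_of_pos h0 α
      nlinarith
    have : (0 : ℝ) < 2 ^ α := by positivity
    linarith

/-- Powers of `1 + |ξ|` are comparable up to polynomial factors of the warped distance. -/
theorem exists_rpow_le_warpDist (d : ℕ) {α : ℝ} (hα : 0 < α) (γ : ℝ) :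
    ∃ (C : ℝ) (m : ℕ), 0 < C ∧ ∀ ξ η : Space d,
      (1 + ‖ξ‖) ^ γ ≤ C * (1 + ‖η‖) ^ γ * (1 + warpDist α ξ η) ^ m := by
  set c : ℝ := 2 ^ α + 2
  have hc1 : 1 ≤ c := by
    have : (0 : ℝ) < 2 ^ α := by positivity
    simp only [c]; linarith
  have hc0 : 0 < c := by linarith
  -- The power `(1 + |ξ|) ^ α` is comparable to `|warp α ξ|` up to an additive constant, and
  -- `|warp|` changes by at most the warped distance. A root of order `α` follows.
  have key : ∀ ξ η : Space d,
      1 + ‖ξ‖ ≤ (c * (1 + warpDist α ξ η)) ^ (1 / α) * (1 + ‖η‖) := by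
    intro ξ η
    have h1 := rpow_le_norm_warp hα ξ
    have h2 := norm_warp_le α η
    have h3 : ‖warp α ξ‖ ≤ ‖warp α η‖ + warpDist α ξ η := norm_le_norm_add_norm_sub' _ _
    have h4 : 1 ≤ (1 + ‖η‖) ^ α := Real.one_le_rpow (by linarith [norm_nonneg η]) hα.le
    have h5 := warpDist_nonneg α ξ η
    have h6 : (1 + ‖ξ‖) ^ α ≤ c * (1 + warpDist α ξ η) * (1 + ‖η‖) ^ α := by
      have : (0 : ℝ) < 2 ^ α := by positivity
      have h7 : (2 : ℝ) ^ α ≤ 2 ^ α * ((1 + warpDist α ξ η) * (1 + ‖η‖) ^ α) := by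
        refine le_mul_of_one_le_right this.le ?_
        nlinarith
      have h8 : ‖warp α ξ‖ ≤ (1 + warpDist α ξ η) * (1 + ‖η‖) ^ α := by nlinarith
      simp only [c]
      nlinarith
    have h7 := Real.rpow_le_rpow (by positivity) h6 (by positivity : 0 ≤ 1 / α)
    rw [← Real.rpow_mul (by positivity), Real.mul_rpow (by positivity) (by positivity),
      ← Real.rpow_mul (by positivity), mul_one_div_cancel hα.ne', Real.rpow_one,
      Real.rpow_one] at h7
    exact h7
  obtain ⟨m, hm⟩ := exists_nat_ge (1 / α * |γ|)
  refine ⟨c ^ (1 / α * |γ|), m, by positivity, fun ξ η => ?_⟩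
  have h5 := warpDist_nonneg α ξ η
  have hk1 : 1 ≤ c * (1 + warpDist α ξ η) := by nlinarith
  have h := rpow_le_of_comparable (one_add_norm_pos ξ) (one_add_norm_pos η)
    (Real.one_le_rpow hk1 (by positivity)) (key ξ η) (by
      have := key η ξ
      rwa [warpDist_comm] at this) γ
  rw [← Real.rpow_mul (by positivity), Real.mul_rpow hc0.le (by positivity)] at h
  have h9 : (1 + warpDist α ξ η) ^ (1 / α * |γ|) ≤ (1 + warpDist α ξ η) ^ m := by
    rw [← Real.rpow_natCast]
    exact Real.rpow_le_rpow_of_exponent_le (by linarith) hm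
  calc _ ≤ _ := h
    _ ≤ c ^ (1 / α * |γ|) * (1 + warpDist α ξ η) ^ m * (1 + ‖η‖) ^ γ := by gcongr
    _ = _ := by ring

/-- Points in a common subdyadic ball have bounded warped distance. -/
theorem exists_warpDist_le (d : ℕ) {α : ℝ} (hα : 0 < α) {R : ℝ} (hR : 0 ≤ R) :
    ∃ C : ℝ, 0 < C ∧ ∀ ξ η : Space d, ‖η - ξ‖ ≤ R * (1 + ‖ξ‖) ^ (1 - α) →
      warpDist α ξ η ≤ C := by
  -- The summand `R` bounds `η` by `ξ`. For the converse, either the ball has radius at most half of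
  -- `1 + |ξ|`, whence the `2`, or `1 + |ξ| ≤ (2 R) ^ (1 / α)`.
  set c : ℝ := 2 + (2 * R) ^ (1 / α) + R
  have hp : 0 ≤ (2 * R) ^ (1 / α) := by positivity
  have hc1 : 1 ≤ c := by simp only [c]; linarith
  refine ⟨max 1 α * (c ^ |α - 1| * (R + 1)), by positivity, fun ξ η h => ?_⟩
  have hξ := one_add_norm_pos ξ
  have hη := one_add_norm_pos η
  have h1 : 1 ≤ 1 + ‖ξ‖ := by linarith [norm_nonneg ξ]
  have h1' : 1 ≤ 1 + ‖η‖ := by linarith [norm_nonneg η]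
  have hle : (1 + ‖ξ‖) ^ (1 - α) ≤ 1 + ‖ξ‖ := by
    calc _ ≤ (1 + ‖ξ‖) ^ (1 : ℝ) := Real.rpow_le_rpow_of_exponent_le h1 (by linarith)
      _ = _ := Real.rpow_one _
  have hηξ : 1 + ‖η‖ ≤ c * (1 + ‖ξ‖) := by
    have h2 : ‖η‖ ≤ ‖ξ‖ + ‖η - ξ‖ := norm_le_norm_add_norm_sub' _ _
    have h3 : ‖η - ξ‖ ≤ R * (1 + ‖ξ‖) := h.trans (by gcongr)
    simp only [c]
    nlinarith
  have hξη : 1 + ‖ξ‖ ≤ c * (1 + ‖η‖) := by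
    rcases le_total (2 * R) ((1 + ‖ξ‖) ^ α) with h2 | h2
    · have h3 : R * (1 + ‖ξ‖) ^ (1 - α) ≤ (1 + ‖ξ‖) / 2 := by
        have h4 : (1 + ‖ξ‖) ^ α * (1 + ‖ξ‖) ^ (1 - α) = 1 + ‖ξ‖ := by
          rw [← Real.rpow_add hξ]; simp
        have h5 : 0 < (1 + ‖ξ‖) ^ (1 - α) := by positivity
        nlinarith
      have h6 : ‖ξ‖ ≤ ‖η‖ + ‖η - ξ‖ := norm_le_norm_add_norm_sub _ _
      simp only [c]
      nlinarith
    · have h3 : 1 + ‖ξ‖ ≤ (2 * R) ^ (1 / α) := by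
        have := Real.rpow_le_rpow (by positivity) h2 (by positivity : 0 ≤ 1 / α)
        rwa [← Real.rpow_mul hξ.le, mul_one_div_cancel hα.ne', Real.rpow_one] at this
      simp only [c]
      nlinarith
  have hb := rpow_le_of_comparable hη hξ hc1 hηξ hξη (α - 1)
  have hcc : 1 ≤ c ^ |α - 1| := Real.one_le_rpow hc1 (abs_nonneg _)
  have ha : 0 < (1 + ‖ξ‖) ^ (α - 1) := by positivity
  have hmax : max ((1 + ‖ξ‖) ^ (α - 1)) ((1 + ‖η‖) ^ (α - 1))
      ≤ c ^ |α - 1| * (1 + ‖ξ‖) ^ (α - 1) := max_le (by nlinarith) hb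
  have hone : (1 + ‖ξ‖) ^ (α - 1) * (1 + ‖ξ‖) ^ (1 - α) = 1 := by
    rw [← Real.rpow_add hξ]; simp
  calc warpDist α ξ η
      ≤ max 1 α * max ((1 + ‖ξ‖) ^ (α - 1)) ((1 + ‖η‖) ^ (α - 1)) * ‖ξ - η‖ :=
        (warpDist_bounds hα ξ η).2
    _ ≤ max 1 α * (c ^ |α - 1| * (1 + ‖ξ‖) ^ (α - 1)) * (R * (1 + ‖ξ‖) ^ (1 - α)) := by
        rw [norm_sub_rev]
        gcongr
    _ = max 1 α * (c ^ |α - 1| * R) * ((1 + ‖ξ‖) ^ (α - 1) * (1 + ‖ξ‖) ^ (1 - α)) := by ring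
    _ ≤ _ := by
        rw [hone, mul_one]
        gcongr
        linarith

/-- Frequencies at small warped distance lie in a common subdyadic ball. -/
theorem exists_norm_sub_le (d : ℕ) {α : ℝ} (hα : 0 < α) :
    ∃ C : ℝ, 0 < C ∧ ∀ ξ η : Space d, warpDist α ξ η ≤ 1 →
      ‖ξ - η‖ ≤ C * warpDist α ξ η * (1 + ‖ξ‖) ^ (1 - α) := by
  obtain ⟨C, m, hC, h⟩ := exists_rpow_le_warpDist d hα (α - 1)
  have hm : 0 < min 1 α := lt_min one_pos hα
  refine ⟨(1 + C * 2 ^ m) / min 1 α, by positivity, fun ξ η hd => ?_⟩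
  have hξ := one_add_norm_pos ξ
  have hη := one_add_norm_pos η
  have h5 := warpDist_nonneg α ξ η
  have ha : 0 < (1 + ‖ξ‖) ^ (α - 1) := by positivity
  have hb : 0 < (1 + ‖η‖) ^ (α - 1) := by positivity
  have h1 : (1 + ‖ξ‖) ^ (α - 1) ≤ C * (1 + ‖η‖) ^ (α - 1) * 2 ^ m := by
    refine (h ξ η).trans ?_
    gcongr
    linarith
  have hC2 : 0 < C * 2 ^ m := by positivity
  have h2 : (1 + ‖ξ‖) ^ (α - 1)
      ≤ (1 + C * 2 ^ m) * min ((1 + ‖ξ‖) ^ (α - 1)) ((1 + ‖η‖) ^ (α - 1)) := by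
    rw [mul_min_of_nonneg _ _ (by positivity)]
    exact le_min (by nlinarith) (by nlinarith)
  have hone : (1 + ‖ξ‖) ^ (α - 1) * (1 + ‖ξ‖) ^ (1 - α) = 1 := by
    rw [← Real.rpow_add hξ]; simp
  have hlow := (warpDist_bounds hα ξ η).1
  have hs : 0 < (1 + ‖ξ‖) ^ (1 - α) := by positivity
  calc ‖ξ - η‖ = ((1 + ‖ξ‖) ^ (α - 1) * ‖ξ - η‖) * (1 + ‖ξ‖) ^ (1 - α) := by
        rw [mul_right_comm, hone, one_mul]
    _ ≤ ((1 + C * 2 ^ m) / min 1 α * warpDist α ξ η) * (1 + ‖ξ‖) ^ (1 - α) := by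
        refine mul_le_mul_of_nonneg_right ?_ hs.le
        rw [div_mul_eq_mul_div, le_div_iff₀ hm]
        calc (1 + ‖ξ‖) ^ (α - 1) * ‖ξ - η‖ * min 1 α
            ≤ (1 + C * 2 ^ m) * min ((1 + ‖ξ‖) ^ (α - 1)) ((1 + ‖η‖) ^ (α - 1))
              * ‖ξ - η‖ * min 1 α := by gcongr
          _ = (1 + C * 2 ^ m) *
              (min 1 α * min ((1 + ‖ξ‖) ^ (α - 1)) ((1 + ‖η‖) ^ (α - 1)) * ‖ξ - η‖) := by ring
          _ ≤ _ := by gcongr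

end Dispersive
end

noncomputable section
namespace Dispersive

variable {d : ℕ}

/-! ### Phase-space distances -/

/-- A substitute for `1 + quasiDist α w z`, comparable to it up to powers. -/
def gap (α : ℝ) (w z : Space d × Space d) : ℝ :=
  (1 + warpDist α w.2 z.2) * (1 + (1 + ‖w.2‖) ^ (1 - α) * ‖w.1 - z.1‖)

theorem one_le_one_add_scaled (α : ℝ) (ξ x : Space d) : 1 ≤ 1 + (1 + ‖ξ‖) ^ (1 - α) * ‖x‖ := by
  have : 0 ≤ (1 + ‖ξ‖) ^ (1 - α) * ‖x‖ := by positivity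
  linarith

theorem one_le_one_add_warpDist (α : ℝ) (ξ η : Space d) : 1 ≤ 1 + warpDist α ξ η := by
  linarith [warpDist_nonneg α ξ η]

theorem one_le_gap (α : ℝ) (w z : Space d × Space d) : 1 ≤ gap α w z :=
  one_le_mul_of_one_le_of_one_le (one_le_one_add_warpDist _ _ _) (one_le_one_add_scaled _ _ _)

theorem quasiDist_nonneg (α : ℝ) (w z : Space d × Space d) : 0 ≤ quasiDist α w z := by
  unfold quasiDist
  have : 0 ≤ min ‖w.2‖ ‖z.2‖ := le_min (norm_nonneg _) (norm_nonneg _)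
  positivity

/-- The minimum in `quasiDist` is one of the two frequencies, and exchanging them costs a power of
the warped distance by `exists_rpow_le_warpDist`. The frequency term is then bounded through the
lower estimate of `warpDist_bounds`. -/
theorem exists_quasiDist_le_gap (d : ℕ) {α : ℝ} (hα : 0 < α) :
    ∃ (C : ℝ) (m : ℕ), 0 < C ∧ ∀ w z : Space d × Space d,
      1 + quasiDist α w z ≤ C * gap α w z ^ m := by
  obtain ⟨C₁, m₁, hC₁, h₁⟩ := exists_rpow_le_warpDist d hα (1 - α)
  obtain ⟨C₂, m₂, hC₂, h₂⟩ := exists_rpow_le_warpDist d hα (α - 1)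
  have hm : 0 < min 1 α := lt_min one_pos hα
  refine ⟨1 + (1 + C₁) + (1 + C₂) / min 1 α, m₁ + m₂ + 1, by positivity, fun w z => ?_⟩
  have hΔ1 := one_le_one_add_warpDist α w.2 z.2
  have hX1 := one_le_one_add_scaled α w.2 (w.1 - z.1)
  have hw := one_add_norm_pos w.2
  have hz := one_add_norm_pos z.2
  have hg := one_le_gap α w z
  have hgΔ : 1 + warpDist α w.2 z.2 ≤ gap α w z := by unfold gap; nlinarith
  have hpow : ∀ n ≤ m₁ + m₂ + 1, gap α w z ^ n ≤ gap α w z ^ (m₁ + m₂ + 1) := fun n hn =>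
    pow_le_pow_right₀ hg hn
  have hmin : ∀ γ : ℝ, (1 + min ‖w.2‖ ‖z.2‖) ^ γ = (1 + ‖w.2‖) ^ γ ∨
      (1 + min ‖w.2‖ ‖z.2‖) ^ γ = (1 + ‖z.2‖) ^ γ := fun γ => by
    rcases min_choice ‖w.2‖ ‖z.2‖ with h | h <;> simp [h]
  have hsp : (1 + min ‖w.2‖ ‖z.2‖) ^ (1 - α) * ‖w.1 - z.1‖
      ≤ (1 + C₁) * gap α w z ^ (m₁ + m₂ + 1) := by
    have e1 : (1 + min ‖w.2‖ ‖z.2‖) ^ (1 - α)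
        ≤ (1 + C₁) * (1 + warpDist α w.2 z.2) ^ m₁ * (1 + ‖w.2‖) ^ (1 - α) := by
      have hp : 1 ≤ (1 + warpDist α w.2 z.2) ^ m₁ := one_le_pow₀ hΔ1
      have hs : 0 < (1 + ‖w.2‖) ^ (1 - α) := by positivity
      rcases hmin (1 - α) with h | h <;> rw [h]
      · refine le_mul_of_one_le_left hs.le ?_
        nlinarith
      · have := h₁ z.2 w.2
        rw [warpDist_comm] at this
        have hps : 0 < (1 + warpDist α w.2 z.2) ^ m₁ * (1 + ‖w.2‖) ^ (1 - α) := by positivity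
        nlinarith
    calc _ ≤ (1 + C₁) * (1 + warpDist α w.2 z.2) ^ m₁ * (1 + ‖w.2‖) ^ (1 - α) * ‖w.1 - z.1‖ := by
          gcongr
      _ = (1 + C₁) * ((1 + warpDist α w.2 z.2) ^ m₁ * ((1 + ‖w.2‖) ^ (1 - α) * ‖w.1 - z.1‖)) := by
          ring
      _ ≤ (1 + C₁) * (gap α w z ^ m₁ * gap α w z) := by
          have h0 : (1 + ‖w.2‖) ^ (1 - α) * ‖w.1 - z.1‖ ≤ gap α w z := by unfold gap; nlinarith
          have h00 := warpDist_nonneg α w.2 z.2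
          gcongr
      _ ≤ _ := by
          rw [← pow_succ]
          gcongr
          omega
  have hfr : (1 + min ‖w.2‖ ‖z.2‖) ^ (α - 1) * ‖w.2 - z.2‖
      ≤ (1 + C₂) / min 1 α * gap α w z ^ (m₁ + m₂ + 1) := by
    have hlow := (warpDist_bounds hα w.2 z.2).1
    have ha : 0 < (1 + ‖w.2‖) ^ (α - 1) := by positivity
    have hb : 0 < (1 + ‖z.2‖) ^ (α - 1) := by positivity
    have hp : 1 ≤ (1 + warpDist α w.2 z.2) ^ m₂ := one_le_pow₀ hΔ1
    have e1 : (1 + min ‖w.2‖ ‖z.2‖) ^ (α - 1) ≤ (1 + C₂) * (1 + warpDist α w.2 z.2) ^ m₂ *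
        min ((1 + ‖w.2‖) ^ (α - 1)) ((1 + ‖z.2‖) ^ (α - 1)) := by
      have h12 := h₂ w.2 z.2
      have h21 := h₂ z.2 w.2
      rw [warpDist_comm] at h21
      have p1 := mul_pos ha (zero_lt_one.trans_le hp)
      have p2 := mul_pos hb (zero_lt_one.trans_le hp)
      rw [mul_min_of_nonneg _ _ (by positivity)]
      rcases hmin (α - 1) with h | h <;> rw [h] <;> refine le_min ?_ ?_ <;> nlinarith
    calc _ ≤ (1 + C₂) * (1 + warpDist α w.2 z.2) ^ m₂ *
          min ((1 + ‖w.2‖) ^ (α - 1)) ((1 + ‖z.2‖) ^ (α - 1)) * ‖w.2 - z.2‖ := by gcongr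
      _ = (1 + C₂) / min 1 α * ((1 + warpDist α w.2 z.2) ^ m₂ * (min 1 α *
          min ((1 + ‖w.2‖) ^ (α - 1)) ((1 + ‖z.2‖) ^ (α - 1)) * ‖w.2 - z.2‖)) := by
          field_simp
      _ ≤ (1 + C₂) / min 1 α * (gap α w z ^ m₂ * gap α w z) := by
          have h00 := warpDist_nonneg α w.2 z.2
          gcongr
          linarith
      _ ≤ _ := by
          rw [← pow_succ]
          gcongr
          omega
  have h1 : 1 ≤ gap α w z ^ (m₁ + m₂ + 1) := one_le_pow₀ hg
  unfold quasiDist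
  nlinarith

/-! ### Sums over relatively separated families -/

/-- Up to the factor `(1 + δ) ^ (d + 1)`, each term is at most the mean of the function over the
ball of radius `δ` about `z k`. At most `N` of these balls overlap, so the sum is bounded by an
integral independent of `z₀` and of the family. -/
theorem exists_tsum_le_of_overlap (d : ℕ) {δ : ℝ} (hδ : 0 < δ) (N : ℕ) :
    ∃ C : ℝ≥0∞, C ≠ ∞ ∧ ∀ {κ : Type} [Countable κ] (z : κ → Space d),
      (∀ y, {k | ‖y - z k‖ ≤ δ}.encard ≤ N) → ∀ z₀ : Space d,
        ∑' k, ENNReal.ofReal (((1 + ‖z₀ - z k‖) ^ (d + 1))⁻¹) ≤ C := by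
  set F : Space d → ℝ≥0∞ := fun y => ENNReal.ofReal (((1 + ‖y‖) ^ (d + 1))⁻¹) with hF
  have hFm : Measurable F := by
    refine ENNReal.measurable_ofReal.comp ?_
    fun_prop
  have hfin : ∫⁻ y, F y < ∞ := by
    have h := finite_integral_one_add_norm (E := Space d) (μ := volume) (r := d + 1) (by simp)
    refine lt_of_eq_of_lt (lintegral_congr fun y => ?_) h
    simp only [hF]
    rw [Real.rpow_neg (by positivity)]
    congr 2
    exact_mod_cast (Real.rpow_natCast (1 + ‖y‖) (d + 1)).symm
  set v := volume (Metric.closedBall (0 : Space d) δ) with hv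
  have hv0 : v ≠ 0 := (Metric.measure_closedBall_pos volume _ hδ).ne'
  have hvt : v ≠ ∞ := measure_closedBall_lt_top.ne
  set c : ℝ≥0∞ := ENNReal.ofReal ((1 + δ) ^ (d + 1)) with hc
  refine ⟨c * (N * ∫⁻ y, F y) / v, (ENNReal.div_lt_top (ENNReal.mul_ne_top ENNReal.ofReal_ne_top
    (ENNReal.mul_ne_top (by simp) hfin.ne)) hv0).ne, fun {κ} _ z hz z₀ => ?_⟩
  rw [ENNReal.le_div_iff_mul_le (Or.inl hv0) (Or.inl hvt), ← ENNReal.tsum_mul_right]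
  have hterm : ∀ k, F (z₀ - z k) * v
      ≤ c * ∫⁻ y, (Metric.closedBall (z k) δ).indicator (fun y => F (z₀ - y)) y := by
    intro k
    rw [lintegral_indicator Metric.isClosed_closedBall.measurableSet, hv,
      ← Measure.addHaar_closedBall_center volume (z k), ← setLIntegral_const,
      ← lintegral_const_mul _ (by fun_prop)]
    refine setLIntegral_mono' Metric.isClosed_closedBall.measurableSet fun y hy => ?_
    rw [mem_closedBall_iff_norm] at hy
    simp only [hF, hc]
    rw [← ENNReal.ofReal_mul (by positivity)]
    apply ENNReal.ofReal_le_ofReal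
    rw [← div_eq_mul_inv, inv_eq_one_div, div_le_div_iff₀ (by positivity) (by positivity), one_mul,
      ← mul_pow]
    gcongr
    have h1 : ‖z₀ - y‖ ≤ ‖z₀ - z k‖ + ‖y - z k‖ := by
      rw [norm_sub_rev y]; exact norm_sub_le_norm_sub_add_norm_sub _ _ _
    nlinarith [norm_nonneg (z₀ - z k)]
  calc ∑' k, F (z₀ - z k) * v
      ≤ ∑' k, c * ∫⁻ y, (Metric.closedBall (z k) δ).indicator (fun y => F (z₀ - y)) y :=
        ENNReal.tsum_le_tsum hterm
    _ = c * ∫⁻ y, ∑' k, (Metric.closedBall (z k) δ).indicator (fun y => F (z₀ - y)) y := by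
        rw [ENNReal.tsum_mul_left, lintegral_tsum fun k => ?_]
        exact ((hFm.comp (by fun_prop)).indicator
          Metric.isClosed_closedBall.measurableSet).aemeasurable
    _ ≤ c * ∫⁻ y, N * F (z₀ - y) := by
        gcongr with y
        have h1 : ∀ k, (Metric.closedBall (z k) δ).indicator (fun y => F (z₀ - y)) y
            = {k | ‖y - z k‖ ≤ δ}.indicator (fun _ => 1) k * F (z₀ - y) := by
          intro k
          by_cases h : ‖y - z k‖ ≤ δ
          · rw [Set.indicator_of_mem (mem_closedBall_iff_norm.2 h),
              Set.indicator_of_mem (by exact h), one_mul]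
          · rw [Set.indicator_of_notMem (fun h' => h (mem_closedBall_iff_norm.1 h')),
              Set.indicator_of_notMem (by exact h), zero_mul]
        simp_rw [h1]
        rw [ENNReal.tsum_mul_right, ← tsum_subtype, ENNReal.tsum_set_one]
        gcongr
        exact_mod_cast hz y
    _ = c * (N * ∫⁻ y, F y) := by
        have hFm' : Measurable fun y => F (z₀ - y) := hFm.comp (by fun_prop)
        rw [lintegral_const_mul _ hFm', lintegral_sub_left_eq_self F z₀]

/-! ### Geometry of admissible lattices -/

/-- A frequency with `|ξ_k| ^ α ≤ C` has the origin in its ball. Finite overlap at the origin leaves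
finitely many of these, all nonzero. This allows `|ξ_k|` and `1 + |ξ_k|` to be exchanged in every
power. -/
theorem Lattice.IsAdmissible.exists_le_norm_freq {Ω : Lattice d} {α C : ℝ} (hα : 0 < α)
    (h : Ω.IsAdmissible α C) : ∃ c : ℝ, 0 < c ∧ ∀ k, c ≤ ‖Ω.freq k‖ := by
  obtain ⟨N, hN⟩ := h.freq_overlap
  have hs : {k : ℕ | ‖0 - Ω.freq k‖ ≤ C * ‖Ω.freq k‖ ^ (1 - α)}.Finite :=
    Set.finite_of_encard_le_coe (hN 0)
  have hpos : ∀ k, 0 < ‖Ω.freq k‖ := fun k => norm_pos_iff.2 (Ω.freq_ne_zero k)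
  set S : ℝ := ∑ k ∈ hs.toFinset, ‖Ω.freq k‖⁻¹
  have hS : 0 ≤ S := Finset.sum_nonneg fun k _ => (inv_pos.2 (hpos k)).le
  have hC := h.pos_const
  refine ⟨min (C ^ (1 / α)) (1 + S)⁻¹, by positivity, fun k => ?_⟩
  by_cases hk : ‖0 - Ω.freq k‖ ≤ C * ‖Ω.freq k‖ ^ (1 - α)
  · refine (min_le_right _ _).trans (inv_le_of_inv_le₀ (hpos k) ?_)
    have : ‖Ω.freq k‖⁻¹ ≤ S := Finset.single_le_sum (f := fun k => ‖Ω.freq k‖⁻¹)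
      (fun k _ => (inv_pos.2 (hpos k)).le) (hs.mem_toFinset.2 hk)
    linarith
  · rw [zero_sub, norm_neg, not_le] at hk
    refine (min_le_left _ _).trans ?_
    have h1 : C ≤ ‖Ω.freq k‖ ^ α := by
      have h2 : ‖Ω.freq k‖ ^ α * ‖Ω.freq k‖ ^ (1 - α) = ‖Ω.freq k‖ := by
        rw [← Real.rpow_add (hpos k)]; simp
      have h3 : 0 < ‖Ω.freq k‖ ^ (1 - α) := Real.rpow_pos_of_pos (hpos k) _
      nlinarith
    have h2 := Real.rpow_le_rpow hC.le h1 (by positivity : 0 ≤ 1 / α)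
    rwa [← Real.rpow_mul (hpos k).le, mul_one_div_cancel hα.ne', Real.rpow_one] at h2

theorem exists_rpow_norm_comparable {c : ℝ} (hc : 0 < c) (γ : ℝ) :
    ∃ A : ℝ, 1 ≤ A ∧ ∀ ξ : Space d, c ≤ ‖ξ‖ →
      (1 + ‖ξ‖) ^ γ ≤ A * ‖ξ‖ ^ γ ∧ ‖ξ‖ ^ γ ≤ A * (1 + ‖ξ‖) ^ γ := by
  have hA : 1 ≤ 1 + c⁻¹ := by
    have : 0 < c⁻¹ := by positivity
    linarith
  refine ⟨(1 + c⁻¹) ^ |γ|, Real.one_le_rpow hA (abs_nonneg _), fun ξ hξ => ?_⟩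
  have h0 : 0 < ‖ξ‖ := hc.trans_le hξ
  have h1 : 1 + ‖ξ‖ ≤ (1 + c⁻¹) * ‖ξ‖ := by
    have : 1 ≤ c⁻¹ * ‖ξ‖ := by rwa [inv_mul_eq_div, one_le_div hc]
    linarith
  have h2 : ‖ξ‖ ≤ (1 + c⁻¹) * (1 + ‖ξ‖) := by nlinarith
  exact ⟨rpow_le_of_comparable (one_add_norm_pos ξ) h0 hA h1 h2 γ,
    rpow_le_of_comparable h0 (one_add_norm_pos ξ) hA h2 h1 γ⟩

/-- The warped frequencies are relatively separated. If several lie within `δ` of `y`, choose one of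
them, `k₀`; then `ξ_{k₀}` belongs to the frequency balls of all the others, and there are at most
`N` such balls. -/
theorem Lattice.IsAdmissible.exists_tsum_freq_le {Ω : Lattice d} {α C : ℝ} (hα : 0 < α)
    (h : Ω.IsAdmissible α C) : ∃ K : ℝ≥0∞, K ≠ ∞ ∧ ∀ ξ : Space d,
      ∑' k, ENNReal.ofReal (((1 + warpDist α ξ (Ω.freq k)) ^ (d + 1))⁻¹) ≤ K := by
  obtain ⟨N, hN⟩ := h.freq_overlap
  obtain ⟨c, hc, hfreq⟩ := h.exists_le_norm_freq hα
  obtain ⟨A, hA, hcomp⟩ := exists_rpow_norm_comparable (d := d) hc (1 - α)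
  obtain ⟨B, hB, hsub⟩ := exists_norm_sub_le d hα
  have hC := h.pos_const
  have hA0 : 0 < A := by linarith
  -- The first bound makes `2 δ ≤ 1`, as `exists_norm_sub_le` requires; the second brings the
  -- resulting radius below `C |ξ_k| ^ (1 - α)`.
  set δ : ℝ := min (1 / 2) (C / (2 * B * A)) with hδ
  have hδ0 : 0 < δ := by positivity
  have hδ1 : δ ≤ 1 / 2 := min_le_left _ _
  have hδ2 : B * (2 * δ) * A ≤ C := by
    have : δ ≤ C / (2 * B * A) := min_le_right _ _
    rw [le_div_iff₀ (by positivity)] at this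
    linarith
  obtain ⟨K, hK, hsum⟩ := exists_tsum_le_of_overlap d hδ0 N
  refine ⟨K, hK, fun ξ => hsum (fun k => warp α (Ω.freq k)) (fun y => ?_) (warp α ξ)⟩
  rcases Set.eq_empty_or_nonempty {k | ‖y - warp α (Ω.freq k)‖ ≤ δ} with he | ⟨k₀, hk₀⟩
  · rw [he]; simp
  refine (Set.encard_le_encard fun k hk => ?_).trans (hN (Ω.freq k₀))
  rw [Set.mem_ofPred_eq] at hk hk₀ ⊢
  have h1 : warpDist α (Ω.freq k) (Ω.freq k₀) ≤ 2 * δ := by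
    have := norm_sub_le_norm_sub_add_norm_sub (warp α (Ω.freq k)) y (warp α (Ω.freq k₀))
    rw [norm_sub_rev _ y] at this
    unfold warpDist
    linarith
  have h2 := hsub _ _ (h1.trans (by linarith))
  rw [norm_sub_rev]
  have h3 := (hcomp _ (hfreq k)).1
  calc _ ≤ _ := h2
    _ ≤ B * (2 * δ) * (A * ‖Ω.freq k‖ ^ (1 - α)) := by
        have := warpDist_nonneg α (Ω.freq k) (Ω.freq k₀)
        gcongr
    _ = B * (2 * δ) * A * ‖Ω.freq k‖ ^ (1 - α) := by ring
    _ ≤ _ := by gcongr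

/-- Dilation by `(1 + |ξ_k|) ^ (1 - α)` turns the spatial balls of the blocks of frequency `ξ_k`
into balls of radius bounded below. Block overlap in the slice of frequency `ξ_k` is then the
hypothesis of `exists_tsum_le_of_overlap`. -/
theorem Lattice.IsAdmissible.exists_tsum_pos_le {Ω : Lattice d} {α C : ℝ} (hα : 0 < α)
    (h : Ω.IsAdmissible α C) : ∃ K : ℝ≥0∞, K ≠ ∞ ∧ ∀ (k : ℕ) (x : Space d),
      ∑' j, ENNReal.ofReal
        (((1 + (1 + ‖Ω.freq k‖) ^ (1 - α) * ‖x - Ω.pos j k‖) ^ (d + 1))⁻¹) ≤ K := by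
  obtain ⟨N, hN⟩ := h.overlap
  obtain ⟨c, hc, hfreq⟩ := h.exists_le_norm_freq hα
  obtain ⟨A, hA, hcomp⟩ := exists_rpow_norm_comparable (d := d) hc (α - 1)
  have hC := h.pos_const
  have hA0 : 0 < A := by linarith
  obtain ⟨K, hK, hsum⟩ := exists_tsum_le_of_overlap d (show 0 < C / A by positivity) N
  refine ⟨K, hK, fun k x => ?_⟩
  set s := (1 + ‖Ω.freq k‖) ^ (1 - α) with hs
  have hs0 : 0 < s := by positivity
  have hsi : s⁻¹ = (1 + ‖Ω.freq k‖) ^ (α - 1) := by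
    rw [hs, ← Real.rpow_neg (one_add_norm_pos _).le, neg_sub]
  have hnorm : ∀ y z : Space d, ‖s • y - s • z‖ = s * ‖y - z‖ := fun y z => by
    rw [← smul_sub, norm_smul, Real.norm_of_nonneg hs0.le]
  have := hsum (fun j => s • Ω.pos j k) (fun y => ?_) (s • x)
  · simpa only [hnorm] using this
  have hinj : Function.Injective fun j : Fin d → ℤ => ((j, k) : Index d) := fun a b hab => by
    simpa using hab
  rw [← hinj.encard_image]
  refine (Set.encard_le_encard ?_).trans (hN (s⁻¹ • y, Ω.freq k))
  rintro _ ⟨j, hj, rfl⟩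
  rw [Set.mem_ofPred_eq] at hj
  refine ⟨?_, ?_⟩
  · have h1 : ‖y - s • Ω.pos j k‖ = s * ‖s⁻¹ • y - Ω.pos j k‖ := by
      rw [← hnorm, smul_smul, mul_inv_cancel₀ hs0.ne', one_smul]
    rw [h1] at hj
    have h2 := (hcomp _ (hfreq k)).1
    change ‖s⁻¹ • y - Ω.pos j k‖ ≤ C * 1 * ‖Ω.freq k‖ ^ (α - 1)
    calc _ = s⁻¹ * (s * ‖s⁻¹ • y - Ω.pos j k‖) := by
          rw [← mul_assoc, inv_mul_cancel₀ hs0.ne', one_mul]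
      _ ≤ (A * ‖Ω.freq k‖ ^ (α - 1)) * (C / A) := by
          rw [hsi] at *
          gcongr
      _ = _ := by field_simp
  · change ‖Ω.freq k - Ω.freq k‖ ≤ _
    rw [sub_self, norm_zero]
    positivity

/-- Here `gap` measures positions at the scale of `w`, while the sum over `j` is controlled at the
scale of `ξ_k`. The change of scale costs `m` powers of the warped factor in each of the `d + 1`
powers needed for summation, which explains the exponent. -/
theorem Lattice.IsAdmissible.exists_tsum_gap_row_le {Ω : Lattice d} {α C : ℝ} (hα : 0 < α)
    (h : Ω.IsAdmissible α C) (n : ℕ) : ∃ (N : ℕ) (K : ℝ≥0∞), K ≠ ∞ ∧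
      ∀ (w : Space d × Space d) (k : ℕ), ∑' j, ENNReal.ofReal ((gap α w (Ω.point (j, k)) ^ N)⁻¹)
        ≤ K * ENNReal.ofReal (((1 + warpDist α w.2 (Ω.freq k)) ^ n)⁻¹) := by
  obtain ⟨K, hK, hsum⟩ := h.exists_tsum_pos_le hα
  obtain ⟨B, m, hB, hrat⟩ := exists_rpow_le_warpDist d hα (1 - α)
  refine ⟨n + m * (d + 1) + (d + 1), ENNReal.ofReal ((1 + B) ^ (d + 1)) * K,
    ENNReal.mul_ne_top ENNReal.ofReal_ne_top hK, fun w k => ?_⟩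
  have hΔ1 := one_le_one_add_warpDist α w.2 (Ω.freq k)
  set Δ := 1 + warpDist α w.2 (Ω.freq k) with hΔ
  set s := (1 + ‖Ω.freq k‖) ^ (1 - α) with hs
  calc ∑' j, ENNReal.ofReal ((gap α w (Ω.point (j, k)) ^ (n + m * (d + 1) + (d + 1)))⁻¹)
      ≤ ∑' j, ENNReal.ofReal ((1 + B) ^ (d + 1)) * ENNReal.ofReal ((Δ ^ n)⁻¹) *
          ENNReal.ofReal (((1 + s * ‖w.1 - Ω.pos j k‖) ^ (d + 1))⁻¹) := by
        refine ENNReal.tsum_le_tsum fun j => ?_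
        rw [← ENNReal.ofReal_mul (by positivity), ← ENNReal.ofReal_mul (by positivity)]
        apply ENNReal.ofReal_le_ofReal
        have hX1 := one_le_one_add_scaled α w.2 (w.1 - Ω.pos j k)
        change ((Δ * (1 + (1 + ‖w.2‖) ^ (1 - α) * ‖w.1 - Ω.pos j k‖)) ^ _)⁻¹ ≤ _
        set X := 1 + (1 + ‖w.2‖) ^ (1 - α) * ‖w.1 - Ω.pos j k‖ with hX
        have h1 : 1 + s * ‖w.1 - Ω.pos j k‖ ≤ (1 + B) * Δ ^ m * X := by
          have h2 := hrat (Ω.freq k) w.2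
          rw [warpDist_comm, ← hΔ, ← hs] at h2
          have h3 : s * ‖w.1 - Ω.pos j k‖ ≤ B * Δ ^ m * ((1 + ‖w.2‖) ^ (1 - α) *
              ‖w.1 - Ω.pos j k‖) := by
            calc _ ≤ B * (1 + ‖w.2‖) ^ (1 - α) * Δ ^ m * ‖w.1 - Ω.pos j k‖ := by gcongr
              _ = _ := by ring
          have h4 : 1 ≤ Δ ^ m := one_le_pow₀ hΔ1
          have h5 : 0 ≤ (1 + ‖w.2‖) ^ (1 - α) * ‖w.1 - Ω.pos j k‖ := by positivity
          rw [hX]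
          have h6 : 0 ≤ Δ ^ m * ((1 + ‖w.2‖) ^ (1 - α) * ‖w.1 - Ω.pos j k‖) := by positivity
          nlinarith
        have hs0 : 0 ≤ s * ‖w.1 - Ω.pos j k‖ := by positivity
        rw [← div_eq_mul_inv, ← div_eq_mul_inv, inv_eq_one_div, div_div,
          div_le_div_iff₀ (by positivity) (by positivity), one_mul]
        calc Δ ^ n * (1 + s * ‖w.1 - Ω.pos j k‖) ^ (d + 1)
            ≤ Δ ^ n * ((1 + B) * Δ ^ m * X) ^ (d + 1) := by gcongr
          _ = (1 + B) ^ (d + 1) * (Δ ^ (n + m * (d + 1)) * X ^ (d + 1)) := by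
            rw [mul_pow, mul_pow, pow_add Δ, pow_mul Δ]; ring
          _ ≤ (1 + B) ^ (d + 1) * (Δ ^ (n + m * (d + 1) + (d + 1)) *
              X ^ (n + m * (d + 1) + (d + 1))) := by
            have e1 := pow_le_pow_right₀ hΔ1
              (show n + m * (d + 1) ≤ n + m * (d + 1) + (d + 1) by omega)
            have e2 := pow_le_pow_right₀ hX1
              (show d + 1 ≤ n + m * (d + 1) + (d + 1) from Nat.le_add_left _ _)
            gcongr
          _ = _ := by rw [← mul_pow]
    _ = ENNReal.ofReal ((1 + B) ^ (d + 1)) * ENNReal.ofReal ((Δ ^ n)⁻¹) *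
          ∑' j, ENNReal.ofReal (((1 + s * ‖w.1 - Ω.pos j k‖) ^ (d + 1))⁻¹) :=
        ENNReal.tsum_mul_left
    _ ≤ ENNReal.ofReal ((1 + B) ^ (d + 1)) * ENNReal.ofReal ((Δ ^ n)⁻¹) * K := by
        gcongr
        exact hsum k w.1
    _ = _ := by ring

/-- `gap` is not symmetric, so columns are treated apart from rows. Positions are now measured at
the scale of `ξ_k`, and no change of scale is needed. -/
theorem Lattice.IsAdmissible.exists_tsum_gap_col_le {Ω : Lattice d} {α C : ℝ} (hα : 0 < α)
    (h : Ω.IsAdmissible α C) (n : ℕ) : ∃ (K : ℝ≥0∞), K ≠ ∞ ∧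
      ∀ (w : Space d × Space d) (k : ℕ), ∑' j, ENNReal.ofReal
          ((gap α (Ω.point (j, k)) w ^ (n + (d + 1)))⁻¹)
        ≤ K * ENNReal.ofReal (((1 + warpDist α (Ω.freq k) w.2) ^ n)⁻¹) := by
  obtain ⟨K, hK, hsum⟩ := h.exists_tsum_pos_le hα
  refine ⟨K, hK, fun w k => ?_⟩
  have hΔ1 := one_le_one_add_warpDist α (Ω.freq k) w.2
  set Δ := 1 + warpDist α (Ω.freq k) w.2 with hΔ
  rw [mul_comm]
  refine le_trans ?_ (mul_le_mul_right (hsum k w.1) _)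
  rw [← ENNReal.tsum_mul_left]
  refine ENNReal.tsum_le_tsum fun j => ?_
  rw [← ENNReal.ofReal_mul (by positivity)]
  apply ENNReal.ofReal_le_ofReal
  have hX1 := one_le_one_add_scaled α (Ω.freq k) (Ω.pos j k - w.1)
  change ((Δ * (1 + (1 + ‖Ω.freq k‖) ^ (1 - α) * ‖Ω.pos j k - w.1‖)) ^ _)⁻¹ ≤ _
  rw [norm_sub_rev w.1]
  set X := 1 + (1 + ‖Ω.freq k‖) ^ (1 - α) * ‖Ω.pos j k - w.1‖
  rw [← mul_inv, mul_pow]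
  have e1 := pow_le_pow_right₀ hΔ1 (show n ≤ n + (d + 1) by omega)
  have e2 := pow_le_pow_right₀ hX1 (show d + 1 ≤ n + (d + 1) by omega)
  exact inv_anti₀ (by positivity) (mul_le_mul e1 e2 (by positivity) (by positivity))

theorem Lattice.IsAdmissible.exists_tsum_gap_le {Ω : Lattice d} {α C : ℝ} (hα : 0 < α)
    (h : Ω.IsAdmissible α C) : ∃ (N : ℕ) (K : ℝ≥0∞), K ≠ ∞ ∧
      ∀ w : Space d × Space d,
        ∑' i, ENNReal.ofReal ((gap α w (Ω.point i) ^ N)⁻¹) ≤ K := by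
  obtain ⟨N, K, hK, hrow⟩ := h.exists_tsum_gap_row_le hα (d + 1)
  obtain ⟨K', hK', hfr⟩ := h.exists_tsum_freq_le hα
  refine ⟨N, K * K', ENNReal.mul_ne_top hK hK', fun w => ?_⟩
  rw [ENNReal.tsum_prod', ENNReal.tsum_comm]
  calc _ ≤ ∑' k, K * ENNReal.ofReal (((1 + warpDist α w.2 (Ω.freq k)) ^ (d + 1))⁻¹) :=
        ENNReal.tsum_le_tsum fun k => hrow w k
    _ ≤ _ := by
        rw [ENNReal.tsum_mul_left]
        gcongr
        exact hfr w.2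

end Dispersive
end

noncomputable section
namespace Dispersive

variable {d : ℕ}

/-! ### Slowly varying weights on phase space -/

/-- A weight centred at `b` which dominates a power of `gap α b` and varies slowly between points
whose frequencies lie in a common subdyadic ball. -/
def slowWeight (α : ℝ) (m : ℕ) (b w : Space d × Space d) : ℝ :=
  max (1 + warpDist α b.2 w.2)
    ((1 + (1 + ‖b.2‖) ^ (1 - α) * ‖b.1 - w.1‖) ^ (1 / ((m : ℝ) + 1)))

theorem one_le_slowWeight (α : ℝ) (m : ℕ) (b w : Space d × Space d) : 1 ≤ slowWeight α m b w :=
  (one_le_one_add_warpDist α b.2 w.2).trans (le_max_left _ _)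

theorem slowWeight_self (α : ℝ) (m : ℕ) (b : Space d × Space d) : slowWeight α m b b = 1 := by
  simp [slowWeight, warpDist]

theorem le_slowWeight_pow (α : ℝ) (m : ℕ) (b w : Space d × Space d) :
    1 + (1 + ‖b.2‖) ^ (1 - α) * ‖b.1 - w.1‖ ≤ slowWeight α m b w ^ (m + 1) := by
  have h0 : 0 ≤ 1 + (1 + ‖b.2‖) ^ (1 - α) * ‖b.1 - w.1‖ := by positivity
  have h1 := le_max_right (1 + warpDist α b.2 w.2)
    ((1 + (1 + ‖b.2‖) ^ (1 - α) * ‖b.1 - w.1‖) ^ (1 / ((m : ℝ) + 1)))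
  have h2 := pow_le_pow_left₀ (by positivity) h1 (m + 1)
  refine le_of_eq_of_le ?_ h2
  rw [← Real.rpow_natCast, ← Real.rpow_mul h0]
  push_cast
  rw [one_div_mul_cancel (by positivity), Real.rpow_one]

theorem gap_le_slowWeight_pow (α : ℝ) (m : ℕ) (b w : Space d × Space d) :
    gap α b w ≤ slowWeight α m b w ^ (m + 2) := by
  rw [pow_succ', gap]
  have h0 := warpDist_nonneg α b.2 w.2
  have h1 := one_le_slowWeight α m b w
  have h2 := le_slowWeight_pow α m b w
  have h3 : 1 + warpDist α b.2 w.2 ≤ slowWeight α m b w := le_max_left _ _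
  gcongr

/-- Positions are measured at the scale of `b`, which exceeds that of `w` by up to the power `m` of
the warped distance from `b`. The spatial factor therefore varies by up to `W ^ m` times the local
displacement; the root of order `m + 1` in `slowWeight` makes this variation independent of `b`. -/
theorem exists_slowWeight_le (d : ℕ) {α : ℝ} (hα : 0 < α) {R : ℝ} (hR : 0 ≤ R) :
    ∃ (m : ℕ) (C : ℝ), 1 ≤ C ∧ ∀ b w z : Space d × Space d, warpDist α w.2 z.2 ≤ R →
      slowWeight α m b w - slowWeight α m b z
        ≤ C * (1 + (1 + ‖w.2‖) ^ (1 - α) * ‖w.1 - z.1‖) := by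
  obtain ⟨B, m, hB, hrat⟩ := exists_rpow_le_warpDist d hα (1 - α)
  refine ⟨m, B * (1 + R) ^ m + R + 1, by
    have : 0 ≤ B * (1 + R) ^ m := by positivity
    linarith, fun b w z hwz => ?_⟩
  have hT := one_le_one_add_scaled α w.2 (w.1 - z.1)
  set T := 1 + (1 + ‖w.2‖) ^ (1 - α) * ‖w.1 - z.1‖ with hTdef
  have hW' := one_le_slowWeight α m b z
  have hu' := le_slowWeight_pow α m b z
  have hΔ' : 1 + warpDist α b.2 z.2 ≤ slowWeight α m b z := le_max_left _ _
  set W' := slowWeight α m b z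
  have hΔ : 1 + warpDist α b.2 w.2 ≤ W' + R := by
    have := warpDist_triangle α b.2 z.2 w.2
    rw [warpDist_comm α z.2] at this
    linarith
  have hΔ0 := warpDist_nonneg α b.2 w.2
  set A := B * (1 + R) ^ m with hA
  have hA0 : 0 ≤ A := by positivity
  -- The spatial factor at `w` is at most `W' ^ (m + 1) + A T W' ^ m ≤ (W' + A T) ^ (m + 1)`.
  have hu : 1 + (1 + ‖b.2‖) ^ (1 - α) * ‖b.1 - w.1‖ ≤ (W' + A * T) ^ (m + 1) := by
    have e1 : ‖b.1 - w.1‖ ≤ ‖b.1 - z.1‖ + ‖w.1 - z.1‖ := by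
      rw [norm_sub_rev w.1]; exact norm_sub_le_norm_sub_add_norm_sub _ _ _
    have e2 : (1 + ‖b.2‖) ^ (1 - α) * ‖w.1 - z.1‖ ≤ A * T * W' ^ m := by
      calc _ ≤ B * (1 + ‖w.2‖) ^ (1 - α) * (1 + warpDist α b.2 w.2) ^ m * ‖w.1 - z.1‖ := by
            have := hrat b.2 w.2
            gcongr
        _ ≤ B * (1 + ‖w.2‖) ^ (1 - α) * ((1 + R) * W') ^ m * ‖w.1 - z.1‖ := by
            gcongr
            nlinarith
        _ = A * ((1 + ‖w.2‖) ^ (1 - α) * ‖w.1 - z.1‖) * W' ^ m := by rw [hA, mul_pow]; ring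
        _ ≤ _ := by gcongr; linarith
    calc _ ≤ 1 + (1 + ‖b.2‖) ^ (1 - α) * (‖b.1 - z.1‖ + ‖w.1 - z.1‖) := by gcongr
      _ = (1 + (1 + ‖b.2‖) ^ (1 - α) * ‖b.1 - z.1‖) + (1 + ‖b.2‖) ^ (1 - α) * ‖w.1 - z.1‖ := by
          ring
      _ ≤ W' ^ (m + 1) + A * T * W' ^ m := add_le_add hu' e2
      _ = W' ^ m * (W' + A * T) := by ring
      _ ≤ (W' + A * T) ^ m * (W' + A * T) := by
          have : 0 ≤ A * T := by positivity
          gcongr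
          linarith
      _ = _ := by ring
  have hpos : 0 ≤ W' + A * T := by positivity
  have hroot : (1 + (1 + ‖b.2‖) ^ (1 - α) * ‖b.1 - w.1‖) ^ (1 / ((m : ℝ) + 1)) ≤ W' + A * T := by
    have := Real.rpow_le_rpow (by positivity) hu (by positivity : 0 ≤ 1 / ((m : ℝ) + 1))
    rw [← Real.rpow_natCast, ← Real.rpow_mul hpos] at this
    push_cast at this
    rwa [mul_one_div_cancel (by positivity), Real.rpow_one] at this
  have : slowWeight α m b w ≤ W' + (A + R) * T := by
    refine max_le ?_ ?_ <;> nlinarith [mul_nonneg hR (zero_le_one.trans hT)]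
  nlinarith

/-! ### Overlap integrals of localized functions -/

theorem integrable_inv_one_add_norm_pow (d : ℕ) :
    Integrable fun u : Space d => ((1 + ‖u‖) ^ (d + 1))⁻¹ := by
  have h := integrable_one_add_norm (E := Space d) (μ := volume) (r := d + 1) (by simp)
  refine h.congr (Eventually.of_forall fun y => ?_)
  simp only
  rw [Real.rpow_neg (by positivity)]
  congr 1
  exact_mod_cast Real.rpow_natCast (1 + ‖y‖) (d + 1)

theorem integral_comp_scaled_sub (d : ℕ) {E : Type*} [NormedAddCommGroup E] [NormedSpace ℝ E]
    (F : Space d → E) {s : ℝ} (hs : 0 < s) (x : Space d) :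
    ∫ t, F (s • (t - x)) = (s ^ d)⁻¹ • ∫ u, F u := by
  rw [integral_sub_right_eq_self (fun t => F (s • t)) x,
    Measure.integral_comp_smul_of_nonneg volume F s (hR := hs.le)]
  simp

theorem integrable_comp_scaled_sub (d : ℕ) {F : Space d → ℝ} (hF : Integrable F) {s : ℝ}
    (hs : 0 < s) (x : Space d) : Integrable fun t => F (s • (t - x)) :=
  (hF.comp_smul hs.ne').comp_sub_right x

/-- Two functions localized at scales `1 / s` and `1 / r` around `x` and `y` have a small overlap
when `s |x - y|` is large. -/
theorem norm_integral_mul_le (d : ℕ) (N : ℕ) {f g : Space d → ℂ} {A B s r : ℝ} (hA : 0 ≤ A)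
    (hB : 0 ≤ B) (hs : 0 < s) (hr : 0 < r) {c : ℝ} (hc : 1 ≤ c) (hsr : s ≤ c * r) (x y : Space d)
    (hf : ∀ t, ‖f t‖ ≤ A * ((1 + s * ‖t - x‖) ^ (N + (d + 1)))⁻¹)
    (hg : ∀ t, ‖g t‖ ≤ B * ((1 + r * ‖t - y‖) ^ N)⁻¹) :
    ‖∫ t, f t * g t‖ ≤ A * B * c ^ N * (∫ u : Space d, ((1 + ‖u‖) ^ (d + 1))⁻¹) * (s ^ d)⁻¹ *
      ((1 + s * ‖x - y‖) ^ N)⁻¹ := by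
  set F : Space d → ℝ := fun u => ((1 + ‖u‖) ^ (d + 1))⁻¹ with hF
  set K := A * B * c ^ N * ((1 + s * ‖x - y‖) ^ N)⁻¹ with hK
  have hpt : ∀ t, ‖f t * g t‖ ≤ K * F (s • (t - x)) := by
    intro t
    -- Peetre's inequality at scale `s`, followed by `s ≤ c r`. Of the powers available for `f`, `N`
    -- are spent on the separation of `x` and `y`, and `d + 1` on integrability.
    have h1 : 1 + s * ‖x - y‖ ≤ (1 + s * ‖t - x‖) * (c * (1 + r * ‖t - y‖)) := by
      have h2 : ‖x - y‖ ≤ ‖t - x‖ + ‖t - y‖ := by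
        rw [norm_sub_rev t x]; exact norm_sub_le_norm_sub_add_norm_sub _ _ _
      have h3 : s * ‖t - y‖ ≤ c * (r * ‖t - y‖) := by
        rw [← mul_assoc]; gcongr
      have h4 : 1 + s * ‖t - y‖ ≤ c * (1 + r * ‖t - y‖) := by linarith
      calc _ ≤ 1 + s * (‖t - x‖ + ‖t - y‖) := by gcongr
        _ ≤ (1 + s * ‖t - x‖) * (1 + s * ‖t - y‖) := by
            have : 0 ≤ (s * ‖t - x‖) * (s * ‖t - y‖) := by positivity
            nlinarith
        _ ≤ _ := by gcongr
    have h5 : ((1 + s * ‖t - x‖) ^ N)⁻¹ * ((1 + r * ‖t - y‖) ^ N)⁻¹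
        ≤ c ^ N * ((1 + s * ‖x - y‖) ^ N)⁻¹ := by
      rw [← mul_inv, ← div_eq_mul_inv, inv_eq_one_div, div_le_div_iff₀ (by positivity)
        (by positivity), one_mul, ← mul_pow, ← mul_pow]
      gcongr
      calc _ ≤ _ := h1
        _ = _ := by ring
    have h6 : ‖s • (t - x)‖ = s * ‖t - x‖ := by rw [norm_smul, Real.norm_of_nonneg hs.le]
    calc ‖f t * g t‖ ≤ (A * ((1 + s * ‖t - x‖) ^ (N + (d + 1)))⁻¹) *
          (B * ((1 + r * ‖t - y‖) ^ N)⁻¹) := by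
          rw [norm_mul]
          exact mul_le_mul (hf t) (hg t) (norm_nonneg _) (by positivity)
      _ = A * B * (((1 + s * ‖t - x‖) ^ N)⁻¹ * ((1 + r * ‖t - y‖) ^ N)⁻¹) *
          ((1 + s * ‖t - x‖) ^ (d + 1))⁻¹ := by rw [pow_add, mul_inv]; ring
      _ ≤ A * B * (c ^ N * ((1 + s * ‖x - y‖) ^ N)⁻¹) * ((1 + s * ‖t - x‖) ^ (d + 1))⁻¹ := by
          gcongr
      _ = K * F (s • (t - x)) := by rw [hK, hF]; simp only [h6]; ring
  calc ‖∫ t, f t * g t‖ ≤ ∫ t, K * F (s • (t - x)) :=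
        norm_integral_le_of_norm_le
          ((integrable_comp_scaled_sub d (integrable_inv_one_add_norm_pow d) hs x).const_mul K)
          (Eventually.of_forall hpt)
    _ = _ := by
        rw [integral_const_mul, integral_comp_scaled_sub d F hs x, hK, smul_eq_mul]
        ring

/-! ### Packets -/

theorem exists_pow_mul_norm_le (φ : 𝓢(Space d, ℂ)) (N n : ℕ) :
    ∃ C : ℝ, 0 < C ∧ ∀ t, (1 + ‖t‖) ^ N * ‖iteratedFDeriv ℝ n φ t‖ ≤ C := by
  refine ⟨_, lt_of_lt_of_le ?_ (le_max_left 1 _), fun t =>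
    (SchwartzMap.one_add_le_sup_seminorm_apply (𝕜 := ℝ) (m := (N, n)) le_rfl le_rfl φ t).trans
      (le_max_right 1 _)⟩
  exact one_pos

theorem exists_norm_le_inv_pow (φ : 𝓢(Space d, ℂ)) (N : ℕ) :
    ∃ C : ℝ, 0 < C ∧ ∀ t, ‖φ t‖ ≤ C * ((1 + ‖t‖) ^ N)⁻¹ := by
  obtain ⟨C, hC, h⟩ := exists_pow_mul_norm_le φ N 0
  refine ⟨C, hC, fun t => ?_⟩
  have := h t
  rw [norm_iteratedFDeriv_zero] at this
  rw [← div_eq_mul_inv, le_div_iff₀ (by positivity), mul_comm]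
  exact this

theorem norm_packet_apply (α : ℝ) (φ : 𝓢(Space d, ℂ)) (x ξ : Space d) (hξ : ξ ≠ 0) (t : Space d) :
    ‖packet α φ x ξ hξ t‖
      = ‖ξ‖ ^ ((d : ℝ) / 2 * (1 - α)) * ‖φ (‖ξ‖ ^ (1 - α) • (t - x))‖ := by
  rw [packet_apply, norm_mul, norm_mul, mul_comm Complex.I, Complex.norm_exp_ofReal_mul_I, mul_one,
    Complex.norm_real, Real.norm_of_nonneg (by positivity)]

theorem norm_packet_le {α : ℝ} {φ : 𝓢(Space d, ℂ)} {N : ℕ} {C : ℝ}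
    (h : ∀ t, ‖φ t‖ ≤ C * ((1 + ‖t‖) ^ N)⁻¹) (x ξ : Space d) (hξ : ξ ≠ 0) (t : Space d) :
    ‖packet α φ x ξ hξ t‖ ≤ ‖ξ‖ ^ ((d : ℝ) / 2 * (1 - α)) * C *
      ((1 + ‖ξ‖ ^ (1 - α) * ‖t - x‖) ^ N)⁻¹ := by
  rw [norm_packet_apply, mul_assoc]
  gcongr
  refine (h _).trans_eq ?_
  rw [norm_smul, Real.norm_of_nonneg (by positivity)]

theorem inner_toL2 (f g : 𝓢(Space d, ℂ)) :
    inner ℂ (toL2 f) (toL2 g) = ∫ t, g t * conj f t := by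
  exact (SchwartzMap.inner_toL2_toL2_eq f g volume).trans rfl

theorem norm_conj_apply (f : 𝓢(Space d, ℂ)) (t : Space d) : ‖conj f t‖ = ‖f t‖ := by
  rw [conj_apply, RCLike.norm_conj]

end Dispersive
end

noncomputable section
namespace Dispersive

variable {d : ℕ}

/-! ### Frequency localization of packets -/

/-- Used only to transfer vanishing of `𝓕 φ`, so the factor is left unspecified and may depend on
`ζ`. The shift is `ξ / (2π)` because the character is `e^{i t·ξ}`, while `𝓕` carries `2π` in the
exponent. -/
theorem fourier_packet_eq (α : ℝ) (φ : 𝓢(Space d, ℂ)) (x ξ : Space d) (hξ : ξ ≠ 0) (ζ : Space d) :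
    ∃ c : ℂ, 𝓕 (packet α φ x ξ hξ) ζ
      = c * 𝓕 φ ((‖ξ‖ ^ (1 - α))⁻¹ • (ζ - (2 * Real.pi)⁻¹ • ξ)) := by
  set s := ‖ξ‖ ^ (1 - α) with hs
  have hs0 : 0 < s := Real.rpow_pos_of_pos (norm_pos_iff.2 hξ) _
  set ζ' := ζ - (2 * Real.pi)⁻¹ • ξ with hζ'
  set A : ℂ := ((‖ξ‖ ^ ((d : ℝ) / 2 * (1 - α)) : ℝ) : ℂ) *
    Complex.exp (↑(-2 * Real.pi * inner ℝ x ζ') * Complex.I) with hA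
  set F : Space d → ℂ := fun u =>
    A * (Complex.exp (↑(-2 * Real.pi * inner ℝ u (s⁻¹ • ζ')) * Complex.I) • φ u) with hF
  have hpt : ∀ t, Complex.exp (↑(-2 * Real.pi * inner ℝ t ζ) * Complex.I) • packet α φ x ξ hξ t
      = F (s • (t - x)) := by
    intro t
    rw [packet_apply, hF, hA]
    simp only [smul_eq_mul]
    have h1 : Complex.exp (↑(-2 * Real.pi * inner ℝ t ζ) * Complex.I) *
        Complex.exp (Complex.I * (inner ℝ t ξ : ℝ))
        = Complex.exp (↑(-2 * Real.pi * inner ℝ x ζ') * Complex.I) *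
          Complex.exp (↑(-2 * Real.pi * inner ℝ (s • (t - x)) (s⁻¹ • ζ')) * Complex.I) := by
      rw [← Complex.exp_add, ← Complex.exp_add]
      congr 1
      have h2 : inner ℝ (s • (t - x)) (s⁻¹ • ζ') = inner ℝ t ζ' - inner ℝ x ζ' := by
        rw [inner_smul_left, inner_smul_right, inner_sub_left]
        simp only [conj_trivial]
        field_simp
      have h3 : inner ℝ t ζ' = inner ℝ t ζ - (2 * Real.pi)⁻¹ * inner ℝ t ξ := by
        rw [hζ', inner_sub_right, inner_smul_right]
      rw [h2, h3]
      have hpi : (Real.pi : ℂ) ≠ 0 := by exact_mod_cast Real.pi_ne_zero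
      push_cast
      field_simp
      ring
    calc _ = ((‖ξ‖ ^ ((d : ℝ) / 2 * (1 - α)) : ℝ) : ℂ) * φ (s • (t - x)) *
          (Complex.exp (↑(-2 * Real.pi * inner ℝ t ζ) * Complex.I) *
          Complex.exp (Complex.I * (inner ℝ t ξ : ℝ))) := by ring
      _ = _ := by rw [h1]; ring
  refine ⟨((s ^ d)⁻¹ : ℝ) * A, ?_⟩
  rw [SchwartzMap.fourier_coe, SchwartzMap.fourier_coe, Real.fourier_eq', Real.fourier_eq']
  simp_rw [hpt]
  rw [integral_comp_scaled_sub d F hs0 x, hF, integral_const_mul, Complex.real_smul, ← mul_assoc]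

/-- The Fourier transform of a packet is supported in a subdyadic ball, up to normalization. -/
theorem norm_sub_le_of_fourier_packet_ne_zero {α : ℝ} {φ : 𝓢(Space d, ℂ)} {c : ℝ}
    (hφ : ∀ ζ, 𝓕 φ ζ ≠ 0 → ‖ζ‖ ≤ c) (x ξ : Space d) (hξ : ξ ≠ 0) (ζ : Space d)
    (h : 𝓕 (packet α φ x ξ hξ) ζ ≠ 0) :
    ‖(2 * Real.pi) • ζ - ξ‖ ≤ 2 * Real.pi * c * ‖ξ‖ ^ (1 - α) := by
  obtain ⟨A, hA⟩ := fourier_packet_eq α φ x ξ hξ ζ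
  have h1 := hφ _ (right_ne_zero_of_mul (hA ▸ h))
  have hs0 : 0 < ‖ξ‖ ^ (1 - α) := Real.rpow_pos_of_pos (norm_pos_iff.2 hξ) _
  have hpi := Real.pi_pos
  rw [norm_smul, Real.norm_of_nonneg (by positivity), inv_mul_eq_div, div_le_iff₀ hs0] at h1
  have h2 : (2 * Real.pi) • ζ - ξ = (2 * Real.pi) • (ζ - (2 * Real.pi)⁻¹ • ξ) := by
    rw [smul_sub, smul_smul, mul_inv_cancel₀ (by positivity), one_smul]
  rw [h2, norm_smul, Real.norm_of_nonneg (by positivity)]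
  calc _ ≤ 2 * Real.pi * (c * ‖ξ‖ ^ (1 - α)) := by gcongr
    _ = _ := by ring

theorem inner_toL2_eq_fourier (f g : 𝓢(Space d, ℂ)) :
    inner ℂ (toL2 f) (toL2 g) = ∫ ζ, 𝓕 g ζ * starRingEnd ℂ (𝓕 f ζ) := by
  rw [toL2, toL2, ← SchwartzMap.inner_fourier_toL2_eq]
  exact (SchwartzMap.inner_toL2_toL2_eq (𝓕 f) (𝓕 g) volume).trans rfl

/-- By Plancherel, a nonzero inner product forces a frequency common to both supports. Each support
is a subdyadic ball, hence of bounded warped size, and the triangle inequality doubles the constant.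
-/
theorem exists_warpDist_le_of_inner_ne_zero {α : ℝ} (hα : 0 < α) {φ : 𝓢(Space d, ℂ)} {c : ℝ}
    (hφ : ∀ ζ, 𝓕 φ ζ ≠ 0 → ‖ζ‖ ≤ c) {c₀ : ℝ} (hc₀ : 0 < c₀) :
    ∃ R : ℝ, 0 ≤ R ∧ (∀ (x ξ : Space d) (hξ : ξ ≠ 0) (ζ : Space d), c₀ ≤ ‖ξ‖ →
        𝓕 (packet α φ x ξ hξ) ζ ≠ 0 → warpDist α ξ ((2 * Real.pi) • ζ) ≤ R) ∧
      ∀ (x ξ : Space d) (hξ : ξ ≠ 0) (y η : Space d) (hη : η ≠ 0), c₀ ≤ ‖ξ‖ → c₀ ≤ ‖η‖ →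
        inner ℂ (toL2 (packet α φ x ξ hξ)) (toL2 (packet α φ y η hη)) ≠ 0 →
        warpDist α ξ η ≤ R := by
  obtain ⟨A, hA, hcomp⟩ := exists_rpow_norm_comparable (d := d) hc₀ (1 - α)
  have hpi := Real.pi_pos
  obtain ⟨R, hR, hwarp⟩ := exists_warpDist_le d hα
    (show 0 ≤ 2 * Real.pi * max c 0 * A by positivity)
  have key : ∀ (x ξ : Space d) (hξ : ξ ≠ 0) (ζ : Space d), c₀ ≤ ‖ξ‖ →
      𝓕 (packet α φ x ξ hξ) ζ ≠ 0 → warpDist α ξ ((2 * Real.pi) • ζ) ≤ R := by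
    intro x ξ hξ ζ hξc h
    apply hwarp
    refine (norm_sub_le_of_fourier_packet_ne_zero
      (fun ζ hζ => (hφ ζ hζ).trans (le_max_left c 0)) x ξ hξ ζ h).trans ?_
    rw [mul_assoc _ A]
    gcongr
    exact (hcomp ξ hξc).2
  refine ⟨2 * R, by positivity, fun x ξ hξ ζ h1 h2 => (key x ξ hξ ζ h1 h2).trans (by linarith),
    fun x ξ hξ y η hη hξc hηc h => ?_⟩
  rw [inner_toL2_eq_fourier] at h
  obtain ⟨ζ, hζ⟩ : ∃ ζ, 𝓕 (packet α φ y η hη) ζ * starRingEnd ℂ (𝓕 (packet α φ x ξ hξ) ζ) ≠ 0 := by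
    by_contra! hcon
    exact h (by simp [hcon])
  have h1 := key y η hη ζ hηc (left_ne_zero_of_mul hζ)
  have h2 := key x ξ hξ ζ hξc (fun h0 => right_ne_zero_of_mul hζ (by rw [h0, map_zero]))
  have h3 := warpDist_triangle α ξ ((2 * Real.pi) • ζ) η
  rw [warpDist_comm α ((2 * Real.pi) • ζ) η] at h3
  linarith

/-! ### Almost orthogonality of packets -/

theorem rpow_half_eq {d : ℕ} {ξ : Space d} (α : ℝ) :
    ‖ξ‖ ^ ((d : ℝ) / 2 * (1 - α)) = (‖ξ‖ ^ (1 - α)) ^ ((d : ℝ) / 2) := by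
  rw [← Real.rpow_mul (norm_nonneg _), mul_comm]

/-- At bounded warped distance the scales `s`, `r` of the packets are comparable, so
`norm_integral_mul_le` applies. The normalizations `s^(d/2) r^(d/2)` compensate the volume factor
`s^(-d)`. -/
theorem exists_inner_packet_le {α : ℝ} (hα : 0 < α) (φ : 𝓢(Space d, ℂ)) {c₀ : ℝ} (hc₀ : 0 < c₀)
    (R : ℝ) (N : ℕ) :
    ∃ C : ℝ, 0 < C ∧ ∀ (x ξ : Space d) (hξ : ξ ≠ 0) (y η : Space d) (hη : η ≠ 0),
      c₀ ≤ ‖ξ‖ → c₀ ≤ ‖η‖ → warpDist α ξ η ≤ R →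
      ‖inner ℂ (toL2 (packet α φ x ξ hξ)) (toL2 (packet α φ y η hη))‖
        ≤ C * ((1 + (1 + ‖ξ‖) ^ (1 - α) * ‖x - y‖) ^ N)⁻¹ := by
  obtain ⟨A, hA, hcomp⟩ := exists_rpow_norm_comparable (d := d) hc₀ (1 - α)
  obtain ⟨B, m, hB, hrat⟩ := exists_rpow_le_warpDist d hα (1 - α)
  obtain ⟨D, hD, hdec⟩ := exists_norm_le_inv_pow φ (N + (d + 1))
  obtain ⟨D', hD', hdec'⟩ := exists_norm_le_inv_pow φ N
  set c : ℝ := 1 + A * B * (1 + |R|) ^ m * A with hc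
  have hA0 : 0 < A := by linarith
  have hc1 : 1 ≤ c := by
    have : 0 ≤ A * B * (1 + |R|) ^ m * A := by positivity
    linarith
  have hc0 : 0 < c := by linarith
  set I := ∫ u : Space d, ((1 + ‖u‖) ^ (d + 1))⁻¹ with hI
  have hI0 : 0 ≤ I := integral_nonneg fun u => by positivity
  refine ⟨D * D' * c ^ ((d : ℝ) / 2) * c ^ N * (I + 1) * A ^ N, by positivity,
    fun x ξ hξ y η hη hξc hηc hΔ => ?_⟩
  have hσ : ∀ ξ η : Space d, c₀ ≤ ‖ξ‖ → c₀ ≤ ‖η‖ → warpDist α ξ η ≤ R →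
      ‖ξ‖ ^ (1 - α) ≤ c * ‖η‖ ^ (1 - α) := by
    intro ξ η hξc hηc hΔ
    have hΔ0 := warpDist_nonneg α ξ η
    have hR0 : warpDist α ξ η ≤ |R| := hΔ.trans (le_abs_self _)
    have hη0 : 0 ≤ ‖η‖ ^ (1 - α) := by positivity
    calc ‖ξ‖ ^ (1 - α) ≤ A * (1 + ‖ξ‖) ^ (1 - α) := (hcomp ξ hξc).2
      _ ≤ A * (B * (1 + ‖η‖) ^ (1 - α) * (1 + warpDist α ξ η) ^ m) := by
          gcongr
          exact hrat ξ η
      _ ≤ A * (B * (A * ‖η‖ ^ (1 - α)) * (1 + |R|) ^ m) := by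
          gcongr
          exact (hcomp η hηc).1
      _ = A * B * (1 + |R|) ^ m * A * ‖η‖ ^ (1 - α) := by ring
      _ ≤ _ := by gcongr; linarith
  have h12 := hσ ξ η hξc hηc hΔ
  have h21 := hσ η ξ hηc hξc (by rwa [warpDist_comm])
  have hs0 : 0 < ‖ξ‖ ^ (1 - α) := Real.rpow_pos_of_pos (norm_pos_iff.2 hξ) _
  have hr0 : 0 < ‖η‖ ^ (1 - α) := Real.rpow_pos_of_pos (norm_pos_iff.2 hη) _
  have hmain := norm_integral_mul_le d N (f := fun t => conj (packet α φ x ξ hξ) t)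
    (g := fun t => packet α φ y η hη t) (A := ‖ξ‖ ^ ((d : ℝ) / 2 * (1 - α)) * D)
    (B := ‖η‖ ^ ((d : ℝ) / 2 * (1 - α)) * D') (by positivity) (by positivity) hs0 hr0 hc1 h12 x y
    (fun t => by rw [norm_conj_apply]; exact norm_packet_le hdec x ξ hξ t)
    (fun t => norm_packet_le hdec' y η hη t)
  rw [← hI] at hmain
  clear_value I c
  rw [inner_toL2]
  simp_rw [mul_comm (packet α φ y η hη _)]
  refine hmain.trans ?_
  rw [rpow_half_eq, rpow_half_eq]
  have hcs := (hcomp ξ hξc).1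
  set s := ‖ξ‖ ^ (1 - α)
  set r := ‖η‖ ^ (1 - α)
  have hr : r ^ ((d : ℝ) / 2) ≤ c ^ ((d : ℝ) / 2) * s ^ ((d : ℝ) / 2) := by
    rw [← Real.mul_rpow hc0.le hs0.le]
    gcongr
  have hss : s ^ ((d : ℝ) / 2) * s ^ ((d : ℝ) / 2) = s ^ d := by
    rw [← Real.rpow_add hs0, add_halves, Real.rpow_natCast]
  have hinv : ((1 + s * ‖x - y‖) ^ N)⁻¹
      ≤ A ^ N * ((1 + (1 + ‖ξ‖) ^ (1 - α) * ‖x - y‖) ^ N)⁻¹ := by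
    rw [← div_eq_mul_inv, inv_eq_one_div, div_le_div_iff₀ (by positivity) (by positivity), one_mul,
      ← mul_pow]
    gcongr
    have : (1 + ‖ξ‖) ^ (1 - α) * ‖x - y‖ ≤ A * s * ‖x - y‖ := by gcongr
    nlinarith
  calc _ ≤ s ^ ((d : ℝ) / 2) * D * ((c ^ ((d : ℝ) / 2) * s ^ ((d : ℝ) / 2)) * D') * c ^ N *
        (I + 1) * (s ^ d)⁻¹ * (A ^ N * ((1 + (1 + ‖ξ‖) ^ (1 - α) * ‖x - y‖) ^ N)⁻¹) := by
        gcongr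
        linarith
    _ = D * D' * c ^ ((d : ℝ) / 2) * c ^ N * (I + 1) * A ^ N *
        ((s ^ ((d : ℝ) / 2) * s ^ ((d : ℝ) / 2)) * (s ^ d)⁻¹) *
        ((1 + (1 + ‖ξ‖) ^ (1 - α) * ‖x - y‖) ^ N)⁻¹ := by ring
    _ = _ := by rw [hss, mul_inv_cancel₀ (by positivity), mul_one]

/-! ### Polynomial bounds -/

theorem exists_rpow_norm_le_pow {c₀ : ℝ} (hc₀ : 0 < c₀) (γ : ℝ) :
    ∃ (C : ℝ) (K : ℕ), 0 < C ∧ ∀ ξ : Space d, c₀ ≤ ‖ξ‖ → ‖ξ‖ ^ γ ≤ C * (1 + ‖ξ‖) ^ K := by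
  obtain ⟨A, hA, hcomp⟩ := exists_rpow_norm_comparable (d := d) hc₀ γ
  obtain ⟨K, hK⟩ := exists_nat_ge γ
  refine ⟨A, K, by linarith, fun ξ hξ => (hcomp ξ hξ).2.trans ?_⟩
  have hA0 : 0 ≤ A := by linarith
  gcongr
  rw [← Real.rpow_natCast]
  exact Real.rpow_le_rpow_of_exponent_le (by linarith [norm_nonneg ξ]) hK

theorem norm_iteratedFDeriv_character_le (ξ : Space d) (n : ℕ) (t : Space d) :
    ‖iteratedFDeriv ℝ n (fun t : Space d => Complex.exp (Complex.I * (inner ℝ t ξ : ℝ))) t‖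
      ≤ ‖ξ‖ ^ n := by
  set h : ℝ → ℂ := fun s => Complex.exp (Complex.I * s) with hh
  have hcd : ContDiff ℝ n h :=
    Complex.contDiff_exp.comp (contDiff_const.mul Complex.ofRealCLM.contDiff)
  have key : ∀ n : ℕ, ∀ s : ℝ, iteratedDeriv n h s = Complex.I ^ n * h s := by
    intro n
    induction n with
    | zero => intro s; simp
    | succ n ih =>
      intro s
      rw [iteratedDeriv_succ, funext ih]
      have h1 : HasDerivAt (fun s : ℝ => Complex.I * (s : ℂ)) (Complex.I * 1) s :=
        (Complex.ofRealCLM.hasDerivAt (x := s)).const_mul Complex.I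
      rw [((h1.cexp).const_mul (Complex.I ^ n)).deriv, hh]
      ring
  have heq : (fun t : Space d => Complex.exp (Complex.I * (inner ℝ t ξ : ℝ)))
      = h ∘ (innerSL ℝ ξ) := by
    funext t
    simp [hh, real_inner_comm]
  rw [heq, ContinuousLinearMap.iteratedFDeriv_comp_right _ hcd t le_rfl]
  refine (ContinuousMultilinearMap.norm_compContinuousLinearMap_le _ _).trans ?_
  rw [norm_iteratedFDeriv_eq_norm_iteratedDeriv, key, norm_mul, norm_pow, Complex.norm_I, one_pow,
    one_mul, hh]
  simp only
  rw [mul_comm Complex.I, Complex.norm_exp_ofReal_mul_I, one_mul]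
  simp

theorem norm_iteratedFDeriv_comp_scaled_sub (φ : 𝓢(Space d, ℂ)) {s : ℝ} (hs : 0 ≤ s)
    (x : Space d) (n : ℕ) (t : Space d) :
    ‖iteratedFDeriv ℝ n (fun t => φ (s • (t - x))) t‖
      = s ^ n * ‖iteratedFDeriv ℝ n φ (s • (t - x))‖ := by
  have h1 := iteratedFDeriv_comp_sub (𝕜 := ℝ) (f := fun z => φ (s • z)) n x t
  rw [h1, iteratedFDeriv_comp_const_smul s (φ.smooth n), norm_smul, norm_pow,
    Real.norm_of_nonneg hs]

/-- The Schwartz seminorms of packets grow polynomially. -/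
theorem exists_packet_seminorm_le (α : ℝ) (φ : 𝓢(Space d, ℂ)) {c₀ : ℝ} (hc₀ : 0 < c₀) (k n : ℕ) :
    ∃ (C : ℝ) (K : ℕ), 0 < C ∧ ∀ (x ξ : Space d) (hξ : ξ ≠ 0), c₀ ≤ ‖ξ‖ → ∀ t,
      ‖t‖ ^ k * ‖iteratedFDeriv ℝ n (packet α φ x ξ hξ) t‖
        ≤ C * ((1 + ‖x‖) * (1 + ‖ξ‖)) ^ K := by
  obtain ⟨C₁, K₁, hC₁, h₁⟩ := exists_rpow_norm_le_pow (d := d) hc₀ (1 - α)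
  obtain ⟨C₂, K₂, hC₂, h₂⟩ := exists_rpow_norm_le_pow (d := d) hc₀ (-(1 - α))
  obtain ⟨C₃, K₃, hC₃, h₃⟩ := exists_rpow_norm_le_pow (d := d) hc₀ ((d : ℝ) / 2 * (1 - α))
  choose D hD hφ using fun n => exists_pow_mul_norm_le φ k n
  set E : ℝ := ∑ i ∈ Finset.range (n + 1), (n.choose i : ℝ) * ((1 + C₁) ^ n * D i) with hE
  have hE0 : 0 ≤ E := Finset.sum_nonneg fun i _ => by have := hD i; positivity
  set K := K₃ + k + K₂ * k + (K₁ * n + n) with hK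
  refine ⟨C₃ * (1 + C₂) ^ k * (E + 1), K, by positivity, fun x ξ hξ hξc t => ?_⟩
  set s := ‖ξ‖ ^ (1 - α) with hs
  have hs0 : 0 < s := Real.rpow_pos_of_pos (norm_pos_iff.2 hξ) _
  have hs1 := h₁ ξ hξc
  have hs2 : s⁻¹ ≤ C₂ * (1 + ‖ξ‖) ^ K₂ := by
    rw [hs, ← Real.rpow_neg (norm_nonneg _)]; exact h₂ ξ hξc
  set ρ := 1 + ‖ξ‖ with hρ
  have hρ1 : 1 ≤ ρ := by linarith [norm_nonneg ξ]
  set a : ℝ := ‖ξ‖ ^ ((d : ℝ) / 2 * (1 - α)) with ha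
  have hfun : (packet α φ x ξ hξ : Space d → ℂ) = fun t => (a : ℂ) • (φ (s • (t - x)) *
      Complex.exp (Complex.I * (inner ℝ t ξ : ℝ))) := by
    funext t
    rw [packet_apply, smul_eq_mul, mul_assoc]
  have hcd1 : ContDiff ℝ n fun t => φ (s • (t - x)) :=
    (φ.smooth n).comp (by fun_prop)
  have hcd2 : ContDiff ℝ n fun t : Space d => Complex.exp (Complex.I * (inner ℝ t ξ : ℝ)) :=
    (character_hasTemperateGrowth ξ).1.of_le (by exact_mod_cast le_top)
  -- Moves the polynomial weight from `t` to the variable `s (t - x)` in which `φ` decays.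
  have hu : ‖t‖ ≤ (1 + ‖x‖) * (1 + s⁻¹) * (1 + ‖s • (t - x)‖) := by
    rw [norm_smul, Real.norm_of_nonneg hs0.le]
    have h1 : ‖t‖ ≤ ‖x‖ + ‖t - x‖ := norm_le_norm_add_norm_sub' _ _
    have h2 : ‖t - x‖ ≤ (1 + s⁻¹) * (1 + s * ‖t - x‖) := by
      have : s⁻¹ * (s * ‖t - x‖) = ‖t - x‖ := by rw [← mul_assoc, inv_mul_cancel₀ hs0.ne', one_mul]
      have h3 : 0 < s⁻¹ := by positivity
      have h4 : 0 ≤ s * ‖t - x‖ := by positivity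
      nlinarith
    have h5 : 1 ≤ (1 + s⁻¹) * (1 + s * ‖t - x‖) := by
      have h3 : 0 < s⁻¹ := by positivity
      have h4 : 0 ≤ s * ‖t - x‖ := by positivity
      nlinarith
    nlinarith [norm_nonneg x]
  have hu2 : 1 + s⁻¹ ≤ (1 + C₂) * ρ ^ K₂ := by
    have : 1 ≤ ρ ^ K₂ := one_le_pow₀ hρ1
    nlinarith
  have hu1 : 1 + s ≤ (1 + C₁) * ρ ^ K₁ := by
    have : 1 ≤ ρ ^ K₁ := one_le_pow₀ hρ1
    nlinarith
  have hderiv : ‖iteratedFDeriv ℝ n (packet α φ x ξ hξ) t‖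
      ≤ a * ∑ i ∈ Finset.range (n + 1), (n.choose i : ℝ) *
        (s ^ i * ‖iteratedFDeriv ℝ i φ (s • (t - x))‖) * ‖ξ‖ ^ (n - i) := by
    rw [hfun, iteratedFDeriv_const_smul_apply' (hcd1.mul hcd2).contDiffAt, norm_smul,
      Complex.norm_real, Real.norm_of_nonneg (by positivity)]
    gcongr
    refine (norm_iteratedFDeriv_mul_le hcd1 hcd2 t le_rfl).trans ?_
    refine Finset.sum_le_sum fun i _ => ?_
    rw [norm_iteratedFDeriv_comp_scaled_sub φ hs0.le]
    gcongr
    exact norm_iteratedFDeriv_character_le ξ _ t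
  have hterm : (1 + ‖s • (t - x)‖) ^ k * ∑ i ∈ Finset.range (n + 1), (n.choose i : ℝ) *
        (s ^ i * ‖iteratedFDeriv ℝ i φ (s • (t - x))‖) * ‖ξ‖ ^ (n - i)
      ≤ E * ρ ^ (K₁ * n + n) := by
    rw [Finset.mul_sum, hE, Finset.sum_mul]
    refine Finset.sum_le_sum fun i hi => ?_
    have hi' : i ≤ n := Nat.lt_succ_iff.1 (Finset.mem_range.1 hi)
    have e1 : s ^ i ≤ (1 + C₁) ^ n * ρ ^ (K₁ * n) := by
      rw [pow_mul, ← mul_pow]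
      calc s ^ i ≤ (1 + s) ^ i := by gcongr; linarith
        _ ≤ (1 + s) ^ n := pow_le_pow_right₀ (by linarith) hi'
        _ ≤ _ := by gcongr
    have e2 : ‖ξ‖ ^ (n - i) ≤ ρ ^ n := by
      calc ‖ξ‖ ^ (n - i) ≤ ρ ^ (n - i) := by gcongr; linarith
        _ ≤ _ := pow_le_pow_right₀ hρ1 (Nat.sub_le _ _)
    have e3 := hφ i (s • (t - x))
    calc _ = (n.choose i : ℝ) * (s ^ i * ((1 + ‖s • (t - x)‖) ^ k *
          ‖iteratedFDeriv ℝ i φ (s • (t - x))‖) * ‖ξ‖ ^ (n - i)) := by ring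
      _ ≤ (n.choose i : ℝ) * (((1 + C₁) ^ n * ρ ^ (K₁ * n)) * D i * ρ ^ n) := by
          have := hD i
          gcongr
      _ = _ := by rw [pow_add]; ring
  have hx1 : 1 ≤ 1 + ‖x‖ := by linarith [norm_nonneg x]
  calc ‖t‖ ^ k * ‖iteratedFDeriv ℝ n (packet α φ x ξ hξ) t‖
      ≤ ((1 + ‖x‖) * ((1 + C₂) * ρ ^ K₂) * (1 + ‖s • (t - x)‖)) ^ k *
        (a * ∑ i ∈ Finset.range (n + 1), (n.choose i : ℝ) *
        (s ^ i * ‖iteratedFDeriv ℝ i φ (s • (t - x))‖) * ‖ξ‖ ^ (n - i)) := by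
        gcongr
        exact hu.trans (by gcongr)
    _ = (1 + ‖x‖) ^ k * ((1 + C₂) * ρ ^ K₂) ^ k * a * ((1 + ‖s • (t - x)‖) ^ k *
        ∑ i ∈ Finset.range (n + 1), (n.choose i : ℝ) *
        (s ^ i * ‖iteratedFDeriv ℝ i φ (s • (t - x))‖) * ‖ξ‖ ^ (n - i)) := by
        rw [mul_pow, mul_pow]; ring
    _ ≤ (1 + ‖x‖) ^ K * ((1 + C₂) * ρ ^ K₂) ^ k * (C₃ * ρ ^ K₃) *
        ((E + 1) * ρ ^ (K₁ * n + n)) := by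
        have e4 := h₃ ξ hξc
        have e5 : (1 + ‖x‖) ^ k ≤ (1 + ‖x‖) ^ K := pow_le_pow_right₀ hx1 (by omega)
        have e6 : E * ρ ^ (K₁ * n + n) ≤ (E + 1) * ρ ^ (K₁ * n + n) := by gcongr; linarith
        have e7 := hterm.trans e6
        gcongr
    _ = C₃ * (1 + C₂) ^ k * (E + 1) * ((1 + ‖x‖) ^ K * ρ ^ (K₃ + K₂ * k + (K₁ * n + n))) := by
        rw [mul_pow, ← pow_mul, pow_add ρ (K₃ + K₂ * k), pow_add ρ K₃]; ring
    _ ≤ C₃ * (1 + C₂) ^ k * (E + 1) * ((1 + ‖x‖) ^ K * ρ ^ K) := by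
        have e8 : ρ ^ (K₃ + K₂ * k + (K₁ * n + n)) ≤ ρ ^ K :=
          pow_le_pow_right₀ hρ1 (by omega)
        gcongr
    _ = _ := by rw [mul_pow]

end Dispersive
end

noncomputable section
namespace Dispersive

variable {d : ℕ}

/-! ### Coefficients of Schwartz functions -/

theorem pair_ofSchwartz (g ψ : 𝓢(Space d, ℂ)) :
    pair (ofSchwartz g) ψ = inner ℂ (toL2 ψ) (toL2 g) := by
  refine (SchwartzMap.toTemperedDistributionCLM_apply_apply volume g (conj ψ)).trans ?_
  rw [inner_toL2]
  simp_rw [smul_eq_mul, mul_comm]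

/-- Overlap of `g`, localized at unit scale around the origin, with the packet. The ratio of the
scales is polynomial in `|ξ|`, which accounts for the growing factor. -/
theorem exists_inner_packet_le_position (α : ℝ) (φ g : 𝓢(Space d, ℂ)) {c₀ : ℝ} (hc₀ : 0 < c₀)
    (N : ℕ) : ∃ (C : ℝ) (K : ℕ), 0 < C ∧ ∀ (x ξ : Space d) (hξ : ξ ≠ 0), c₀ ≤ ‖ξ‖ →
      ‖inner ℂ (toL2 (packet α φ x ξ hξ)) (toL2 g)‖
        ≤ C * (1 + ‖ξ‖) ^ K * ((1 + ‖x‖) ^ N)⁻¹ := by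
  obtain ⟨C₂, K₂, hC₂, h₂⟩ := exists_rpow_norm_le_pow (d := d) hc₀ (-(1 - α))
  obtain ⟨C₃, K₃, hC₃, h₃⟩ := exists_rpow_norm_le_pow (d := d) hc₀ ((d : ℝ) / 2 * (1 - α))
  obtain ⟨D, hD, hdec⟩ := exists_norm_le_inv_pow g (N + (d + 1))
  obtain ⟨D', hD', hdec'⟩ := exists_norm_le_inv_pow φ N
  set I := ∫ u : Space d, ((1 + ‖u‖) ^ (d + 1))⁻¹ with hI
  have hI0 : 0 ≤ I := integral_nonneg fun u => by positivity
  refine ⟨D * D' * C₃ * (1 + C₂) ^ N * (I + 1), K₃ + K₂ * N, by positivity,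
    fun x ξ hξ hξc => ?_⟩
  have hs0 : 0 < ‖ξ‖ ^ (1 - α) := Real.rpow_pos_of_pos (norm_pos_iff.2 hξ) _
  have hs2 : (‖ξ‖ ^ (1 - α))⁻¹ ≤ C₂ * (1 + ‖ξ‖) ^ K₂ := by
    rw [← Real.rpow_neg (norm_nonneg _)]; exact h₂ ξ hξc
  have hρ1 : 1 ≤ 1 + ‖ξ‖ := by linarith [norm_nonneg ξ]
  have hc1 : 1 ≤ 1 + (‖ξ‖ ^ (1 - α))⁻¹ := by
    have := inv_pos.2 hs0
    linarith
  have hsr : 1 ≤ (1 + (‖ξ‖ ^ (1 - α))⁻¹) * ‖ξ‖ ^ (1 - α) := by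
    rw [add_mul, inv_mul_cancel₀ hs0.ne']
    linarith
  have hmain := norm_integral_mul_le d N (f := fun t => g t)
    (g := fun t => conj (packet α φ x ξ hξ) t) (A := D)
    (B := ‖ξ‖ ^ ((d : ℝ) / 2 * (1 - α)) * D') hD.le (by positivity) one_pos hs0 hc1 hsr 0 x
    (fun t => by simpa using hdec t)
    (fun t => by rw [norm_conj_apply]; exact norm_packet_le hdec' x ξ hξ t)
  rw [← hI] at hmain
  clear_value I
  rw [inner_toL2]
  refine hmain.trans ?_
  rw [zero_sub, norm_neg, one_mul, one_pow, inv_one, mul_one]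
  have hu2 : 1 + (‖ξ‖ ^ (1 - α))⁻¹ ≤ (1 + C₂) * (1 + ‖ξ‖) ^ K₂ := by
    have : 1 ≤ (1 + ‖ξ‖) ^ K₂ := one_le_pow₀ hρ1
    nlinarith
  have e3 := h₃ ξ hξc
  calc _ ≤ D * ((C₃ * (1 + ‖ξ‖) ^ K₃) * D') * ((1 + C₂) * (1 + ‖ξ‖) ^ K₂) ^ N * (I + 1) *
        ((1 + ‖x‖) ^ N)⁻¹ := by
        have : 0 < (‖ξ‖ ^ (1 - α))⁻¹ := inv_pos.2 hs0
        gcongr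
        linarith
    _ = _ := by rw [mul_pow, ← pow_mul, pow_add]; ring

theorem norm_fourier_packet_le (α : ℝ) (φ : 𝓢(Space d, ℂ)) {c₀ : ℝ} (hc₀ : 0 < c₀) :
    ∃ (C : ℝ) (K : ℕ), 0 < C ∧ ∀ (x ξ : Space d) (hξ : ξ ≠ 0), c₀ ≤ ‖ξ‖ → ∀ ζ,
      ‖𝓕 (packet α φ x ξ hξ) ζ‖ ≤ C * (1 + ‖ξ‖) ^ K := by
  obtain ⟨C₂, K₂, hC₂, h₂⟩ := exists_rpow_norm_le_pow (d := d) hc₀ (-(1 - α))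
  obtain ⟨C₃, K₃, hC₃, h₃⟩ := exists_rpow_norm_le_pow (d := d) hc₀ ((d : ℝ) / 2 * (1 - α))
  set I := ∫ u, ‖φ u‖ with hI
  have hI0 : 0 ≤ I := integral_nonneg fun u => norm_nonneg _
  refine ⟨C₃ * C₂ ^ d * (I + 1), K₃ + K₂ * d, by positivity, fun x ξ hξ hξc ζ => ?_⟩
  have hs0 : 0 < ‖ξ‖ ^ (1 - α) := Real.rpow_pos_of_pos (norm_pos_iff.2 hξ) _
  have hs2 : (‖ξ‖ ^ (1 - α))⁻¹ ≤ C₂ * (1 + ‖ξ‖) ^ K₂ := by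
    rw [← Real.rpow_neg (norm_nonneg _)]; exact h₂ ξ hξc
  have h1 : ‖𝓕 (packet α φ x ξ hξ) ζ‖ ≤ ∫ t, ‖packet α φ x ξ hξ t‖ :=
    VectorFourier.norm_fourierIntegral_le_integral_norm _ _ _ _ _
  refine h1.trans ?_
  simp_rw [norm_packet_apply]
  rw [integral_const_mul, integral_comp_scaled_sub d (fun u => ‖φ u‖) hs0 x, ← hI, smul_eq_mul]
  clear_value I
  have e3 := h₃ ξ hξc
  calc _ ≤ (C₃ * (1 + ‖ξ‖) ^ K₃) * ((C₂ * (1 + ‖ξ‖) ^ K₂) ^ d * (I + 1)) := by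
        rw [← inv_pow]
        gcongr
        linarith
    _ = _ := by rw [mul_pow, ← pow_mul, pow_add]; ring

/-- On the Fourier support of the packet `1 + |ξ|` is at most a constant times `1 + |ζ|`, so by
Plancherel decay of `𝓕 g` becomes decay in `ξ`. The order `N + K + (d + 1)` covers the target, the
growth of the packet's transform and integrability. -/
theorem exists_inner_packet_le_frequency {α : ℝ} (hα : 0 < α) (φ g : 𝓢(Space d, ℂ)) {c : ℝ}
    (hφ : ∀ ζ, 𝓕 φ ζ ≠ 0 → ‖ζ‖ ≤ c) {c₀ : ℝ} (hc₀ : 0 < c₀) (N : ℕ) :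
    ∃ C : ℝ, 0 < C ∧ ∀ (x ξ : Space d) (hξ : ξ ≠ 0), c₀ ≤ ‖ξ‖ →
      ‖inner ℂ (toL2 (packet α φ x ξ hξ)) (toL2 g)‖ ≤ C * ((1 + ‖ξ‖) ^ N)⁻¹ := by
  obtain ⟨R, hR, hsupp, -⟩ := exists_warpDist_le_of_inner_ne_zero hα hφ hc₀
  obtain ⟨B, K, hB, hhat⟩ := norm_fourier_packet_le α φ hc₀
  obtain ⟨A, m, hA, hrat⟩ := exists_rpow_le_warpDist d hα 1
  obtain ⟨D, hD, hdec⟩ := exists_norm_le_inv_pow (𝓕 g) (N + K + (d + 1))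
  set I := ∫ u : Space d, ((1 + ‖u‖) ^ (d + 1))⁻¹ with hI
  have hI0 : 0 ≤ I := integral_nonneg fun u => by positivity
  have hpi := Real.pi_pos
  set E : ℝ := A * (1 + 2 * Real.pi) * (1 + R) ^ m with hE
  have hE0 : 0 < E := by positivity
  refine ⟨D * B * E ^ (N + K) * (I + 1), by positivity, fun x ξ hξ hξc => ?_⟩
  rw [inner_toL2_eq_fourier]
  set M : ℝ := D * B * E ^ (N + K) * ((1 + ‖ξ‖) ^ N)⁻¹ with hM
  have hpt : ∀ ζ, ‖𝓕 g ζ * starRingEnd ℂ (𝓕 (packet α φ x ξ hξ) ζ)‖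
      ≤ M * ((1 + ‖ζ‖) ^ (d + 1))⁻¹ := by
    intro ζ
    rw [norm_mul, RCLike.norm_conj]
    rcases eq_or_ne (𝓕 (packet α φ x ξ hξ) ζ) 0 with h0 | h0
    · rw [h0, norm_zero, mul_zero]; positivity
    have h1 := hsupp x ξ hξ ζ hξc h0
    have h2 : 1 + ‖ξ‖ ≤ E * (1 + ‖ζ‖) := by
      have h3 := hrat ξ ((2 * Real.pi) • ζ)
      rw [Real.rpow_one, Real.rpow_one, norm_smul, Real.norm_of_nonneg (by positivity)] at h3
      have h4 := warpDist_nonneg α ξ ((2 * Real.pi) • ζ)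
      calc _ ≤ _ := h3
        _ ≤ A * ((1 + 2 * Real.pi) * (1 + ‖ζ‖)) * (1 + R) ^ m := by
            gcongr
            nlinarith [norm_nonneg ζ]
        _ = _ := by rw [hE]; ring
    have h5 : (1 + ‖ξ‖) ^ K * ((1 + ‖ζ‖) ^ (N + K))⁻¹ ≤ E ^ (N + K) * ((1 + ‖ξ‖) ^ N)⁻¹ := by
      rw [← div_eq_mul_inv, ← div_eq_mul_inv, div_le_div_iff₀ (by positivity) (by positivity),
        ← pow_add, ← mul_pow, add_comm K N]
      gcongr
    calc _ ≤ (D * ((1 + ‖ζ‖) ^ (N + K + (d + 1)))⁻¹) * (B * (1 + ‖ξ‖) ^ K) :=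
          mul_le_mul (hdec ζ) (hhat x ξ hξ hξc ζ) (norm_nonneg _) (by positivity)
      _ = D * B * ((1 + ‖ξ‖) ^ K * ((1 + ‖ζ‖) ^ (N + K))⁻¹) * ((1 + ‖ζ‖) ^ (d + 1))⁻¹ := by
          rw [pow_add _ (N + K), mul_inv]; ring
      _ ≤ D * B * (E ^ (N + K) * ((1 + ‖ξ‖) ^ N)⁻¹) * ((1 + ‖ζ‖) ^ (d + 1))⁻¹ := by gcongr
      _ = _ := by rw [hM]; ring
  refine (norm_integral_le_of_norm_le ((integrable_inv_one_add_norm_pow d).const_mul M)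
    (Eventually.of_forall hpt)).trans ?_
  rw [integral_const_mul, ← hI]
  clear_value I
  calc M * I ≤ M * (I + 1) := by
        have : 0 ≤ M := by positivity
        gcongr
        linarith
    _ = _ := by rw [hM]; ring

/-- The coefficients of a Schwartz function decrease rapidly in phase space. -/
theorem exists_inner_packet_le_pow {α : ℝ} (hα : 0 < α) (φ g : 𝓢(Space d, ℂ)) {c : ℝ}
    (hφ : ∀ ζ, 𝓕 φ ζ ≠ 0 → ‖ζ‖ ≤ c) {c₀ : ℝ} (hc₀ : 0 < c₀) (N : ℕ) :
    ∃ C : ℝ, 0 < C ∧ ∀ (x ξ : Space d) (hξ : ξ ≠ 0), c₀ ≤ ‖ξ‖ →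
      ‖inner ℂ (toL2 (packet α φ x ξ hξ)) (toL2 g)‖
        ≤ C * (((1 + ‖x‖) * (1 + ‖ξ‖)) ^ N)⁻¹ := by
  obtain ⟨C₁, K, hC₁, h₁⟩ := exists_inner_packet_le_position α φ g hc₀ (2 * N)
  obtain ⟨C₂, hC₂, h₂⟩ := exists_inner_packet_le_frequency hα φ g hφ hc₀ (K + 2 * N)
  refine ⟨C₁ + C₂, by positivity, fun x ξ hξ hξc => ?_⟩
  -- Geometric mean of the two estimates: the extra `K` in the frequency decay cancels the growth in
  -- the position estimate, and the orders `2 N` become `N`.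
  refine le_of_sq_le_sq ?_ (by positivity)
  have h3 := mul_le_mul (h₁ x ξ hξ hξc) (h₂ x ξ hξ hξc) (norm_nonneg _) (by positivity)
  rw [← sq] at h3
  calc _ ≤ _ := h3
    _ = C₁ * C₂ * (((((1 + ‖x‖) * (1 + ‖ξ‖)) ^ N)⁻¹) ^ 2) := by
        have : (1 + ‖ξ‖) ^ K ≠ 0 := by positivity
        rw [pow_add, mul_pow, inv_pow, mul_pow, ← pow_mul, ← pow_mul, mul_comm N 2]
        field_simp
    _ ≤ (C₁ + C₂) ^ 2 * (((((1 + ‖x‖) * (1 + ‖ξ‖)) ^ N)⁻¹) ^ 2) := by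
        gcongr
        nlinarith
    _ = _ := by ring

/-! ### Absolutely convergent series of Schwartz functions -/

theorem exists_hasSum_schwartz {ι : Type*} (u : ι → 𝓢(Space d, ℂ))
    (hu : ∀ k n, Summable fun i => SchwartzMap.seminorm ℝ k n (u i)) :
    ∃ Φ : 𝓢(Space d, ℂ), HasSum u Φ := by
  have hbound : ∀ (n : ℕ) (i : ι) (t : Space d),
      ‖iteratedFDeriv ℝ n (u i) t‖ ≤ SchwartzMap.seminorm ℝ 0 n (u i) := fun n i t =>
    SchwartzMap.norm_iteratedFDeriv_le_seminorm ℝ (u i) n t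
  have hD : ∀ (n : ℕ) (t : Space d), iteratedFDeriv ℝ n (fun t => ∑' i, u i t) t
      = ∑' i, iteratedFDeriv ℝ n (u i) t := fun n t =>
    iteratedFDeriv_tsum_apply (N := ⊤) (v := fun n i => SchwartzMap.seminorm ℝ 0 n (u i))
      (fun i => (u i).smooth _) (fun k _ => hu 0 k) (fun k i t _ => hbound k i t)
      (by exact_mod_cast le_top) t
  have hs : ∀ (n : ℕ) (t : Space d), Summable fun i => iteratedFDeriv ℝ n (u i) t := fun n t =>
    Summable.of_norm_bounded (hu 0 n) fun i => hbound n i t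
  -- Used twice: `s = univ` gives the decay of the sum, and the complement of a finite set gives
  -- convergence in every seminorm.
  have htail : ∀ (k n : ℕ) (s : Set ι) (t : Space d),
      ‖t‖ ^ k * ‖∑' i : s, iteratedFDeriv ℝ n (u i) t‖
        ≤ ∑' i : s, SchwartzMap.seminorm ℝ k n (u i) := by
    intro k n s t
    have h1 : ∀ i, ‖t‖ ^ k * ‖iteratedFDeriv ℝ n (u i) t‖ ≤ SchwartzMap.seminorm ℝ k n (u i) :=
      fun i => SchwartzMap.le_seminorm ℝ k n (u i) t
    have h2 : Summable fun i : s => ‖iteratedFDeriv ℝ n (u i) t‖ :=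
      (Summable.of_nonneg_of_le (fun _ => norm_nonneg _) (fun i => hbound n i t) (hu 0 n)).subtype s
    calc _ ≤ ‖t‖ ^ k * ∑' i : s, ‖iteratedFDeriv ℝ n (u i) t‖ := by
          gcongr
          exact norm_tsum_le_tsum_norm h2
      _ = ∑' i : s, ‖t‖ ^ k * ‖iteratedFDeriv ℝ n (u i) t‖ := tsum_mul_left.symm
      _ ≤ _ := Summable.tsum_le_tsum (fun i => h1 i) (h2.mul_left _) ((hu k n).subtype s)
  let Φ : 𝓢(Space d, ℂ) :=
    { toFun := fun t => ∑' i, u i t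
      smooth' := contDiff_tsum (N := ⊤) (v := fun n i => SchwartzMap.seminorm ℝ 0 n (u i))
        (fun i => (u i).smooth _) (fun k _ => hu 0 k) (fun k i t _ => hbound k i t)
      decay' := fun k n => ⟨∑' i : (Set.univ : Set ι), SchwartzMap.seminorm ℝ k n (u i), fun t => by
        rw [hD, ← tsum_univ fun i => iteratedFDeriv ℝ n (u i) t]
        exact htail k n Set.univ t⟩ }
  refine ⟨Φ, ?_⟩
  rw [HasSum, (schwartz_withSeminorms ℝ (Space d) ℂ).tendsto_nhds]
  rintro ⟨k, n⟩ ε hε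
  have ht := (tendsto_tsum_compl_atTop_zero
    (fun i => SchwartzMap.seminorm ℝ k n (u i))).eventually_lt_const hε
  rw [SummationFilter.unconditional_filter]
  filter_upwards [ht] with F hF
  rw [map_sub_rev]
  refine lt_of_le_of_lt (SchwartzMap.seminorm_le_bound ℝ k n _
    (tsum_nonneg fun i => apply_nonneg _ _) fun t => ?_) hF
  refine le_of_eq_of_le ?_ (htail k n {i | i ∉ F} t)
  congr 2
  have h1 : iteratedFDeriv ℝ n (Φ - ∑ i ∈ F, u i : 𝓢(Space d, ℂ)) t
      = iteratedFDeriv ℝ n Φ t - ∑ i ∈ F, iteratedFDeriv ℝ n (u i) t := by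
    have hF : ((∑ i ∈ F, u i : 𝓢(Space d, ℂ)) : Space d → ℂ) = fun t => ∑ i ∈ F, u i t := by
      funext t
      simp
    have e1 : ((Φ - ∑ i ∈ F, u i : 𝓢(Space d, ℂ)) : Space d → ℂ)
        = (Φ : Space d → ℂ) - fun t => ∑ i ∈ F, u i t := by
      rw [← hF]; rfl
    rw [e1, iteratedFDeriv_sub_apply (Φ.smooth n).contDiffAt
      (ContDiff.sum fun i _ => (u i).smooth n).contDiffAt,
      iteratedFDeriv_fun_sum_apply fun i _ => ((u i).smooth n).contDiffAt]
  have h2 : iteratedFDeriv ℝ n Φ t = ∑' i, iteratedFDeriv ℝ n (u i) t := hD n t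
  rw [h1, h2, ← (hs n t).sum_add_tsum_subtype_compl F, add_sub_cancel_left]
  rfl

theorem hasSum_toL2 {ι : Type*} {u : ι → 𝓢(Space d, ℂ)} {Φ : 𝓢(Space d, ℂ)} (h : HasSum u Φ) :
    HasSum (fun i => toL2 (u i)) (toL2 Φ) :=
  h.mapL (SchwartzMap.toLpCLM ℂ ℂ 2 (volume : Measure (Space d)))

theorem hasSum_pair {ι : Type*} {u : ι → 𝓢(Space d, ℂ)} {Φ : 𝓢(Space d, ℂ)} (h : HasSum u Φ)
    (f : 𝓢'(Space d, ℂ)) : HasSum (fun i => pair f (u i)) (pair f Φ) := by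
  have h1 : HasSum (fun i => conj (u i)) (conj Φ) :=
    h.mapL (SchwartzMap.postcompCLM (𝕜 := ℝ) (Complex.conjCLE : ℂ →L[ℝ] ℂ))
  exact h1.map f (map_continuous f)

theorem pair_smul (f : 𝓢'(Space d, ℂ)) (c : ℂ) (ψ : 𝓢(Space d, ℂ)) :
    pair f (c • ψ) = starRingEnd ℂ c * pair f ψ := by
  have : conj (c • ψ) = starRingEnd ℂ c • conj ψ := by
    ext t
    simp [conj_apply]
  rw [pair, this, map_smul, smul_eq_mul, pair]

theorem toL2_injective : Function.Injective (toL2 : 𝓢(Space d, ℂ) → _) :=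
  SchwartzMap.injective_toLp 2 volume

end Dispersive
end

noncomputable section
namespace Dispersive

/-! ### Mixed-norm sequence spaces -/

section
variable {d : ℕ}

theorem ennreal_tsum_rpow_le {κ : Type*} (a : κ → ℝ≥0∞) {θ : ℝ} (h0 : 0 < θ) (h1 : θ ≤ 1) :
    (∑' y, a y) ^ θ ≤ ∑' y, a y ^ θ := by
  have hfin : ∀ s : Finset κ, (∑ y ∈ s, a y) ^ θ ≤ ∑ y ∈ s, a y ^ θ := by
    classical
    intro s
    induction s using Finset.induction_on with
    | empty => simp [h0]
    | insert y s hy ih =>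
      rw [Finset.sum_insert hy, Finset.sum_insert hy]
      exact (ENNReal.rpow_add_le_add_rpow _ _ h0.le h1).trans (by gcongr)
  rw [← ENNReal.le_rpow_inv_iff h0, ENNReal.tsum_eq_iSup_sum]
  refine iSup_le fun s => ?_
  rw [ENNReal.le_rpow_inv_iff h0]
  exact (hfin s).trans (ENNReal.sum_le_tsum s)

theorem ennreal_tendsto_tsum_of_dominated {ι κ : Type*} [Countable κ] {l : Filter ι}
    [l.IsCountablyGenerated] {f : ι → κ → ℝ≥0∞} {g : κ → ℝ≥0∞} (hg : ∑' y, g y ≠ ∞)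
    (hle : ∀ x y, f x y ≤ g y) (h0 : ∀ y, Tendsto (fun x => f x y) l (𝓝 0)) :
    Tendsto (fun x => ∑' y, f x y) l (𝓝 0) := by
  let _ : MeasurableSpace κ := ⊤
  have := tendsto_lintegral_filter_of_dominated_convergence (μ := Measure.count) (l := l)
    (F := f) (f := fun _ => 0) g (Eventually.of_forall fun x => measurable_from_top)
    (Eventually.of_forall fun x => Eventually.of_forall (hle x))
    (by rwa [lintegral_count]) (Eventually.of_forall h0)
  simpa [lintegral_count] using this

/-- The `q`-th power of the mixed `ℓ^q(ℓ^p)` norm with weight `w`. -/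
def mixNorm (p q : ℝ) (w : ℕ → ℝ≥0∞) (c : Index d → ℝ≥0∞) : ℝ≥0∞ :=
  ∑' k, (∑' j, c (j, k) ^ p) ^ (q / p) * w k ^ q

/-- Dominated convergence for series, first in `j` at fixed `k`, then in `k`. Positive weights are
needed for finiteness of the inner sums. -/
theorem tendsto_mixNorm_tail {p q : ℝ} (hp : 1 ≤ p) (hq : 1 ≤ q) {w : ℕ → ℝ≥0∞}
    (hw : ∀ k, w k ≠ 0) (hw' : ∀ k, w k ≠ ∞) {b : Index d → ℝ≥0∞} (hb : mixNorm p q w b ≠ ∞) :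
    Tendsto (fun F : Finset (Index d) => mixNorm p q w ((F : Set (Index d))ᶜ.indicator b))
      atTop (𝓝 0) := by
  have hp0 : 0 < p := by linarith
  have hq0 : 0 < q := by linarith
  have hθ : 0 < q / p := by positivity
  have hle : ∀ (F : Finset (Index d)) i, (F : Set (Index d))ᶜ.indicator b i ≤ b i :=
    fun F i => Set.indicator_le_self _ _ i
  refine ennreal_tendsto_tsum_of_dominated hb (fun F k => ?_) fun k => ?_
  · gcongr with j
    exact hle F _
  · have hk := ENNReal.ne_top_of_tsum_ne_top hb k
    have hS : ∑' j, b (j, k) ^ p ≠ ∞ := by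
      intro hS
      rw [hS, ENNReal.top_rpow_of_pos hθ, ENNReal.top_mul] at hk
      · exact hk rfl
      · exact (ENNReal.rpow_pos (pos_iff_ne_zero.2 (hw k)) (hw' k)).ne'
    have h1 : Tendsto (fun F : Finset (Index d) =>
        ∑' j, (F : Set (Index d))ᶜ.indicator b (j, k) ^ p) atTop (𝓝 0) := by
      refine ennreal_tendsto_tsum_of_dominated hS (fun F j => by gcongr; exact hle F _)
        fun j => tendsto_const_nhds.congr' ?_
      filter_upwards [eventually_ge_atTop {(j, k)}] with F hF
      have : (j, k) ∈ F := hF (Finset.mem_singleton_self _)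
      simp [this, hp0]
    have h2 := ENNReal.Tendsto.mul_const (b := w k ^ q)
      ((ENNReal.continuous_rpow_const (y := q / p)).tendsto 0 |>.comp h1)
      (Or.inr (ENNReal.rpow_ne_top_of_nonneg hq0.le (hw' k)))
    simpa [hθ, Function.comp_def] using h2

theorem mixNorm_single_ne_top {p q : ℝ} (hp : 1 ≤ p) (hq : 1 ≤ q) {w : ℕ → ℝ≥0∞}
    (hw' : ∀ k, w k ≠ ∞) (i : Index d) {c : ℝ≥0∞} (hc : c ≠ ∞) :
    mixNorm p q w (({i} : Set (Index d)).indicator fun _ => c) ≠ ∞ := by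
  have hp0 : 0 < p := by linarith
  have hq0 : 0 < q := by linarith
  have hθ : 0 < q / p := by positivity
  rw [mixNorm, tsum_eq_single i.2]
  · rw [tsum_eq_single i.1]
    · refine ENNReal.mul_ne_top (ENNReal.rpow_ne_top_of_nonneg hθ.le
        (ENNReal.rpow_ne_top_of_nonneg hp0.le ?_)) (ENNReal.rpow_ne_top_of_nonneg hq0.le (hw' _))
      simpa using hc
    · intro j hj
      have : (j, i.2) ≠ i := fun h => hj (congrArg Prod.fst h)
      simp [this, hp0]
  · intro k hk
    have : ∀ j, (j, k) ≠ i := fun j h => hk (congrArg Prod.snd h)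
    simp [this, hp0, hθ]

/-- An almost diagonal estimate for the blocks of frequency `ξ_k`. -/
theorem Lattice.IsAdmissible.exists_tsum_block_rpow_le {Ω : Lattice d} {α C : ℝ} (hα : 0 < α)
    (h : Ω.IsAdmissible α C) {p : ℝ} (hp : 1 ≤ p) (a : ℕ) :
    ∃ (N : ℕ) (K : ℝ≥0∞), K ≠ ∞ ∧ ∀ b c : Index d → ℝ≥0∞,
      (∀ i, c i ≤ ∑' i', ENNReal.ofReal ((gap α (Ω.point i) (Ω.point i') ^ N)⁻¹) * b i') →
      ∀ k, ∑' j, c (j, k) ^ p ≤ K * ∑' k', ENNReal.ofReal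
        (((1 + warpDist α (Ω.freq k) (Ω.freq k')) ^ a)⁻¹) * ∑' j, b (j, k') ^ p := by
  obtain ⟨Nr, Kr, hKr, hr⟩ := h.exists_tsum_gap_row_le hα 0
  obtain ⟨Kc, hKc, hc⟩ := h.exists_tsum_gap_col_le hα 0
  obtain ⟨Kf, hKf, hf⟩ := h.exists_tsum_freq_le hα
  simp only [pow_zero, inv_one, ENNReal.ofReal_one, mul_one] at hr hc
  set N₀ := max Nr (0 + (d + 1))
  set K₁ := max Kr Kc
  -- Since `gap` dominates the warped factor, `gap ^ (-(e + N₀))` splits into a frequency weight of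
  -- order `e` and a kernel of order `N₀`. The weight is summable by `d + 1 ≤ e` and serves in the
  -- mean inequality over `k'`; the kernel satisfies Schur's test in `j` for each pair of
  -- frequencies.
  set e := max a (d + 1)
  refine ⟨e + N₀, Kf ^ (p - 1) * K₁ ^ p, ENNReal.mul_ne_top
    (ENNReal.rpow_ne_top_of_nonneg (by linarith) hKf)
    (ENNReal.rpow_ne_top_of_nonneg (by linarith) (max_ne_top hKr hKc)), fun b c hcb k => ?_⟩
  set t : ℕ → ℝ≥0∞ := fun k' =>
    ENNReal.ofReal (((1 + warpDist α (Ω.freq k) (Ω.freq k')) ^ e)⁻¹) with ht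
  set M : Index d → Index d → ℝ≥0∞ := fun i i' =>
    ENNReal.ofReal ((gap α (Ω.point i) (Ω.point i') ^ N₀)⁻¹) with hM
  have hpow : ∀ {x : ℝ} {m n : ℕ}, 1 ≤ x → m ≤ n →
      ENNReal.ofReal ((x ^ n)⁻¹) ≤ ENNReal.ofReal ((x ^ m)⁻¹) := by
    intro x m n hx hmn
    refine ENNReal.ofReal_le_ofReal (inv_anti₀ (by positivity) (pow_le_pow_right₀ hx hmn))
  have hMt : ∀ j i', ENNReal.ofReal ((gap α (Ω.point (j, k)) (Ω.point i') ^ (e + N₀))⁻¹)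
      ≤ t i'.2 * M (j, k) i' := by
    intro j i'
    rw [ht, hM, ← ENNReal.ofReal_mul (by
      have := one_le_one_add_warpDist α (Ω.freq k) (Ω.freq i'.2); positivity), ← mul_inv]
    refine ENNReal.ofReal_le_ofReal (inv_anti₀ ?_ ?_)
    · have := one_le_one_add_warpDist α (Ω.freq k) (Ω.freq i'.2)
      have := one_le_gap α (Ω.point (j, k)) (Ω.point i')
      positivity
    · rw [pow_add]
      have h1 := one_le_one_add_warpDist α (Ω.freq k) (Ω.freq i'.2)
      have h2 := one_le_gap α (Ω.point (j, k)) (Ω.point i')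
      have h3 : 1 + warpDist α (Ω.freq k) (Ω.freq i'.2) ≤ gap α (Ω.point (j, k)) (Ω.point i') :=
        le_mul_of_one_le_right (by linarith) (one_le_one_add_scaled α _ _)
      gcongr
  have htK : ∑' k', t k' ≤ Kf :=
    (ENNReal.tsum_le_tsum fun k' => hpow (one_le_one_add_warpDist _ _ _)
      (le_max_right a (d + 1))).trans (hf _)
  have hc1 : ∀ j, c (j, k) ≤ ∑' k', t k' * ∑' j', M (j, k) (j', k') * b (j', k') := by
    intro j
    refine (hcb (j, k)).trans ?_
    rw [ENNReal.tsum_prod', ENNReal.tsum_comm]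
    refine ENNReal.tsum_le_tsum fun k' => ?_
    rw [← ENNReal.tsum_mul_left]
    refine ENNReal.tsum_le_tsum fun j' => ?_
    rw [← mul_assoc]
    gcongr
    exact hMt j (j', k')
  have hblock : ∀ k', ∑' j, (∑' j', M (j, k) (j', k') * b (j', k')) ^ p
      ≤ K₁ ^ p * ∑' j', b (j', k') ^ p := by
    intro k'
    refine schur_test (fun j j' => M (j, k) (j', k')) (fun j => ?_) (fun j' => ?_) hp _
    · exact ((ENNReal.tsum_le_tsum fun j' => hpow (one_le_gap _ _ _) (le_max_left _ _)).trans
        (hr _ k')).trans (le_max_left _ _)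
    · exact ((ENNReal.tsum_le_tsum fun j => hpow (one_le_gap _ _ _) (le_max_right _ _)).trans
        (hc _ k)).trans (le_max_right _ _)
  calc ∑' j, c (j, k) ^ p
      ≤ ∑' j, Kf ^ (p - 1) * ∑' k', t k' * (∑' j', M (j, k) (j', k') * b (j', k')) ^ p := by
        refine ENNReal.tsum_le_tsum fun j => ?_
        exact (ENNReal.rpow_le_rpow (hc1 j) (by linarith)).trans
          (ennreal_weighted_mean_rpow _ _ htK hp)
    _ = Kf ^ (p - 1) * ∑' k', t k' * ∑' j, (∑' j', M (j, k) (j', k') * b (j', k')) ^ p := by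
        rw [ENNReal.tsum_mul_left, ENNReal.tsum_comm]
        simp_rw [ENNReal.tsum_mul_left]
    _ ≤ Kf ^ (p - 1) * ∑' k', K₁ ^ p * (ENNReal.ofReal
        (((1 + warpDist α (Ω.freq k) (Ω.freq k')) ^ a)⁻¹) * ∑' j, b (j, k') ^ p) := by
        refine mul_le_mul' le_rfl (ENNReal.tsum_le_tsum fun k' => ?_)
        rw [mul_left_comm]
        exact mul_le_mul' (hpow (one_le_one_add_warpDist _ _ _) (le_max_left _ _)) (hblock k')
    _ = _ := by rw [ENNReal.tsum_mul_left, ← mul_assoc]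

/-- With `S c k` the `p`-th power of the weighted norm of the block `k`, the estimate between blocks
reads `S c ≤ K' t (S b)` for a matrix `t` on frequencies; `m` powers of the warped factor absorb the
quotient of weights. The matrix `t` acts on `ℓ^θ`, `θ = q / p`, by Schur's test if `θ ≥ 1` and by
subadditivity of the power `θ` if `θ ≤ 1`. -/
theorem Lattice.IsAdmissible.exists_mixNorm_le {Ω : Lattice d} {α C : ℝ} (hα : 0 < α)
    (h : Ω.IsAdmissible α C) (β : ℝ) {p q : ℝ} (hp : 1 ≤ p) (hq : 1 ≤ q) :
    ∃ (N : ℕ) (K : ℝ≥0∞), K ≠ ∞ ∧ ∀ b c : Index d → ℝ≥0∞,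
      (∀ i, c i ≤ ∑' i', ENNReal.ofReal ((gap α (Ω.point i) (Ω.point i') ^ N)⁻¹) * b i') →
      mixNorm p q (fun k => ENNReal.ofReal (weight β (Ω.freq k))) c
        ≤ K * mixNorm p q (fun k => ENNReal.ofReal (weight β (Ω.freq k))) b := by
  have hp0 : 0 < p := by linarith
  have hq0 : 0 < q := by linarith
  set θ := q / p with hθd
  have hθ : 0 < θ := by positivity
  obtain ⟨B, m, hB, hrat⟩ := exists_rpow_le_warpDist d hα (β * p)
  obtain ⟨Kf, hKf, hf⟩ := h.exists_tsum_freq_le hα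
  -- The first condition makes the entries of `t` summable, the second their powers of order `θ`.
  obtain ⟨e, he1, heθ⟩ : ∃ e : ℕ, d + 1 ≤ e ∧ ((d + 1 : ℕ) : ℝ) ≤ e * θ := by
    obtain ⟨e, he⟩ := exists_nat_ge (((d + 1 : ℕ) : ℝ) / θ)
    refine ⟨max e (d + 1), le_max_right _ _, ?_⟩
    rw [div_le_iff₀ hθ] at he
    exact he.trans (by gcongr; exact le_max_left _ _)
  obtain ⟨N, K, hK, hblock⟩ := h.exists_tsum_block_rpow_le hα hp (e + m)
  set w : ℕ → ℝ≥0∞ := fun k => ENNReal.ofReal (weight β (Ω.freq k)) with hw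
  set t : ℕ → ℕ → ℝ≥0∞ := fun k k' =>
    ENNReal.ofReal (((1 + warpDist α (Ω.freq k) (Ω.freq k')) ^ e)⁻¹) with ht
  set S : (Index d → ℝ≥0∞) → ℕ → ℝ≥0∞ := fun c k => w k ^ p * ∑' j, c (j, k) ^ p with hS
  have hmix : ∀ c, mixNorm p q w c = ∑' k, S c k ^ θ := by
    intro c
    refine tsum_congr fun k => ?_
    rw [hS, ENNReal.mul_rpow_of_nonneg _ _ hθ.le, ← ENNReal.rpow_mul, hθd,
      mul_div_cancel₀ _ hp0.ne', mul_comm]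
  have hwt : ∀ k k', w k ^ p * ENNReal.ofReal
      (((1 + warpDist α (Ω.freq k) (Ω.freq k')) ^ (e + m))⁻¹)
        ≤ ENNReal.ofReal B * (t k k' * w k' ^ p) := by
    intro k k'
    have h1 := one_le_one_add_warpDist α (Ω.freq k) (Ω.freq k')
    have hx : 0 < 1 + ‖Ω.freq k‖ := one_add_norm_pos _
    have hy : 0 < 1 + ‖Ω.freq k'‖ := one_add_norm_pos _
    have h2 := hrat (Ω.freq k) (Ω.freq k')
    simp only [hw, ht, weight]
    rw [ENNReal.ofReal_rpow_of_pos (by positivity), ENNReal.ofReal_rpow_of_pos (by positivity),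
      ← Real.rpow_mul hx.le, ← Real.rpow_mul hy.le, ← ENNReal.ofReal_mul (by positivity),
      ← ENNReal.ofReal_mul (by positivity), ← ENNReal.ofReal_mul (by positivity)]
    refine ENNReal.ofReal_le_ofReal ?_
    set D := 1 + warpDist α (Ω.freq k) (Ω.freq k') with hD
    have hD0 : 0 < D := by linarith
    calc (1 + ‖Ω.freq k‖) ^ (β * p) * (D ^ (e + m))⁻¹
        ≤ B * (1 + ‖Ω.freq k'‖) ^ (β * p) * D ^ m * (D ^ (e + m))⁻¹ := by gcongr
      _ = B * ((D ^ e)⁻¹ * (1 + ‖Ω.freq k'‖) ^ (β * p)) := by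
        rw [pow_add]; field_simp
  set K' := K * ENNReal.ofReal B with hK'
  have hK'top : K' ≠ ∞ := ENNReal.mul_ne_top hK ENNReal.ofReal_ne_top
  have hmain : ∀ b c : Index d → ℝ≥0∞,
      (∀ i, c i ≤ ∑' i', ENNReal.ofReal ((gap α (Ω.point i) (Ω.point i') ^ N)⁻¹) * b i') →
      ∀ k, S c k ≤ K' * ∑' k', t k k' * S b k' := by
    intro b c hbc k
    calc S c k ≤ w k ^ p * (K * ∑' k', ENNReal.ofReal
        (((1 + warpDist α (Ω.freq k) (Ω.freq k')) ^ (e + m))⁻¹) * ∑' j, b (j, k') ^ p) := by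
          simp only [hS]
          gcongr
          exact hblock b c hbc k
      _ = K * ∑' k', (w k ^ p * ENNReal.ofReal
        (((1 + warpDist α (Ω.freq k) (Ω.freq k')) ^ (e + m))⁻¹)) * ∑' j, b (j, k') ^ p := by
          rw [mul_left_comm, ← ENNReal.tsum_mul_left]
          simp_rw [mul_assoc]
      _ ≤ K * ∑' k', (ENNReal.ofReal B * (t k k' * w k' ^ p)) * ∑' j, b (j, k') ^ p := by
          exact mul_le_mul' le_rfl (ENNReal.tsum_le_tsum fun k' => mul_le_mul' (hwt k k') le_rfl)
      _ = K' * ∑' k', t k k' * S b k' := by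
          rw [hK', mul_assoc, ← ENNReal.tsum_mul_left (a := ENNReal.ofReal B)]
          simp_rw [hS, mul_assoc]
  have htsymm : ∀ k k', t k k' = t k' k := fun k k' => by
    simp only [ht, warpDist_comm α (Ω.freq k)]
  have hrow : ∀ k, ∑' k', t k k' ≤ Kf := fun k =>
    (ENNReal.tsum_le_tsum fun k' => ENNReal.ofReal_le_ofReal <| by
      have h1 := one_le_one_add_warpDist α (Ω.freq k) (Ω.freq k')
      exact inv_anti₀ (by positivity) (pow_le_pow_right₀ h1 he1)).trans (hf (Ω.freq k))
  have hcol : ∀ k', ∑' k, t k k' ≤ Kf := fun k' => by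
    simp_rw [htsymm _ k']
    exact hrow k'
  rcases le_total 1 θ with h1 | h1
  · refine ⟨N, K' ^ θ * Kf ^ θ, ENNReal.mul_ne_top (ENNReal.rpow_ne_top_of_nonneg hθ.le hK'top)
      (ENNReal.rpow_ne_top_of_nonneg hθ.le hKf), fun b c hbc => ?_⟩
    rw [hmix, hmix]
    calc ∑' k, S c k ^ θ ≤ ∑' k, (K' * ∑' k', t k k' * S b k') ^ θ := by
          gcongr with k
          exact hmain b c hbc k
      _ = K' ^ θ * ∑' k, (∑' k', t k k' * S b k') ^ θ := by
          simp_rw [ENNReal.mul_rpow_of_nonneg _ _ hθ.le]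
          rw [ENNReal.tsum_mul_left]
      _ ≤ K' ^ θ * (Kf ^ θ * ∑' k, S b k ^ θ) := by
          gcongr
          exact schur_test t hrow hcol h1 (S b)
      _ = _ := by rw [mul_assoc]
  · have htθ : ∀ k', ∑' k, t k k' ^ θ ≤ Kf := fun k' => by
      refine (ENNReal.tsum_le_tsum fun k => ?_).trans (hf (Ω.freq k'))
      have hD := one_le_one_add_warpDist α (Ω.freq k') (Ω.freq k)
      rw [htsymm]
      simp only [ht]
      rw [ENNReal.ofReal_rpow_of_pos (by positivity)]
      refine ENNReal.ofReal_le_ofReal ?_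
      rw [Real.inv_rpow (by positivity), ← Real.rpow_natCast, ← Real.rpow_natCast,
        ← Real.rpow_mul (by positivity)]
      exact inv_anti₀ (by positivity) (Real.rpow_le_rpow_of_exponent_le hD heθ)
    refine ⟨N, K' ^ θ * Kf, ENNReal.mul_ne_top (ENNReal.rpow_ne_top_of_nonneg hθ.le hK'top)
      hKf, fun b c hbc => ?_⟩
    rw [hmix, hmix]
    calc ∑' k, S c k ^ θ ≤ ∑' k, (K' * ∑' k', t k k' * S b k') ^ θ := by
          gcongr with k
          exact hmain b c hbc k
      _ = K' ^ θ * ∑' k, (∑' k', t k k' * S b k') ^ θ := by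
          simp_rw [ENNReal.mul_rpow_of_nonneg _ _ hθ.le]
          rw [ENNReal.tsum_mul_left]
      _ ≤ K' ^ θ * ∑' k, ∑' k', t k k' ^ θ * S b k' ^ θ := by
          gcongr with k
          refine (ennreal_tsum_rpow_le _ hθ h1).trans_eq (tsum_congr fun k' => ?_)
          rw [ENNReal.mul_rpow_of_nonneg _ _ hθ.le]
      _ = K' ^ θ * ∑' k', (∑' k, t k k' ^ θ) * S b k' ^ θ := by
          rw [ENNReal.tsum_comm]
          simp_rw [ENNReal.tsum_mul_right]
      _ ≤ K' ^ θ * ∑' k', Kf * S b k' ^ θ := by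
          gcongr with k'
          exact htθ k'
      _ = _ := by rw [ENNReal.tsum_mul_left, mul_assoc]

/-- Sequences decaying away from a point of the lattice have finite mixed norms. -/
theorem Lattice.IsAdmissible.exists_mixNorm_ne_top {Ω : Lattice d} {α C : ℝ} (hα : 0 < α)
    (h : Ω.IsAdmissible α C) (β : ℝ) {p q : ℝ} (hp : 1 ≤ p) (hq : 1 ≤ q) (i₀ : Index d) :
    ∃ N : ℕ, ∀ (B : ℝ) (c : Index d → ℝ≥0∞),
      (∀ i, c i ≤ ENNReal.ofReal (B * (gap α (Ω.point i) (Ω.point i₀) ^ N)⁻¹)) →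
      mixNorm p q (fun k => ENNReal.ofReal (weight β (Ω.freq k))) c ≠ ∞ := by
  obtain ⟨N, K, hK, hN⟩ := h.exists_mixNorm_le hα β hp hq
  refine ⟨N, fun B c hc => ?_⟩
  -- The sequence is dominated by the almost diagonal matrix applied to a single spike at `i₀`.
  refine ne_top_of_le_ne_top (ENNReal.mul_ne_top hK (mixNorm_single_ne_top hp hq
    (fun k => ENNReal.ofReal_ne_top) i₀ (ENNReal.ofReal_ne_top (r := B)))) (hN _ c fun i => ?_)
  refine (hc i).trans ?_
  refine le_trans ?_ (ENNReal.le_tsum i₀)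
  have := one_le_gap α (Ω.point i) (Ω.point i₀)
  rw [mul_comm, ENNReal.ofReal_mul (by positivity)]
  simp

end

end Dispersive
end

noncomputable section
namespace Dispersive

section
variable {d : ℕ}

/-! ### Localization of the dual frame -/

/-- Together with `exists_gap_le_one_add_norm_mul`: seen from a fixed point, `gap` and polynomial
size in phase space are equivalent up to powers. This direction lets rapid decay in `gap` outweigh
the seminorms of packets. -/
theorem exists_one_add_norm_mul_le_gap {α : ℝ} (hα : 0 < α) (w : Space d × Space d) :
    ∃ (B : ℝ) (K : ℕ), 0 < B ∧ ∀ z : Space d × Space d,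
      (1 + ‖z.1‖) * (1 + ‖z.2‖) ≤ B * gap α w z ^ K := by
  obtain ⟨C, m, hC, h⟩ := exists_rpow_le_warpDist d hα 1
  set s := (1 + ‖w.2‖) ^ (1 - α) with hs
  have hs0 : 0 < s := Real.rpow_pos_of_pos (one_add_norm_pos _) _
  refine ⟨(1 + ‖w.1‖ + s⁻¹) * (C * (1 + ‖w.2‖)), m + 1, by positivity, fun z => ?_⟩
  have hg := one_le_gap α w z
  have h1 : 1 + ‖z.1‖ ≤ (1 + ‖w.1‖ + s⁻¹) * gap α w z := by
    have h2 : s * ‖w.1 - z.1‖ ≤ gap α w z := by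
      have h3 : 1 + s * ‖w.1 - z.1‖ ≤ gap α w z :=
        le_mul_of_one_le_left (by positivity) (one_le_one_add_warpDist α w.2 z.2)
      linarith
    have h3 : ‖w.1 - z.1‖ ≤ s⁻¹ * gap α w z := by
      rw [inv_mul_eq_div, le_div_iff₀ hs0, mul_comm]; exact h2
    have h4 : ‖z.1‖ ≤ ‖w.1‖ + ‖w.1 - z.1‖ := by
      rw [norm_sub_rev]
      simpa using norm_add_le w.1 (z.1 - w.1)
    nlinarith [norm_nonneg w.1]
  have h2 : 1 + ‖z.2‖ ≤ C * (1 + ‖w.2‖) * gap α w z ^ m := by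
    have h3 := h z.2 w.2
    rw [Real.rpow_one, Real.rpow_one, warpDist_comm] at h3
    have h4 : 1 + warpDist α w.2 z.2 ≤ gap α w z :=
      le_mul_of_one_le_right (by linarith [warpDist_nonneg α w.2 z.2])
        (one_le_one_add_scaled α _ _)
    have h5 := warpDist_nonneg α w.2 z.2
    refine h3.trans ?_
    gcongr
  calc (1 + ‖z.1‖) * (1 + ‖z.2‖)
      ≤ ((1 + ‖w.1‖ + s⁻¹) * gap α w z) * (C * (1 + ‖w.2‖) * gap α w z ^ m) := by gcongr
    _ = _ := by ring

theorem exists_gap_le_one_add_norm_mul (α : ℝ) (z : Space d × Space d) :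
    ∃ (B : ℝ) (K : ℕ), 0 < B ∧ ∀ w : Space d × Space d,
      gap α w z ≤ B * ((1 + ‖w.1‖) * (1 + ‖w.2‖)) ^ K := by
  obtain ⟨m, hm⟩ := exists_nat_ge (max α (1 - α))
  refine ⟨(2 + ‖warp α z.2‖) * (2 + ‖z.1‖), m + (m + 1), by positivity, fun w => ?_⟩
  have hx : 1 ≤ 1 + ‖w.1‖ := by linarith [norm_nonneg w.1]
  have hξ : 1 ≤ 1 + ‖w.2‖ := by linarith [norm_nonneg w.2]
  set P := (1 + ‖w.1‖) * (1 + ‖w.2‖) with hP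
  have hP1 : 1 ≤ P := one_le_mul_of_one_le_of_one_le hx hξ
  have hr : ∀ γ ≤ max α (1 - α), (1 + ‖w.2‖) ^ γ ≤ P ^ m := fun γ hγ => by
    calc (1 + ‖w.2‖) ^ γ ≤ (1 + ‖w.2‖) ^ (m : ℝ) :=
          Real.rpow_le_rpow_of_exponent_le hξ (hγ.trans hm)
      _ = (1 + ‖w.2‖) ^ m := Real.rpow_natCast _ _
      _ ≤ P ^ m := by gcongr; exact le_mul_of_one_le_left (by linarith) hx
  have hPm : 1 ≤ P ^ m := one_le_pow₀ hP1
  have h1 : 1 + warpDist α w.2 z.2 ≤ (2 + ‖warp α z.2‖) * P ^ m := by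
    have h2 : warpDist α w.2 z.2 ≤ ‖warp α w.2‖ + ‖warp α z.2‖ := norm_sub_le _ _
    have h3 := (norm_warp_le α w.2).trans (hr α (le_max_left _ _))
    nlinarith [norm_nonneg (warp α z.2)]
  have h2 : 1 + (1 + ‖w.2‖) ^ (1 - α) * ‖w.1 - z.1‖ ≤ (2 + ‖z.1‖) * P ^ (m + 1) := by
    have h3 : ‖w.1 - z.1‖ ≤ (1 + ‖z.1‖) * P := by
      have h4 : 1 + ‖w.1‖ ≤ P := le_mul_of_one_le_right (by linarith) hξ
      have h5 := norm_sub_le w.1 z.1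
      nlinarith [norm_nonneg z.1]
    have h4 : (1 + ‖w.2‖) ^ (1 - α) * ‖w.1 - z.1‖ ≤ P ^ m * ((1 + ‖z.1‖) * P) := by
      gcongr
      exact hr _ (le_max_right _ _)
    have h5 : 1 ≤ P ^ (m + 1) := one_le_pow₀ hP1
    calc _ ≤ P ^ (m + 1) + P ^ m * ((1 + ‖z.1‖) * P) := by gcongr
      _ = _ := by ring
  calc gap α w z ≤ ((2 + ‖warp α z.2‖) * P ^ m) * ((2 + ‖z.1‖) * P ^ (m + 1)) := by
        rw [gap]; gcongr
    _ = _ := by ring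

/-- A bound for the variation of `slowWeight` between points of phase space. -/
def linkWeight (α C : ℝ) (w z : Space d × Space d) : ℝ :=
  C * (1 + ((1 + ‖w.2‖) ^ (1 - α) + (1 + ‖z.2‖) ^ (1 - α)) * ‖w.1 - z.1‖)

theorem linkWeight_comm (α C : ℝ) (w z : Space d × Space d) :
    linkWeight α C w z = linkWeight α C z w := by
  rw [linkWeight, linkWeight, add_comm ((1 + ‖w.2‖) ^ (1 - α)), norm_sub_rev]

theorem one_le_linkWeight (α : ℝ) {C : ℝ} (hC : 1 ≤ C) (w z : Space d × Space d) :
    1 ≤ linkWeight α C w z := by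
  have : 0 ≤ ((1 + ‖w.2‖) ^ (1 - α) + (1 + ‖z.2‖) ^ (1 - α)) * ‖w.1 - z.1‖ := by positivity
  exact one_le_mul_of_one_le_of_one_le hC (by linarith)

theorem abs_slowWeight_sub_le {α C : ℝ} (hC : 0 ≤ C) {R : ℝ} {m : ℕ}
    (h : ∀ b w z : Space d × Space d, warpDist α w.2 z.2 ≤ R →
      slowWeight α m b w - slowWeight α m b z
        ≤ C * (1 + (1 + ‖w.2‖) ^ (1 - α) * ‖w.1 - z.1‖))
    (b w z : Space d × Space d) (hwz : warpDist α w.2 z.2 ≤ R) :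
    |slowWeight α m b w - slowWeight α m b z| ≤ linkWeight α C w z := by
  have key : ∀ w z : Space d × Space d, warpDist α w.2 z.2 ≤ R →
      slowWeight α m b w - slowWeight α m b z ≤ linkWeight α C w z := fun w z hwz => by
    refine (h b w z hwz).trans ?_
    have : 0 ≤ (1 + ‖z.2‖) ^ (1 - α) := by positivity
    rw [linkWeight]
    gcongr
    linarith
  rw [abs_le']
  refine ⟨key w z hwz, ?_⟩
  rw [neg_sub, linkWeight_comm]
  exact key z w (by rwa [warpDist_comm])

/-- Where the entry is nonzero, both `gap` and `linkWeight` are bounded by multiples of `D`, the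
rescaled distance of the positions. Decay of order `n + N` in `D` pays for `linkWeight ^ n` and
leaves a summable power of `gap`. -/
theorem Lattice.IsAdmissible.exists_gram_schur {Ω : Lattice d} {α C : ℝ} (hα : 0 < α)
    (h : Ω.IsAdmissible α C) (φ : 𝓢(Space d, ℂ)) {R : ℝ} (hR : 0 ≤ R)
    (hadj : ∀ i j, inner ℂ (toL2 (Ω.packet α φ i)) (toL2 (Ω.packet α φ j)) ≠ 0 →
      warpDist α (Ω.point i).2 (Ω.point j).2 ≤ R) {C₀ : ℝ} (hC₀ : 1 ≤ C₀) (n : ℕ) :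
    ∃ K : ℝ≥0∞, K ≠ ∞ ∧ ∀ i, ∑' j, ‖inner ℂ (toL2 (Ω.packet α φ i)) (toL2 (Ω.packet α φ j))‖ₑ *
      ENNReal.ofReal (linkWeight α C₀ (Ω.point i) (Ω.point j) ^ n) ≤ K := by
  obtain ⟨c, hc, hfreq⟩ := h.exists_le_norm_freq hα
  obtain ⟨N, K, hK, hsum⟩ := h.exists_tsum_gap_le hα
  obtain ⟨B, m, hB, hrat⟩ := exists_rpow_le_warpDist d hα (1 - α)
  obtain ⟨C₁, hC₁, hin⟩ := exists_inner_packet_le hα φ hc R (n + N)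
  set B' := B * (1 + R) ^ m with hB'
  have hB'0 : 0 ≤ B' := by positivity
  set A : ℝ := C₁ * (C₀ * (1 + B')) ^ n * (1 + R) ^ N with hA
  have hA0 : 0 ≤ A := by positivity
  refine ⟨ENNReal.ofReal A * K, ENNReal.mul_ne_top ENNReal.ofReal_ne_top hK, fun i => ?_⟩
  refine le_trans ?_ (mul_le_mul' le_rfl (hsum (Ω.point i)))
  rw [← ENNReal.tsum_mul_left]
  refine ENNReal.tsum_le_tsum fun j => ?_
  by_cases hij : inner ℂ (toL2 (Ω.packet α φ i)) (toL2 (Ω.packet α φ j)) = 0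
  · simp [hij]
  have hd := hadj i j hij
  have hb := hin (Ω.pos i.1 i.2) (Ω.freq i.2) (Ω.freq_ne_zero _) (Ω.pos j.1 j.2) (Ω.freq j.2)
    (Ω.freq_ne_zero _) (hfreq _) (hfreq _) hd
  rw [← ofReal_norm, ← ENNReal.ofReal_mul (norm_nonneg _), ← ENNReal.ofReal_mul hA0]
  refine ENNReal.ofReal_le_ofReal ?_
  have hg1 := one_le_gap α (Ω.point i) (Ω.point j)
  set G := gap α (Ω.point i) (Ω.point j) with hG
  set s := (1 + ‖Ω.freq i.2‖) ^ (1 - α) with hs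
  have hs0 : 0 ≤ s := by positivity
  set D := 1 + s * ‖Ω.pos i.1 i.2 - Ω.pos j.1 j.2‖ with hD
  have hD1 : 1 ≤ D := one_le_one_add_scaled _ _ _
  have hGD : G ≤ (1 + R) * D := by
    rw [hG, gap]
    have := warpDist_nonneg α (Ω.point i).2 (Ω.point j).2
    exact mul_le_mul (by linarith) le_rfl (by positivity) (by positivity)
  have hL : linkWeight α C₀ (Ω.point i) (Ω.point j) ≤ C₀ * (1 + B') * D := by
    have h1 : (1 + ‖Ω.freq j.2‖) ^ (1 - α) ≤ B' * s := by
      refine (hrat (Ω.freq j.2) (Ω.freq i.2)).trans ?_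
      rw [warpDist_comm]
      have := warpDist_nonneg α (Ω.freq i.2) (Ω.freq j.2)
      have h2 : warpDist α (Ω.freq i.2) (Ω.freq j.2) ≤ R := hd
      rw [hB', mul_right_comm]
      gcongr
    calc linkWeight α C₀ (Ω.point i) (Ω.point j)
        ≤ C₀ * (1 + (s + B' * s) * ‖Ω.pos i.1 i.2 - Ω.pos j.1 j.2‖) := by
          rw [linkWeight]
          simp only [Lattice.point]
          gcongr
      _ ≤ C₀ * (1 + B' + (s + B' * s) * ‖Ω.pos i.1 i.2 - Ω.pos j.1 j.2‖) := by
          gcongr; linarith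
      _ = _ := by rw [hD]; ring
  have hL0 : 0 ≤ linkWeight α C₀ (Ω.point i) (Ω.point j) :=
    zero_le_one.trans (one_le_linkWeight α hC₀ _ _)
  have hDN : (D ^ N)⁻¹ ≤ (1 + R) ^ N * (G ^ N)⁻¹ := by
    rw [← div_eq_mul_inv, le_div_iff₀ (by positivity), inv_mul_le_iff₀ (by positivity), ← mul_pow,
      mul_comm D]
    gcongr
  calc _ ≤ C₁ * (D ^ (n + N))⁻¹ * (C₀ * (1 + B') * D) ^ n := by gcongr; exact hb
    _ = C₁ * (C₀ * (1 + B')) ^ n * (D ^ N)⁻¹ := by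
        rw [mul_pow _ D, pow_add]; field_simp
    _ ≤ C₁ * (C₀ * (1 + B')) ^ n * ((1 + R) ^ N * (G ^ N)⁻¹) := by gcongr
    _ = _ := by rw [hA]; ring

/-- The inverse `T` of the frame operator of the packets maps each packet to a function whose
coefficients decay rapidly. -/
theorem IsAdmissiblePair.exists_inverse {Ω : Lattice d} {α : ℝ} (hα : 0 < α)
    {φ : 𝓢(Space d, ℂ)} (hadm : IsAdmissiblePair α φ Ω) :
    ∃ T : Lp ℂ 2 (volume : Measure (Space d)) →L[ℂ] Lp ℂ 2 (volume : Measure (Space d)),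
      (∀ f, HasSum (fun j => inner ℂ (toL2 (Ω.packet α φ j)) (T f) • toL2 (Ω.packet α φ j)) f) ∧
      (∀ f g, inner ℂ (T f) g = inner ℂ f (T g)) ∧
      ∀ N : ℕ, ∃ B : ℝ, ∀ i j,
        ‖inner ℂ (toL2 (Ω.packet α φ j)) (T (toL2 (Ω.packet α φ i)))‖
            ≤ B * (gap α (Ω.point i) (Ω.point j) ^ N)⁻¹ ∧
          ‖inner ℂ (toL2 (Ω.packet α φ j)) (T (T (toL2 (Ω.packet α φ i))))‖
            ≤ B * (gap α (Ω.point i) (Ω.point j) ^ N)⁻¹ := by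
  obtain ⟨C, h⟩ := hadm.lattice
  obtain ⟨_, c₂, -, -, hann⟩ := hadm.annulus
  obtain ⟨V, T, A, hA, hV, hlow, hST, -, hT⟩ := hadm.frame.exists_inverse
  obtain ⟨c, hc, hfreq⟩ := h.exists_le_norm_freq hα
  obtain ⟨R, hR, -, hadj⟩ := exists_warpDist_le_of_inner_ne_zero hα
    (fun ζ hζ => (hann ζ hζ).2) hc
  have hadj' : ∀ i j, inner ℂ (toL2 (Ω.packet α φ i)) (toL2 (Ω.packet α φ j)) ≠ 0 →
      warpDist α (Ω.point i).2 (Ω.point j).2 ≤ R := fun i j hij =>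
    hadj _ _ _ _ _ _ (hfreq _) (hfreq _) hij
  obtain ⟨m, C₀, hC₀, hslow⟩ := exists_slowWeight_le d hα hR
  refine ⟨T, fun f => ?_, hT, fun N => ?_⟩
  · have := hasSum_adjoint_analysis hV (V (T f))
    rw [hST] at this
    simpa only [hV] using this
  -- The exponent comes from `gap ≤ slowWeight ^ (m + 2)`.
  obtain ⟨B, hB⟩ := exists_localization hA hV hlow hST
    (L := fun i j => linkWeight α C₀ (Ω.point i) (Ω.point j))
    (fun i j => one_le_linkWeight α hC₀ _ _) (fun i j => linkWeight_comm α C₀ _ _)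
    (fun n => h.exists_gram_schur hα φ hR hadj' hC₀ n) ((m + 2) * N)
  refine ⟨B, fun i j => ?_⟩
  have hloc := hB (fun j => slowWeight α m (Ω.point i) (Ω.point j))
    (fun j => one_le_slowWeight α m _ _)
    (fun j l hjl => abs_slowWeight_sub_le (by linarith) hslow _ _ _ (hadj' j l hjl)) i
    (slowWeight_self α m _) j
  have hg := one_le_gap α (Ω.point i) (Ω.point j)
  have hgW : gap α (Ω.point i) (Ω.point j) ^ N
      ≤ slowWeight α m (Ω.point i) (Ω.point j) ^ ((m + 2) * N) := by
    rw [pow_mul]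
    gcongr
    exact gap_le_slowWeight_pow α m _ _
  have key : ∀ x : ℝ, 0 ≤ x → slowWeight α m (Ω.point i) (Ω.point j) ^ ((m + 2) * N) * x ≤ B →
      x ≤ B * (gap α (Ω.point i) (Ω.point j) ^ N)⁻¹ := fun x hx h1 => by
    rw [← div_eq_mul_inv, le_div_iff₀ (by positivity), mul_comm]
    exact (mul_le_mul_of_nonneg_right hgW hx).trans h1
  exact ⟨key _ (norm_nonneg _) hloc.1, key _ (norm_nonneg _) hloc.2⟩

/-- Sums of packets with rapidly decaying coefficients converge in the Schwartz space. -/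
theorem Lattice.IsAdmissible.exists_hasSum_packet {Ω : Lattice d} {α C : ℝ} (hα : 0 < α)
    (h : Ω.IsAdmissible α C) (φ : 𝓢(Space d, ℂ)) {w : Space d × Space d} {u : Index d → ℂ}
    (hu : ∀ N : ℕ, ∃ B : ℝ, ∀ j, ‖u j‖ ≤ B * (gap α w (Ω.point j) ^ N)⁻¹) :
    ∃ Φ : 𝓢(Space d, ℂ), HasSum (fun j => u j • Ω.packet α φ j) Φ := by
  obtain ⟨c, hc, hfreq⟩ := h.exists_le_norm_freq hα
  obtain ⟨N, K, hK, hsum⟩ := h.exists_tsum_gap_le hα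
  obtain ⟨B, L, hB, hsize⟩ := exists_one_add_norm_mul_le_gap hα w
  have hsumm : Summable fun j => (gap α w (Ω.point j) ^ N)⁻¹ := by
    have h1 := ENNReal.summable_toReal (ne_top_of_le_ne_top hK (hsum w))
    refine h1.congr fun j => ENNReal.toReal_ofReal ?_
    have := one_le_gap α w (Ω.point j)
    positivity
  refine exists_hasSum_schwartz _ fun k n => ?_
  obtain ⟨C₁, M, hC₁, hsemi⟩ := exists_packet_seminorm_le α φ hc k n
  -- The seminorm grows at most like `gap ^ (L * M)`; the other `N` powers give summability.
  obtain ⟨B', hB'⟩ := hu (N + L * M)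
  refine Summable.of_nonneg_of_le (fun j => apply_nonneg _ _) (fun j => ?_)
    (hsumm.mul_left (B' * (C₁ * B ^ M)))
  have hg := one_le_gap α w (Ω.point j)
  set G := gap α w (Ω.point j) with hG
  have h1 : SchwartzMap.seminorm ℝ k n (Ω.packet α φ j) ≤ C₁ * (B ^ M * G ^ (L * M)) := by
    refine SchwartzMap.seminorm_le_bound ℝ k n _ (by positivity) fun t => ?_
    refine (hsemi _ _ (Ω.freq_ne_zero j.2) (hfreq _) t).trans ?_
    rw [pow_mul, ← mul_pow]
    exact mul_le_mul_of_nonneg_left (pow_le_pow_left₀ (by positivity) (hsize (Ω.point j)) M) hC₁.le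
  have h2 : SchwartzMap.seminorm ℝ k n (u j • Ω.packet α φ j)
      ≤ ‖u j‖ * SchwartzMap.seminorm ℝ k n (Ω.packet α φ j) := by
    refine SchwartzMap.seminorm_le_bound ℝ k n _ (by positivity) fun t => ?_
    have h3 := SchwartzMap.le_seminorm ℝ k n (Ω.packet α φ j) t
    have h4 : iteratedFDeriv ℝ n (u j • Ω.packet α φ j : 𝓢(Space d, ℂ)) t
        = u j • iteratedFDeriv ℝ n (Ω.packet α φ j) t :=
      iteratedFDeriv_const_smul_apply ((Ω.packet α φ j).smooth n).contDiffAt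
    rw [h4, norm_smul, mul_left_comm]
    gcongr
  calc _ ≤ ‖u j‖ * SchwartzMap.seminorm ℝ k n (Ω.packet α φ j) := h2
    _ ≤ (B' * (G ^ (N + L * M))⁻¹) * (C₁ * (B ^ M * G ^ (L * M))) := by
        gcongr
        · exact (norm_nonneg _).trans (hB' j)
        · exact hB' j
    _ = _ := by rw [pow_add]; field_simp

end

end Dispersive
end

noncomputable section
namespace Dispersive

section
variable {d : ℕ}

/-! ### Expansions in the dual frame -/

theorem mixNorm_const_mul {p q : ℝ} (hp : 1 ≤ p) (hq : 1 ≤ q) (w : ℕ → ℝ≥0∞) (a : ℝ≥0∞)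
    (c : Index d → ℝ≥0∞) : mixNorm p q w (fun i => a * c i) = a ^ q * mixNorm p q w c := by
  have hp0 : 0 < p := by linarith
  have hθ : 0 ≤ q / p := by positivity
  rw [mixNorm, mixNorm, ← ENNReal.tsum_mul_left]
  refine tsum_congr fun k => ?_
  simp_rw [ENNReal.mul_rpow_of_nonneg _ _ hp0.le]
  rw [ENNReal.tsum_mul_left, ENNReal.mul_rpow_of_nonneg _ _ hθ, ← ENNReal.rpow_mul,
    mul_div_cancel₀ _ hp0.ne', mul_assoc]

theorem modNorm_eq_mixNorm (α β p q : ℝ) (φ : 𝓢(Space d, ℂ)) (Ω : Lattice d)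
    (f : 𝓢'(Space d, ℂ)) : modNorm α β p q φ Ω f
      = mixNorm p q (fun k => ENNReal.ofReal (weight β (Ω.freq k)))
          (fun i => ‖coeff α φ Ω f i‖ₑ) ^ (1 / q) := rfl

theorem weight_pos (β : ℝ) (ξ : Space d) : 0 < weight β ξ :=
  Real.rpow_pos_of_pos (one_add_norm_pos ξ) _

theorem mem_modSpace_iff {α β p q : ℝ} (hq : 1 ≤ q) {φ : 𝓢(Space d, ℂ)} {Ω : Lattice d}
    {f : 𝓢'(Space d, ℂ)} : f ∈ modSpace α β p q φ Ω ↔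
      mixNorm p q (fun k => ENNReal.ofReal (weight β (Ω.freq k)))
        (fun i => ‖coeff α φ Ω f i‖ₑ) ≠ ∞ := by
  have hq0 : 0 < 1 / q := by positivity
  rw [modSpace, Set.mem_ofPred_eq, modNorm_eq_mixNorm, ENNReal.rpow_lt_top_iff_of_pos hq0,
    lt_top_iff_ne_top]

theorem IsAdmissiblePair.ofSchwartz_mem_modSpace {Ω : Lattice d} {α : ℝ} (hα : 0 < α)
    {φ : 𝓢(Space d, ℂ)} (hadm : IsAdmissiblePair α φ Ω) (β : ℝ) {p q : ℝ} (hp : 1 ≤ p)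
    (hq : 1 ≤ q) (g : 𝓢(Space d, ℂ)) : ofSchwartz g ∈ modSpace α β p q φ Ω := by
  obtain ⟨C, h⟩ := hadm.lattice
  obtain ⟨_, c₂, -, -, hann⟩ := hadm.annulus
  obtain ⟨c, hc, hfreq⟩ := h.exists_le_norm_freq hα
  set i₀ : Index d := (0, 0)
  obtain ⟨N, hN⟩ := h.exists_mixNorm_ne_top hα β hp hq i₀
  obtain ⟨B, K, hB, hsize⟩ := exists_gap_le_one_add_norm_mul α (Ω.point i₀)
  obtain ⟨C₁, hC₁, hin⟩ := exists_inner_packet_le_pow hα φ g (fun ζ hζ => (hann ζ hζ).2) hc (K * N)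
  rw [mem_modSpace_iff hq]
  refine hN (C₁ * B ^ N) _ fun i => ?_
  rw [coeff, pair_ofSchwartz, ← ofReal_norm]
  refine ENNReal.ofReal_le_ofReal ((hin _ _ (Ω.freq_ne_zero i.2) (hfreq _)).trans ?_)
  have hg := one_le_gap α (Ω.point i) (Ω.point i₀)
  have h1 : gap α (Ω.point i) (Ω.point i₀)
      ≤ B * ((1 + ‖Ω.pos i.1 i.2‖) * (1 + ‖Ω.freq i.2‖)) ^ K := hsize (Ω.point i)
  have h2 : gap α (Ω.point i) (Ω.point i₀) ^ N
      ≤ B ^ N * ((1 + ‖Ω.pos i.1 i.2‖) * (1 + ‖Ω.freq i.2‖)) ^ (K * N) := by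
    rw [pow_mul, ← mul_pow]
    gcongr
  rw [mul_assoc]
  gcongr
  rw [← div_eq_mul_inv, le_div_iff₀ (by positivity), inv_mul_le_iff₀ (by positivity), mul_comm]
  exact h2

/-- The canonical dual frame of the packets consists of Schwartz functions. -/
theorem IsAdmissiblePair.exists_dual {Ω : Lattice d} {α : ℝ} (hα : 0 < α)
    {φ : 𝓢(Space d, ℂ)} (hadm : IsAdmissiblePair α φ Ω) :
    ∃ φd : Index d → 𝓢(Space d, ℂ),
      IsCanonicalDual (fun i => toL2 (Ω.packet α φ i)) (fun i => toL2 (φd i)) ∧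
      (∀ N : ℕ, ∃ B : ℝ, ∀ i j,
        ‖inner ℂ (toL2 (φd j)) (toL2 (φd i))‖ ≤ B * (gap α (Ω.point i) (Ω.point j) ^ N)⁻¹ ∧
        ‖inner ℂ (toL2 (Ω.packet α φ j)) (toL2 (φd i))‖
          ≤ B * (gap α (Ω.point i) (Ω.point j) ^ N)⁻¹) ∧
      (∀ i j, inner ℂ (toL2 (φd j)) (toL2 (Ω.packet α φ i))
        = inner ℂ (toL2 (Ω.packet α φ j)) (toL2 (φd i))) ∧
      ∀ j, HasSum (fun i => inner ℂ (toL2 (Ω.packet α φ i)) (toL2 (φd j)) • Ω.packet α φ i)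
        (Ω.packet α φ j) := by
  obtain ⟨C, h⟩ := hadm.lattice
  obtain ⟨T, hST, hT, hdec⟩ := hadm.exists_inverse hα
  have hsmul : ∀ (c : ℂ) (ψ : 𝓢(Space d, ℂ)), toL2 (c • ψ) = c • toL2 ψ := fun c ψ =>
    map_smul (SchwartzMap.toLpCLM ℂ ℂ 2 (volume : Measure (Space d))) c ψ
  -- The reconstruction formula for `T` of a packet has coefficients involving `T` twice, which is
  -- why `T²` had to be localized. The series converges in the Schwartz space, and its class is the
  -- `L²` sum.
  have hd : ∀ i, ∃ Φ : 𝓢(Space d, ℂ), toL2 Φ = T (toL2 (Ω.packet α φ i)) := fun i => by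
    obtain ⟨Φ, hΦ⟩ := h.exists_hasSum_packet hα φ (w := Ω.point i)
      (u := fun j => inner ℂ (toL2 (Ω.packet α φ j)) (T (T (toL2 (Ω.packet α φ i)))))
      fun N => (hdec N).imp fun B hB j => (hB i j).2
    have h1 := hasSum_toL2 hΦ
    simp only [hsmul] at h1
    exact ⟨Φ, h1.unique (hST _)⟩
  choose φd hφd using hd
  refine ⟨φd, fun i => ?_, fun N => (hdec N).imp fun B hB i j => ?_, fun i j => ?_, fun j => ?_⟩
  · simpa only [hφd] using hST (toL2 (Ω.packet α φ i))
  · rw [hφd, hφd, hT]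
    exact ⟨(hB i j).2, (hB i j).1⟩
  · rw [hφd, hφd, hT]
  -- Reconstruction of the packet itself; injectivity of the passage to `L²` identifies the Schwartz
  -- sum.
  · obtain ⟨Φ, hΦ⟩ := h.exists_hasSum_packet hα φ (w := Ω.point j)
      (u := fun i => inner ℂ (toL2 (Ω.packet α φ i)) (toL2 (φd j)))
      fun N => (hdec N).imp fun B hB i => by rw [hφd]; exact (hB j i).1
    have h1 := hasSum_toL2 hΦ
    simp only [hsmul, hφd] at h1
    have h2 : Φ = Ω.packet α φ j := toL2_injective (h1.unique (hST _))
    rwa [h2] at hΦ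

theorem hasOffDiagonalDecay_of_gap {Ω : Lattice d} {α : ℝ} (hα : 0 < α)
    {u v : Index d → 𝓢(Space d, ℂ)}
    (h : ∀ N : ℕ, ∃ B : ℝ, ∀ i j,
      ‖inner ℂ (toL2 (v j)) (toL2 (u i))‖ ≤ B * (gap α (Ω.point i) (Ω.point j) ^ N)⁻¹) :
    HasOffDiagonalDecay α Ω u v := by
  intro N
  obtain ⟨n, hn⟩ := exists_nat_ge N
  obtain ⟨C, m, hC, hgap⟩ := exists_quasiDist_le_gap d hα
  obtain ⟨B, hB⟩ := h (m * n)
  refine ⟨|B| * C ^ n, fun i j => (hB i j).trans ?_⟩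
  have hg := one_le_gap α (Ω.point i) (Ω.point j)
  set Q := 1 + quasiDist α (Ω.point i) (Ω.point j) with hQ
  have hQ1 : 1 ≤ Q := by linarith [quasiDist_nonneg α (Ω.point i) (Ω.point j)]
  have h1 : Q ^ n ≤ C ^ n * gap α (Ω.point i) (Ω.point j) ^ (m * n) := by
    rw [pow_mul, ← mul_pow]
    gcongr
    exact hgap _ _
  have h2 : (Q ^ n)⁻¹ ≤ Q ^ (-N) := by
    rw [← Real.rpow_natCast, ← Real.rpow_neg (by positivity)]
    exact Real.rpow_le_rpow_of_exponent_le hQ1 (by linarith)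
  calc B * (gap α (Ω.point i) (Ω.point j) ^ (m * n))⁻¹
      ≤ |B| * (C ^ n * (Q ^ n)⁻¹) := by
        gcongr
        · exact le_abs_self B
        · rw [← div_eq_mul_inv, le_div_iff₀ (by positivity), inv_mul_le_iff₀ (by positivity),
            mul_comm]
          exact h1
    _ ≤ |B| * (C ^ n * Q ^ (-N)) := by gcongr
    _ = _ := by ring

/-- Applying `f` to the Schwartz-convergent expansion of the packet `j` expresses its coefficient as
a series in all the coefficients of `f`. This replaces the `L²` expansion, which is unavailable for
a distribution. Subtracting the finite sum removes exactly the terms with index in `F`. -/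
theorem coeff_sub_sum {Ω : Lattice d} {α : ℝ} {φ : 𝓢(Space d, ℂ)} {φd : Index d → 𝓢(Space d, ℂ)}
    (hsymm : ∀ i j, inner ℂ (toL2 (φd j)) (toL2 (Ω.packet α φ i))
      = inner ℂ (toL2 (Ω.packet α φ j)) (toL2 (φd i)))
    (hrep : ∀ j, HasSum (fun i => inner ℂ (toL2 (Ω.packet α φ i)) (toL2 (φd j)) • Ω.packet α φ i)
      (Ω.packet α φ j)) (f : 𝓢'(Space d, ℂ)) (F : Finset (Index d)) (j : Index d) :
    HasSum ((F : Set (Index d))ᶜ.indicator fun i =>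
        inner ℂ (toL2 (Ω.packet α φ j)) (toL2 (φd i)) * coeff α φ Ω f i)
      (coeff α φ Ω (f - ofSchwartz (∑ i ∈ F, coeff α φ Ω f i • φd i)) j) := by
  have h1 : HasSum (fun i => inner ℂ (toL2 (Ω.packet α φ j)) (toL2 (φd i)) * coeff α φ Ω f i)
      (coeff α φ Ω f j) := by
    have := hasSum_pair (hrep j) f
    simp only [pair_smul, inner_conj_symm] at this
    simp only [hsymm] at this
    exact this
  have h2 : coeff α φ Ω (f - ofSchwartz (∑ i ∈ F, coeff α φ Ω f i • φd i)) j
      = coeff α φ Ω f j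
        - ∑ i ∈ F, inner ℂ (toL2 (Ω.packet α φ j)) (toL2 (φd i)) * coeff α φ Ω f i := by
    have h3 : toL2 (∑ i ∈ F, coeff α φ Ω f i • φd i)
        = ∑ i ∈ F, coeff α φ Ω f i • toL2 (φd i) := by
      change SchwartzMap.toLpCLM ℂ ℂ 2 (volume : Measure (Space d)) _ = _
      rw [map_sum]
      exact Finset.sum_congr rfl fun i _ => map_smul _ _ _
    have h4 : pair (ofSchwartz (∑ i ∈ F, coeff α φ Ω f i • φd i)) (Ω.packet α φ j)
        = ∑ i ∈ F, inner ℂ (toL2 (Ω.packet α φ j)) (toL2 (φd i)) * coeff α φ Ω f i := by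
      rw [pair_ofSchwartz, h3, inner_sum]
      exact Finset.sum_congr rfl fun i _ => by rw [inner_smul_right, mul_comm]
    rw [← h4]
    rfl
  rw [h2, ← hasSum_subtype_iff_indicator]
  have h3 := (F.hasSum_compl_iff (a := coeff α φ Ω f j
    - ∑ i ∈ F, inner ℂ (toL2 (Ω.packet α φ j)) (toL2 (φd i)) * coeff α φ Ω f i)).2
    (by rwa [sub_add_cancel])
  exact h3

/-- The error has as coefficients an almost diagonal matrix applied to the tail of those of `f`: the
matrix is bounded in the mixed norm, and the tail vanishes in the limit. -/
theorem IsAdmissiblePair.tendsto_modNorm {Ω : Lattice d} {α : ℝ} (hα : 0 < α)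
    {φ : 𝓢(Space d, ℂ)} (hadm : IsAdmissiblePair α φ Ω) {φd : Index d → 𝓢(Space d, ℂ)}
    (hdec : ∀ N : ℕ, ∃ B : ℝ, ∀ i j, ‖inner ℂ (toL2 (Ω.packet α φ j)) (toL2 (φd i))‖
      ≤ B * (gap α (Ω.point i) (Ω.point j) ^ N)⁻¹)
    (hsymm : ∀ i j, inner ℂ (toL2 (φd j)) (toL2 (Ω.packet α φ i))
      = inner ℂ (toL2 (Ω.packet α φ j)) (toL2 (φd i)))
    (hrep : ∀ j, HasSum (fun i => inner ℂ (toL2 (Ω.packet α φ i)) (toL2 (φd j)) • Ω.packet α φ i)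
      (Ω.packet α φ j)) (β : ℝ) {p q : ℝ} (hp : 1 ≤ p) (hq : 1 ≤ q) {f : 𝓢'(Space d, ℂ)}
    (hf : f ∈ modSpace α β p q φ Ω) :
    Tendsto (fun F : Finset (Index d) => modNorm α β p q φ Ω
      (f - ofSchwartz (∑ i ∈ F, coeff α φ Ω f i • φd i))) atTop (𝓝 0) := by
  obtain ⟨C, h⟩ := hadm.lattice
  obtain ⟨N, K, hK, hN⟩ := h.exists_mixNorm_le hα β hp hq
  obtain ⟨B, hB⟩ := hdec N
  rw [mem_modSpace_iff hq] at hf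
  have hq0 : 0 < q := by linarith
  have hq1 : 0 < 1 / q := by positivity
  set w : ℕ → ℝ≥0∞ := fun k => ENNReal.ofReal (weight β (Ω.freq k)) with hw
  set a : Index d → ℝ≥0∞ := fun i => ENNReal.ofReal B * ‖coeff α φ Ω f i‖ₑ with ha
  have ha' : mixNorm p q w a ≠ ∞ := by
    rw [mixNorm_const_mul hp hq]
    exact ENNReal.mul_ne_top (ENNReal.rpow_ne_top_of_nonneg hq0.le ENNReal.ofReal_ne_top) hf
  have htail := tendsto_mixNorm_tail hp hq
    (fun k => (ENNReal.ofReal_pos.2 (weight_pos β (Ω.freq k))).ne')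
    (fun k => ENNReal.ofReal_ne_top) ha'
  have hle : ∀ F : Finset (Index d), mixNorm p q w (fun j =>
      ‖coeff α φ Ω (f - ofSchwartz (∑ i ∈ F, coeff α φ Ω f i • φd i)) j‖ₑ)
        ≤ K * mixNorm p q w ((F : Set (Index d))ᶜ.indicator a) := by
    refine fun F => hN _ _ fun j => ?_
    rw [← (coeff_sub_sum hsymm hrep f F j).tsum_eq]
    refine enorm_tsum_le_tsum_enorm.trans (ENNReal.tsum_le_tsum fun i => ?_)
    by_cases hi : i ∈ (F : Set (Index d))ᶜ
    · rw [Set.indicator_of_mem hi, Set.indicator_of_mem hi, enorm_mul, ha, ← mul_assoc]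
      gcongr
      have hg := one_le_gap α (Ω.point j) (Ω.point i)
      rw [← ofReal_norm, mul_comm, ← ENNReal.ofReal_mul' (by positivity)]
      refine ENNReal.ofReal_le_ofReal ?_
      -- `gap` must be based at the output index `j`, so the decay is read off the transposed entry.
      rw [← hsymm, norm_inner_symm]
      exact hB j i
    · simp [Set.indicator_of_notMem hi]
  have h1 := ENNReal.Tendsto.const_mul (a := K) htail (Or.inr hK)
  rw [mul_zero] at h1
  have h2 := tendsto_of_tendsto_of_tendsto_of_le_of_le tendsto_const_nhds h1
    (fun _ => zero_le) hle
  have h3 := ((ENNReal.continuous_rpow_const (y := 1 / q)).tendsto 0).comp h2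
  rw [ENNReal.zero_rpow_of_pos hq1] at h3
  exact h3

end

end Dispersive
end

/-! ### Density and convergence of truncated dual expansions -/

theorem proposition4p9 (d : ℕ) (α : ℝ) (hα : 0 < α) (φ : 𝓢(Dispersive.Space d, ℂ))
    (Ω : Dispersive.Lattice d) (hadm : Dispersive.IsAdmissiblePair α φ Ω) :
    (∀ β p q : ℝ, 1 ≤ p → 1 ≤ q →
      (∀ g : 𝓢(Dispersive.Space d, ℂ),
        Dispersive.ofSchwartz g ∈ Dispersive.modSpace α β p q φ Ω) ∧
      (∀ f ∈ Dispersive.modSpace α β p q φ Ω, ∀ ε : ℝ≥0∞, 0 < ε →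
        ∃ g : 𝓢(Dispersive.Space d, ℂ),
          Dispersive.modNorm α β p q φ Ω (f - Dispersive.ofSchwartz g) < ε)) ∧
    (∃ φd : Dispersive.Index d → 𝓢(Dispersive.Space d, ℂ),
      Dispersive.IsCanonicalDual (fun i => Dispersive.toL2 (Ω.packet α φ i))
        (fun i => Dispersive.toL2 (φd i)) ∧
      Dispersive.HasOffDiagonalDecay α Ω φd φd ∧
      Dispersive.HasOffDiagonalDecay α Ω φd (Ω.packet α φ) ∧
      ∀ β p q : ℝ, 1 ≤ p → 1 ≤ q → ∀ f ∈ Dispersive.modSpace α β p q φ Ω,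
        Tendsto (fun F : Finset (Dispersive.Index d) =>
          Dispersive.modNorm α β p q φ Ω
            (f - Dispersive.ofSchwartz (∑ i ∈ F, Dispersive.coeff α φ Ω f i • φd i)))
          atTop (𝓝 0)) := by
  obtain ⟨φd, hdual, hdec, hsymm, hrep⟩ := hadm.exists_dual hα
  have hlim := fun (β p q : ℝ) (hp : 1 ≤ p) (hq : 1 ≤ q) (f : 𝓢'(Dispersive.Space d, ℂ))
      (hf : f ∈ Dispersive.modSpace α β p q φ Ω) =>
    hadm.tendsto_modNorm hα (fun N => (hdec N).imp fun B hB i j => (hB i j).2) hsymm hrep β hp hq hf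
  refine ⟨fun β p q hp hq => ⟨hadm.ofSchwartz_mem_modSpace hα β hp hq, fun f hf ε hε => ?_⟩,
    φd, hdual, ?_, ?_, hlim⟩
  · obtain ⟨F, hF⟩ := ((hlim β p q hp hq f hf).eventually_lt_const hε).exists
    exact ⟨_, hF⟩
  · exact Dispersive.hasOffDiagonalDecay_of_gap hα
      fun N => (hdec N).imp fun B hB i j => (hB i j).1
  · exact Dispersive.hasOffDiagonalDecay_of_gap hα
      fun N => (hdec N).imp fun B hB i j => (hB i j).2
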